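/- Let $\Omega=(0,1)^2$, $1\le p,q\le 2$, $\nu_1,\nu_2\in\mathbb R$. \emph{Framelets.} Let $m\ge 1$ and let $\phi_0$ be the univariate B-spline of order $m$ (the $m$-fold convolution power of $\chi_{[0,1]}$) shifted to the left by $\lfloor m/2\rfloor$. For $0\le\ell\le m$ let $q_\ell$ be the filter on $\mathbb Z$ with $\sum_k q_\ell[k]z^k=(-1)^{\lfloor \ell/2\rfloor}\sqrt{\binom m\ell}\,2^{-m}z^{-\lfloor m/2\rfloor}(1-z)^\ell(1+z)^{m-\ell}$ (the B-spline tight frame filters), and for $\beta=(\beta_1,\beta_2)\in\{0,\dots,m\}^2$ put $q^{(\beta)}[k]=q_{\beta_1}[k_1]q_{\beta_2}[k_2]$, $\phi(x)=\phi_0(x_1)\phi_0(x_2)$, $\psi_\beta=4\sum_k q^{(\beta)}[k]\phi(2\cdot-k)$. Let $\beta^1,\dots,\beta^J\in\{0,\dots,m\}^2\setminus\{(0,0)\}$, $J\ge1$, be the bands used; write $q^{(j)},\psi_j$ for $q^{(\beta^j)},\psi_{\beta^j}$, let $D_j=\partial_1^{\beta^j_1}\partial_2^{\beta^j_2}$ be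 the associated differential operator, $s_j=\beta_1^j+\beta_2^j$ its order, and $s=\max_j s_j$. Let $\varphi_j$ be the compactly supported function with $D_j\varphi_j=\psi_j$ and $c_j=\int\varphi_j\ (\neq 0)$; let $\varphi_{ij}$ be the compactly supported function with $D_i\varphi_{ij}=4c_j^{-1}\sum_l q^{(i)}[l]\varphi_j(2\cdot-l/2)$ and $c_{ij}=\int\varphi_{ij}\ (\neq0)$. Put $\phi_{n,k}=2^n\phi(2^n\cdot-k)$ and $\varphi_{j,n-1,k}=2^{n-2}\varphi_j(2^{n-1}\cdot-k/2)$. \emph{Discretization.} Let $M_n=\{k\in\mathbb Z^2:\operatorname{supp}\phi_{n,k}\subset\overline\Omega\}$ and, for a fixed integer $C\ge2$, $K_n=\{k\in M_n: k+C\operatorname{supp}q^{(\beta)}\subset M_n\ \text{for all }\beta\in\{0,\dots,m\}^2\}$. Define $(T_nu)[k]=2^n\langle u,\phi_{n,k}\rangle_{L_2(\Omega)}$ and $(S_nv)[j;k]=2^n\langle v_j,c_j^{-1}\varphi_{j,n-1,k}\rangle_{L_2(\Omega)}$ for $k\in M_n$, and for $k\in K_n$ and arrays $\mathbf u$, $\mathbf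 v=(\mathbf v[1;\cdot],\dots,\mathbf v[J;\cdot])$ on $M_n$ $$(W_n'\mathbf u)[j;k]=c_j^{-1}(-1)^{s_j}2^{(n-1)s_j}\sum_l q^{(j)}[l]\,\mathbf u[k+l],\qquad (W_n''\mathbf v)[i,j;k]=c_{ij}^{-1}(-1)^{s_i}2^{(n-2)s_i}\sum_l q^{(i)}[l]\,\mathbf v[j;k+l].$$ For arrays on $K_n$ with several components let $\|\mathbf a\|_{\ell_p(K_n;\ell_2)}=\bigl(2^{-2n}\sum_{k\in K_n}(\sum_i|\mathbf a[i;k]|^2)^{p/2}\bigr)^{1/p}$. Let $A:L_2(\Omega)\to L_2(\Omega)$ be linear, $f\in L_2(\Omega)$, and let $A_n:\mathbb R^{M_n}\to\mathbb R^{K_n}$ be linear maps with $\lim_{n\to\infty}\|T_nAu-A_nT_nu\|_{\ell_2(K_n)}=0$ for all $u\in L_2(\Omega)$. Put $$F_n(\mathbf u,\mathbf v)=\nu_1\|W_n'\mathbf u-\mathbf v\|^p_{\ell_p(K_n;\ell_2)}+\nu_2\|W_n''\mathbf v\|^q_{\ell_q(K_n;\ell_2)}+\tfrac12\|A_n\mathbf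 u-T_nf\|^2_{\ell_2(K_n)},\qquad E_n(u,v)=F_n(T_nu,S_nv),$$ $$E(u,v)=\nu_1\int_\Omega\Bigl(\sum_{j}|D_ju-v_j|^2\Bigr)^{p/2}dx+\nu_2\int_\Omega\Bigl(\sum_{i,j}|D_iv_j|^2\Bigr)^{q/2}dx+\tfrac12\|Au-f\|_{L_2(\Omega)}^2 .$$ \textbf{Theorem.} For $(u,v)\in W^p_{2s}(\Omega)\times W^q_s(\Omega;\mathbb R^J)$ one has $u\in L_2(\Omega)$ and $v\in L_p(\Omega;\mathbb R^J)$, so that $E(u,v)$ is well defined and finite. For every sequence $(u_n,v_n)\to(u,v)$ in $W^p_{2s}(\Omega)\times W^q_s(\Omega;\mathbb R^J)$ one has $\lim_{n\to\infty}E_n(u_n,v_n)=E(u,v)$. Consequently $E_n$ $\Gamma$-converges to $E$ in $W^p_{2s}(\Omega)\times W^q_s(\Omega;\mathbb R^J)$, i.e. $\liminf_n E_n(u_n,v_n)\ge E(u,v)$ whenever $(u_n,v_n)\to(u,v)$, and every $(u,v)$ is the limit of some sequence $(u_n',v_n')$ with $\limsup_n E_n(u'_n,v'_n)\le E(u,v)$.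 -/

import Mathlib

open MeasureTheory Filter Topology
open scoped ENNReal ContDiff

namespace WaveletFrame

noncomputable section

/-! ### The domain, weak derivatives and Sobolev spaces -/

/-- The open unit square. -/
def Ω : Set (ℝ × ℝ) := Set.Ioo 0 1 ×ˢ Set.Ioo 0 1

/-- Lebesgue measure on the open unit square. -/
abbrev μΩ : Measure (ℝ × ℝ) := volume.restrict Ω

instance : IsFiniteMeasure μΩ :=
  ⟨by
    rw [Measure.restrict_apply_univ]
    refine lt_of_le_of_lt (measure_mono (t := Set.Icc ((0 : ℝ), (0 : ℝ)) (1, 1)) ?_)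
      isCompact_Icc.measure_lt_top
    rintro ⟨x, y⟩ ⟨hx, hy⟩
    exact ⟨⟨hx.1.le, hy.1.le⟩, ⟨hx.2.le, hy.2.le⟩⟩⟩

/-- The classical partial derivative in the direction `e`. -/
def pd (e : ℝ × ℝ) (η : ℝ × ℝ → ℝ) : ℝ × ℝ → ℝ := fun x => fderiv ℝ η x e

/-- The classical partial derivative `∂₁^{α₁} ∂₂^{α₂} η`. -/
def pderiv (α : ℕ × ℕ) (η : ℝ × ℝ → ℝ) : ℝ × ℝ → ℝ :=
  (pd (1, 0))^[α.1] ((pd (0, 1))^[α.2] η)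

/-- Test functions: smooth, with compact support contained in `Ω`. -/
def IsTest (η : ℝ × ℝ → ℝ) : Prop :=
  ContDiff ℝ ∞ η ∧ HasCompactSupport η ∧ tsupport η ⊆ Ω

/-- `g` is the weak derivative `∂^α u` on `Ω`. -/
def HasWeakDeriv (α : ℕ × ℕ) (u g : ℝ × ℝ → ℝ) : Prop :=
  ∀ η : ℝ × ℝ → ℝ, IsTest η →
    ∫ x, u x * pderiv α η x ∂μΩ = (-1) ^ (α.1 + α.2) * ∫ x, g x * η x ∂μΩ

theorem pd_iterate_smooth (e : ℝ × ℝ) (k : ℕ) {η : ℝ × ℝ → ℝ}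
    (h : ContDiff ℝ ∞ η ∧ HasCompactSupport η) :
    ContDiff ℝ ∞ ((pd e)^[k] η) ∧ HasCompactSupport ((pd e)^[k] η) := by
  induction k with
  | zero => exact h
  | succ k ih =>
    rw [Function.iterate_succ_apply']
    exact ⟨(ih.1.fderiv_right (m := ∞) (by simp)).clm_apply contDiff_const,
      ih.2.fderiv_apply ℝ e⟩

theorem integrable_mul_pderiv {p : ℝ≥0∞} [hp : Fact (1 ≤ p)] (u : Lp ℝ p μΩ) (α : ℕ × ℕ)
    {η : ℝ × ℝ → ℝ} (hη : IsTest η) : Integrable (fun x => u x * pderiv α η x) μΩ := by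
  have h := pd_iterate_smooth (1, 0) α.1 (pd_iterate_smooth (0, 1) α.2 ⟨hη.1, hη.2.1⟩)
  obtain ⟨c, hc⟩ := h.2.exists_bound_of_continuous h.1.continuous
  exact ((Lp.memLp u).integrable hp.out).mul_bdd (c := c)
    h.1.continuous.aestronglyMeasurable (Eventually.of_forall hc)

/-- The multi-indices of order at most `k`. -/
def multiIdx (k : ℕ) : Finset (ℕ × ℕ) :=
  (Finset.range (k + 1) ×ˢ Finset.range (k + 1)).filter fun α => α.1 + α.2 ≤ k

theorem mem_multiIdx {k : ℕ} {α : ℕ × ℕ} (h : α.1 + α.2 ≤ k) : α ∈ multiIdx k := by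
  simp only [multiIdx, Finset.mem_filter, Finset.mem_product, Finset.mem_range]
  omega

/-- The multi-index `0`. -/
def zeroIdx (k : ℕ) : multiIdx k := ⟨(0, 0), mem_multiIdx (Nat.zero_le k)⟩

/-- The Sobolev space `W_k^p(Ω)`: a function is recorded together with its weak derivatives of
order at most `k`, all in `L_p(Ω)`, and the norm is `(∑_{|α| ≤ k} ‖∂^α u‖_p^p)^{1/p}`. -/
def Sobolev (k : ℕ) (p : ℝ≥0∞) [Fact (1 ≤ p)] :
    Submodule ℝ (PiLp p fun _ : multiIdx k => Lp ℝ p μΩ) where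
  carrier := {g | ∀ α : multiIdx k, HasWeakDeriv α (g (zeroIdx k)) (g α)}
  zero_mem' := by
    intro α η _
    have h0 : ((0 : Lp ℝ p μΩ) : ℝ × ℝ → ℝ) =ᵐ[μΩ] 0 := Lp.coeFn_zero ℝ p μΩ
    have h (ζ : ℝ × ℝ → ℝ) : ∫ x, (0 : Lp ℝ p μΩ) x * ζ x ∂μΩ = 0 := by
      rw [integral_congr_ae (g := fun _ => (0 : ℝ))
        (h0.mono fun x hx => by dsimp only; rw [hx]; simp)]
      simp
    simp only [PiLp.zero_apply]
    rw [h, h, mul_zero]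
  add_mem' := by
    intro a b ha hb α η hη
    have h (u v : Lp ℝ p μΩ) (β : ℕ × ℕ) : ∫ x, (u + v) x * pderiv β η x ∂μΩ =
        ∫ x, u x * pderiv β η x ∂μΩ + ∫ x, v x * pderiv β η x ∂μΩ := by
      rw [← integral_add (integrable_mul_pderiv _ _ hη) (integrable_mul_pderiv _ _ hη)]
      refine integral_congr_ae ((Lp.coeFn_add u v).mono fun x hx => ?_)
      dsimp only
      rw [hx, Pi.add_apply, add_mul]
    have h1 := h (a α) (b α) (0, 0)
    simp only [pderiv, Function.iterate_zero, id_eq] at h1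
    simp only [PiLp.add_apply]
    rw [h, h1, ha α η hη, hb α η hη, mul_add]
  smul_mem' := by
    intro c a ha α η hη
    have h (u : Lp ℝ p μΩ) (ζ : ℝ × ℝ → ℝ) : ∫ x, (c • u) x * ζ x ∂μΩ =
        c * ∫ x, u x * ζ x ∂μΩ := by
      rw [← integral_const_mul]
      refine integral_congr_ae ((Lp.coeFn_smul c u).mono fun x hx => ?_)
      dsimp only
      rw [hx, Pi.smul_apply, smul_eq_mul, mul_assoc]
    simp only [PiLp.smul_apply]
    rw [h, h, ha α η hη]
    ring

/-- The underlying function of an element of `W_k^p(Ω)`. -/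
def fn {k : ℕ} {p : ℝ≥0∞} [Fact (1 ≤ p)] (u : Sobolev k p) : Lp ℝ p μΩ :=
  u.1 (zeroIdx k)

/-- The weak derivative `∂^α u` of `u ∈ W_k^p(Ω)`, for `|α| ≤ k`. -/
def wderiv {k : ℕ} {p : ℝ≥0∞} [Fact (1 ≤ p)] (u : Sobolev k p) (α : ℕ × ℕ)
    (hα : α.1 + α.2 ≤ k) : Lp ℝ p μΩ :=
  u.1 ⟨α, mem_multiIdx hα⟩

open Classical in
/-- A function class of `L_p(Ω)` regarded as an element of `L_2(Ω)`, whenever it lies there. -/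
def toL2 {p : ℝ≥0∞} (u : Lp ℝ p μΩ) : Lp ℝ 2 μΩ :=
  if h : MemLp u 2 μΩ then h.toLp u else 0

/-! ### B-splines, filters and framelets in one variable -/

/-- The cardinal B-spline of order `m ≥ 1`, supported on `[0, m]`. -/
def bspline : ℕ → ℝ → ℝ
  | 0 => 0
  | 1 => Set.indicator (Set.Icc 0 1) 1
  | m + 2 => fun x => ∫ t in (0 : ℝ)..1, bspline (m + 1) (x - t)

/-- The univariate refinable function: the B-spline of order `m`, shifted by the integer `⌊m/2⌋`
so as to be centred at `0` for even `m` and at `1/2` for odd `m`. -/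
def phi₁ (m : ℕ) (x : ℝ) : ℝ := bspline m (x + (m / 2 : ℕ))

/-- The univariate B-spline tight framelet filters of order `m`, `0 ≤ ℓ ≤ m`, with Fourier series
`± i^ℓ e^{-iκξ/2} √(m choose ℓ) sin^ℓ(ξ/2) cos^{m-ℓ}(ξ/2)`, where `κ ∈ {0, 1}` is the parity of
`m` and the sign is `(-1)^⌊ℓ/2⌋`. With `z = e^{-iξ}` this is
`± √(m choose ℓ) 2^{-m} z^{-⌊m/2⌋} (1 - z)^ℓ (1 + z)^{m-ℓ}`. -/
def filter₁ (m ℓ : ℕ) (k : ℤ) : ℝ :=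
  if 0 ≤ k + (m / 2 : ℕ) then
    (-1) ^ (ℓ / 2) * √(m.choose ℓ) / 2 ^ m *
      ((1 - Polynomial.X) ^ ℓ * (1 + Polynomial.X) ^ (m - ℓ) : Polynomial ℝ).coeff
        (k + (m / 2 : ℕ)).toNat
  else 0

/-- The integer interval `{-⌊m/2⌋, …, m - ⌊m/2⌋}` outside which all filters vanish. -/
def box₁ (m : ℕ) : Finset ℤ := Finset.Icc (-((m / 2 : ℕ) : ℤ)) (m - (m / 2 : ℕ))

/-- The univariate framelets `ψ_ℓ = 2 ∑_k q_ℓ[k] φ(2· - k)`. -/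
def psi₁ (m ℓ : ℕ) (x : ℝ) : ℝ := 2 * ∑ k ∈ box₁ m, filter₁ m ℓ k * phi₁ m (2 * x - k)

/-- The antiderivative vanishing at `-∞`. -/
def prim (g : ℝ → ℝ) (x : ℝ) : ℝ := ∫ t in Set.Iic x, g t

/-- The compactly supported function `φ_ℓ` with `φ_ℓ^{(ℓ)} = ψ_ℓ`. -/
def vphi₁ (m ℓ : ℕ) : ℝ → ℝ := prim^[ℓ] (psi₁ m ℓ)

/-- `c_ℓ = ∫ φ_ℓ`. -/
def c₁ (m ℓ : ℕ) : ℝ := ∫ x, vphi₁ m ℓ x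

/-- The compactly supported function `φ_{aℓ}` whose `a`-th derivative is
`2 c_ℓ⁻¹ ∑_k q_a[k] φ_ℓ(2· - k/2)`. -/
def vphi₂ (m a ℓ : ℕ) : ℝ → ℝ :=
  prim^[a] fun y => 2 * (c₁ m ℓ)⁻¹ * ∑ k ∈ box₁ m, filter₁ m a k * vphi₁ m ℓ (2 * y - k / 2)

/-- `c_{aℓ} = ∫ φ_{aℓ}`. -/
def c₂ (m a ℓ : ℕ) : ℝ := ∫ x, vphi₂ m a ℓ x

/-! ### Tensor products. A band is a pair `β = (β₁, β₂)` with `0 ≤ β₁, β₂ ≤ m`; the band `(0, 0)`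
is the low-pass one, the others are the framelets; the differential operator associated with
`β` is `∂₁^{β₁} ∂₂^{β₂}`. -/

/-- The order of the differential operator of a band. -/
def ord (β : ℕ × ℕ) : ℕ := β.1 + β.2

/-- The bivariate filter `q^{(β)}`. -/
def filt (m : ℕ) (β : ℕ × ℕ) (k : ℤ × ℤ) : ℝ := filter₁ m β.1 k.1 * filter₁ m β.2 k.2

/-- `c_β = ∫ φ_β`. -/
def cst (m : ℕ) (β : ℕ × ℕ) : ℝ := c₁ m β.1 * c₁ m β.2

/-- `c_{γβ} = ∫ φ_{γβ}`. -/
def cst₂ (m : ℕ) (γ β : ℕ × ℕ) : ℝ := c₂ m γ.1 β.1 * c₂ m γ.2 β.2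

/-- `φ_{n,k} = 2^n φ(2^n · - k)`. -/
def phi (m n : ℕ) (k : ℤ × ℤ) (x : ℝ × ℝ) : ℝ :=
  2 ^ n * (phi₁ m (2 ^ n * x.1 - k.1) * phi₁ m (2 ^ n * x.2 - k.2))

/-- `φ_{β,n-1,k} = 2^{n-2} φ_β(2^{n-1} · - k/2)`. -/
def vphi (m : ℕ) (β : ℕ × ℕ) (n : ℕ) (k : ℤ × ℤ) (x : ℝ × ℝ) : ℝ :=
  (2 : ℝ) ^ ((n : ℤ) - 2) *
    (vphi₁ m β.1 ((2 : ℝ) ^ ((n : ℤ) - 1) * x.1 - k.1 / 2) *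
      vphi₁ m β.2 ((2 : ℝ) ^ ((n : ℤ) - 1) * x.2 - k.2 / 2))

/-! ### Index sets, sampling operators and transforms -/

/-- `O_n`: the `k ∈ ℤ²` with `2^{-n} k` in the closed unit square. -/
def O (n : ℕ) : Finset (ℤ × ℤ) := Finset.Icc 0 (2 ^ n) ×ˢ Finset.Icc 0 (2 ^ n)

open Classical in
/-- `M_n`: the indices for which `supp φ_{n,k}` lies in the closed unit square. -/
def M (m n : ℕ) : Finset (ℤ × ℤ) :=
  (O n).filter fun k => tsupport (phi m n k) ⊆ closure Ω

open Classical in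
/-- `K_n`: the `k ∈ M_n` such that `k + C · supp q^{(β)} ⊆ M_n` for all bands `β`. -/
def K (m C n : ℕ) : Finset (ℤ × ℤ) :=
  (M m n).filter fun k =>
    ∀ β : ℕ × ℕ, β.1 ≤ m → β.2 ≤ m → ∀ l : ℤ × ℤ, filt m β l ≠ 0 → k + (C : ℤ) • l ∈ M m n

open Classical in
/-- `K_n ⊆ M_n`. -/
def toM {m C n : ℕ} (k : K m C n) : M m n := ⟨k.1, (Finset.mem_filter.1 k.2).1⟩

/-- The array `a` on `M_n`, extended by `0`. -/
def ext {m n : ℕ} (a : M m n → ℝ) (k : ℤ × ℤ) : ℝ := if h : k ∈ M m n then a ⟨k, h⟩ else 0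

/-- `(q^{(β)}[-·] ⊛ a)[k] = ∑_l q^{(β)}[l] a[k + l]`, for `k ∈ K_n`. -/
def conv {m n : ℕ} (C : ℕ) (β : ℕ × ℕ) (a : M m n → ℝ) (k : K m C n) : ℝ :=
  ∑ l ∈ box₁ m ×ˢ box₁ m, filt m β l * ext a (k.1 + l)

/-- The sampling operator `T_n`. -/
def T (m n : ℕ) (g : ℝ × ℝ → ℝ) (k : M m n) : ℝ := 2 ^ n * ∫ x, g x * phi m n k x ∂μΩ

/-- The sampling operator `S_n` associated with the bands `α 1, …, α J`. -/
def S (m n : ℕ) {J : ℕ} (α : Fin J → ℕ × ℕ) (v : Fin J → ℝ × ℝ → ℝ) (j : Fin J)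
    (k : M m n) : ℝ :=
  2 ^ n * ∫ x, v j x * ((cst m (α j))⁻¹ * vphi m (α j) n k x) ∂μΩ

/-- The weighted transform `W'_n`, with weights `λ'_j = c_j⁻¹ (-1)^{s_j} 2^{(n-1) s_j}`. -/
def W' (m C n : ℕ) {J : ℕ} (α : Fin J → ℕ × ℕ) (u : M m n → ℝ) (j : Fin J)
    (k : K m C n) : ℝ :=
  (cst m (α j))⁻¹ * (-1) ^ ord (α j) * (2 : ℝ) ^ (((n : ℤ) - 1) * ord (α j)) *
    conv C (α j) u k

/-- The weighted transform `W''_n`, with weights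
`λ''_{ij} = c_{ij}⁻¹ (-1)^{s_i} 2^{(n-2) s_i}`. -/
def W'' (m C n : ℕ) {J : ℕ} (α : Fin J → ℕ × ℕ) (v : Fin J → M m n → ℝ)
    (ij : Fin J × Fin J) (k : K m C n) : ℝ :=
  (cst₂ m (α ij.1) (α ij.2))⁻¹ * (-1) ^ ord (α ij.1) *
    (2 : ℝ) ^ (((n : ℤ) - 2) * ord (α ij.1)) * conv C (α ij.1) (v ij.2) k

/-- The norm of `ℓ_p(K_n; ℓ_2)`. -/
def arrayNorm {m C n : ℕ} {ι : Type} [Fintype ι] (p : ℝ≥0∞) (a : ι → K m C n → ℝ) : ℝ :=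
  ((2 ^ (2 * n))⁻¹ * ∑ k, (∑ i, |a i k| ^ 2) ^ (p.toReal / 2)) ^ (1 / p.toReal)

/-- The norm of `ℓ_2(K_n)`. -/
def arrayNorm₂ {m C n : ℕ} (a : K m C n → ℝ) : ℝ :=
  √((2 ^ (2 * n))⁻¹ * ∑ k, |a k| ^ 2)

/-- The norm of `L_p(Ω; ℓ_2)`. -/
def vecNorm {ι : Type} [Fintype ι] (p : ℝ≥0∞) (g : ι → ℝ × ℝ → ℝ) : ℝ :=
  (∫ x, (∑ i, |g i x| ^ 2) ^ (p.toReal / 2) ∂μΩ) ^ (1 / p.toReal)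

/-! ### The energies -/

/-- The order `s = max_j |D_j|` of the differential operator `D' = (D_1, …, D_J)`. -/
def order {J : ℕ} (α : Fin J → ℕ × ℕ) : ℕ := Finset.univ.sup fun j => ord (α j)

theorem ord_le_order {J : ℕ} (α : Fin J → ℕ × ℕ) (j : Fin J) :
    (α j).1 + (α j).2 ≤ order α :=
  Finset.le_sup (f := fun j => ord (α j)) (Finset.mem_univ j)

theorem ord_le_two_order {J : ℕ} (α : Fin J → ℕ × ℕ) (j : Fin J) :
    (α j).1 + (α j).2 ≤ 2 * order α :=
  (ord_le_order α j).trans (Nat.le_mul_of_pos_left _ two_pos)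

/-- The discrete objective function `F_n`. -/
def F {m C n J : ℕ} (α : Fin J → ℕ × ℕ) (p q : ℝ≥0∞) (ν₁ ν₂ : ℝ)
    (A : (M m n → ℝ) →ₗ[ℝ] (K m C n → ℝ)) (f : M m n → ℝ)
    (u : M m n → ℝ) (v : Fin J → M m n → ℝ) : ℝ :=
  ν₁ * arrayNorm p (fun j k => W' m C n α u j k - v j (toM k)) ^ p.toReal
    + ν₂ * arrayNorm q (W'' m C n α v) ^ q.toReal
    + 1 / 2 * arrayNorm₂ (fun k => A u k - f (toM k)) ^ 2

/-- The space `W_{2s}^p(Ω) × W_s^q(Ω; ℝ^J)`. -/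
abbrev Space {J : ℕ} (α : Fin J → ℕ × ℕ) (p q : ℝ≥0∞) [Fact (1 ≤ p)] [Fact (1 ≤ q)] : Type :=
  Sobolev (2 * order α) p × (Fin J → Sobolev (order α) q)

/-- `E_n(u, v) = F_n(T_n u, S_n v)`, with data `f_n = T_n f`. -/
def En (m C n : ℕ) {J : ℕ} (α : Fin J → ℕ × ℕ) (p q : ℝ≥0∞) [Fact (1 ≤ p)] [Fact (1 ≤ q)]
    (ν₁ ν₂ : ℝ) (A : (M m n → ℝ) →ₗ[ℝ] (K m C n → ℝ)) (f : Lp ℝ 2 μΩ)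
    (w : Space α p q) : ℝ :=
  F α p q ν₁ ν₂ A (T m n f) (T m n (fn w.1)) (S m n α fun j => fn (w.2 j))

/-- `E(u, v) = ν₁ ‖D'u - v‖_p^p + ν₂ ‖D''v‖_q^q + ½ ‖Au - f‖_2²`. -/
def E {J : ℕ} (α : Fin J → ℕ × ℕ) (p q : ℝ≥0∞) [Fact (1 ≤ p)] [Fact (1 ≤ q)]
    (ν₁ ν₂ : ℝ) (A : Lp ℝ 2 μΩ →ₗ[ℝ] Lp ℝ 2 μΩ) (f : Lp ℝ 2 μΩ) (w : Space α p q) : ℝ :=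
  ν₁ * vecNorm p (fun j x =>
      wderiv w.1 (α j) (ord_le_two_order α j) x - fn (w.2 j) x) ^ p.toReal
    + ν₂ * vecNorm q (fun (ij : Fin J × Fin J) x =>
      wderiv (w.2 ij.2) (α ij.1) (ord_le_order α ij.1) x) ^ q.toReal
    + 1 / 2 * ‖A (toL2 (fn w.1)) - f‖ ^ 2

/-- Sequential Γ-convergence of real functionals. -/
def GammaConverges {X : Type} [TopologicalSpace X] (G : ℕ → X → ℝ) (G₀ : X → ℝ) : Prop :=
  (∀ (w : ℕ → X) (w₀ : X), Tendsto w atTop (𝓝 w₀) →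
    (G₀ w₀ : EReal) ≤ liminf (fun n => (G n (w n) : EReal)) atTop) ∧
  ∀ w₀ : X, ∃ w : ℕ → X, Tendsto w atTop (𝓝 w₀) ∧
    limsup (fun n => (G n (w n) : EReal)) atTop ≤ (G₀ w₀ : EReal)

end

end WaveletFrame

open WaveletFrame

/-!
Integrating by parts against B-splines, the discrete transforms `W'ₙ Tₙ u - Sₙ v` and `W''ₙ Sₙ v`
are local samples of `D_j u - v_j` and `D_i v_j` against compactly supported functions of integral
one: each filter `q_ℓ` is the `ℓ`-th power of a difference operator times an averaging operator, and
differences of B-splines are derivatives of smoother ones. The associated step functions are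
therefore given by approximate identities, which converge strongly in `L_p` and are uniformly
bounded, so that samples of a convergent sequence converge as well. The Sobolev embedding in
dimension two controls the `L_2` and `L_p` norms of the functions themselves, and the uniform
boundedness principle turns the pointwise consistency of `Aₙ` into stability of the data term.
-/

namespace WaveletFrame

noncomputable section

/-! ### Approximate identities -/

section ApproximateIdentity

variable {X : Type*} [MeasurableSpace X] {μ : Measure X}

theorem rpow_lintegral_mul_le {w f : X → ℝ≥0∞} (hw : AEMeasurable w μ) (hf : AEMeasurable f μ)
    {r : ℝ} (hr : 1 ≤ r) :
    (∫⁻ y, w y * f y ∂μ) ^ r ≤ (∫⁻ y, w y ∂μ) ^ (r - 1) * ∫⁻ y, w y * f y ^ r ∂μ := by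
  have hr0 : 0 < r := by linarith
  have hr1 : 0 ≤ 1 - 1 / r := by rw [sub_nonneg, div_le_one hr0]; exact hr
  have hsplit (y : X) : (w y * f y ^ r) ^ (1 / r) * w y ^ (1 - 1 / r) = w y * f y := by
    rw [ENNReal.mul_rpow_of_nonneg _ _ (by positivity), ← ENNReal.rpow_mul,
      mul_one_div_cancel hr0.ne', ENNReal.rpow_one, mul_right_comm,
      ← ENNReal.rpow_add_of_nonneg _ _ (by positivity) hr1, add_sub_cancel, ENNReal.rpow_one]
  have hölder := ENNReal.lintegral_mul_norm_pow_le (μ := μ) (hw.mul (hf.pow_const r)) hw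
    (p := 1 / r) (q := 1 - 1 / r) (by positivity) hr1 (by ring)
  simp only [Pi.mul_apply, hsplit] at hölder
  calc (∫⁻ y, w y * f y ∂μ) ^ r
      ≤ ((∫⁻ y, w y * f y ^ r ∂μ) ^ (1 / r) * (∫⁻ y, w y ∂μ) ^ (1 - 1 / r)) ^ r := by gcongr
    _ = (∫⁻ y, w y ∂μ) ^ (r - 1) * ∫⁻ y, w y * f y ^ r ∂μ := by
        rw [ENNReal.mul_rpow_of_nonneg _ _ hr0.le, ← ENNReal.rpow_mul, ← ENNReal.rpow_mul,
          one_div_mul_cancel hr0.ne', ENNReal.rpow_one, mul_comm, sub_mul,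
          one_div_mul_cancel hr0.ne', one_mul]

/-- Schur's test. -/
theorem lintegral_rpow_lintegral_mul_le [SFinite μ] {w : X → X → ℝ≥0∞}
    (hw : Measurable (Function.uncurry w)) {f : X → ℝ≥0∞} (hf : AEMeasurable f μ) {r : ℝ}
    (hr : 1 ≤ r) {D : ℝ≥0∞} (hrow : ∀ᵐ x ∂μ, ∫⁻ y, w x y ∂μ ≤ D)
    (hcol : ∀ᵐ y ∂μ, ∫⁻ x, w x y ∂μ ≤ D) :
    ∫⁻ x, (∫⁻ y, w x y * f y ∂μ) ^ r ∂μ ≤ D ^ r * ∫⁻ y, f y ^ r ∂μ := by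
  have hr1 : 0 ≤ r - 1 := sub_nonneg.2 hr
  have hm : AEMeasurable (Function.uncurry fun x y => w x y * f y ^ r) (μ.prod μ) :=
    hw.aemeasurable.mul ((hf.pow_const r).comp_quasiMeasurePreserving
      Measure.quasiMeasurePreserving_snd)
  calc ∫⁻ x, (∫⁻ y, w x y * f y ∂μ) ^ r ∂μ
      ≤ ∫⁻ x, D ^ (r - 1) * ∫⁻ y, w x y * f y ^ r ∂μ ∂μ := by
        refine lintegral_mono_ae (hrow.mono fun x hx => ?_)
        have hwx : AEMeasurable (w x) μ := (hw.comp measurable_prodMk_left).aemeasurable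
        exact (rpow_lintegral_mul_le hwx hf hr).trans (by gcongr)
    _ = D ^ (r - 1) * ∫⁻ x, ∫⁻ y, w x y * f y ^ r ∂μ ∂μ :=
        lintegral_const_mul'' _ hm.lintegral_prod_right'
    _ = D ^ (r - 1) * ∫⁻ y, (∫⁻ x, w x y ∂μ) * f y ^ r ∂μ := by
        rw [lintegral_lintegral_swap hm]
        congr with y
        exact lintegral_mul_const _ (hw.comp measurable_prodMk_right)
    _ ≤ D ^ (r - 1) * ∫⁻ y, D * f y ^ r ∂μ :=
        mul_le_mul' le_rfl (lintegral_mono_ae (hcol.mono fun y hy => by gcongr))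
    _ = D ^ r * ∫⁻ y, f y ^ r ∂μ := by
        rw [lintegral_const_mul'' _ (hf.pow_const r), ← mul_assoc]
        nth_rewrite 2 [← ENNReal.rpow_one D]
        rw [← ENNReal.rpow_add_of_nonneg _ _ hr1 zero_le_one, sub_add_cancel]

theorem tendsto_eLpNorm_zero_of_bounded [IsFiniteMeasure μ] {F : ℕ → X → ℝ} {r : ℝ≥0∞}
    (hr : r ≠ 0) (hr' : r ≠ ⊤) (hF : ∀ n, AEStronglyMeasurable (F n) μ) {B : ℝ}
    (hB : ∀ n, ∀ᵐ x ∂μ, ‖F n x‖ ≤ B) (h : ∀ᵐ x ∂μ, Tendsto (fun n => F n x) atTop (𝓝 0)) :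
    Tendsto (fun n => eLpNorm (F n) r μ) atTop (𝓝 0) := by
  have hr0 : 0 < r.toReal := ENNReal.toReal_pos hr hr'
  have hint : Tendsto (fun n => ∫⁻ x, ‖F n x‖ₑ ^ r.toReal ∂μ) atTop (𝓝 (∫⁻ _, 0 ∂μ)) := by
    refine tendsto_lintegral_of_dominated_convergence' (fun _ => ENNReal.ofReal B ^ r.toReal)
      (fun n => (hF n).enorm.pow_const _) (fun n => (hB n).mono fun x hx => ?_) ?_
      (h.mono fun x hx => ?_)
    · dsimp only
      rw [← ofReal_norm]
      gcongr
    · rw [lintegral_const]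
      exact ENNReal.mul_ne_top (ENNReal.rpow_ne_top_of_nonneg hr0.le ENNReal.ofReal_ne_top)
        (measure_ne_top _ _)
    · simpa [hr0] using hx.enorm.ennrpow_const r.toReal
  simp only [eLpNorm_eq_lintegral_rpow_enorm_toReal hr hr']
  simpa [hr0] using hint.ennrpow_const (1 / r.toReal)

/-- The integral operator on `L_1(μ)` with kernel `k`. -/
def kernelOp (μ : Measure X) (k : X → X → ℝ) (g : X → ℝ) (x : X) : ℝ := ∫ y, k x y * g y ∂μ

/-- An approximate identity: kernels `k n` which live within distance `ρ n → 0` of the diagonal,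
have mass `1` in the second variable for large `n`, and satisfy the bounds of Schur's test with
constant `D`. -/
structure IsApproxIdentity [PseudoMetricSpace X] (μ : Measure X) (k : ℕ → X → X → ℝ) (D : ℝ)
    (ρ : ℕ → ℝ) : Prop where
  measurable : ∀ n, Measurable (Function.uncurry (k n))
  bounded : ∀ n, ∃ B, ∀ x y, ‖k n x y‖ ≤ B
  row_le : ∀ n, ∀ᵐ x ∂μ, ∫⁻ y, ‖k n x y‖ₑ ∂μ ≤ ENNReal.ofReal D
  col_le : ∀ n, ∀ᵐ y ∂μ, ∫⁻ x, ‖k n x y‖ₑ ∂μ ≤ ENNReal.ofReal D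
  dist_le : ∀ n, ∀ᵐ x ∂μ, ∀ y, k n x y ≠ 0 → dist x y ≤ ρ n
  tendsto_radius : Tendsto ρ atTop (𝓝 0)
  eventually_mass : ∀ᵐ x ∂μ, ∀ᶠ n in atTop, ∫ y, k n x y ∂μ = 1

namespace IsApproxIdentity

variable [PseudoMetricSpace X] {k : ℕ → X → X → ℝ} {D : ℝ} {ρ : ℕ → ℝ}

theorem integrable_mul (hk : IsApproxIdentity μ k D ρ) (n : ℕ) (x : X) {g : X → ℝ}
    (hg : Integrable g μ) : Integrable (fun y => k n x y * g y) μ := by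
  obtain ⟨B, hB⟩ := hk.bounded n
  exact hg.bdd_mul ((hk.measurable n).comp measurable_prodMk_left).aestronglyMeasurable
    (Eventually.of_forall (hB x))

theorem kernelOp_sub (hk : IsApproxIdentity μ k D ρ) (n : ℕ) {g g' : X → ℝ}
    (hg : Integrable g μ) (hg' : Integrable g' μ) :
    kernelOp μ (k n) (g - g') = kernelOp μ (k n) g - kernelOp μ (k n) g' := by
  funext x
  simp only [kernelOp, Pi.sub_apply, mul_sub]
  exact integral_sub (hk.integrable_mul n x hg) (hk.integrable_mul n x hg')

theorem aestronglyMeasurable_kernelOp [SFinite μ] (hk : IsApproxIdentity μ k D ρ) (n : ℕ)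
    {g : X → ℝ} (hg : AEStronglyMeasurable g μ) :
    AEStronglyMeasurable (kernelOp μ (k n) g) μ := by
  have h : AEStronglyMeasurable (fun z : X × X => k n z.1 z.2 * g z.2) (μ.prod μ) :=
    (hk.measurable n).aestronglyMeasurable.mul hg.comp_snd
  exact h.integral_prod_right'

theorem eLpNorm_kernelOp_le [SFinite μ] (hk : IsApproxIdentity μ k D ρ) (n : ℕ) {r : ℝ≥0∞}
    (hr : 1 ≤ r) (hr' : r ≠ ⊤) {g : X → ℝ} (hg : AEStronglyMeasurable g μ) :
    eLpNorm (kernelOp μ (k n) g) r μ ≤ ENNReal.ofReal D * eLpNorm g r μ := by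
  have hr0 : r ≠ 0 := (zero_lt_one.trans_le hr).ne'
  have hr1 : 1 ≤ r.toReal := by simpa using ENNReal.toReal_mono hr' hr
  rw [eLpNorm_eq_lintegral_rpow_enorm_toReal hr0 hr',
    eLpNorm_eq_lintegral_rpow_enorm_toReal hr0 hr']
  calc _ ≤ (∫⁻ x, (∫⁻ y, ‖k n x y‖ₑ * ‖g y‖ₑ ∂μ) ^ r.toReal ∂μ) ^ (1 / r.toReal) := by
        gcongr with x
        refine (enorm_integral_le_lintegral_enorm _).trans_eq ?_
        simp only [enorm_mul]
    _ ≤ (ENNReal.ofReal D ^ r.toReal * ∫⁻ y, ‖g y‖ₑ ^ r.toReal ∂μ) ^ (1 / r.toReal) := by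
        gcongr
        exact lintegral_rpow_lintegral_mul_le (hk.measurable n).enorm hg.enorm hr1 (hk.row_le n)
          (hk.col_le n)
    _ = _ := by
        rw [ENNReal.mul_rpow_of_nonneg _ _ (by positivity), ← ENNReal.rpow_mul,
          mul_one_div_cancel (by positivity), ENNReal.rpow_one]

theorem norm_kernelOp_le (hk : IsApproxIdentity μ k D ρ) (hD : 0 ≤ D) (n : ℕ) :
    ∀ᵐ x ∂μ, ∀ (h : X → ℝ) (ε : ℝ), 0 ≤ ε → (∀ y, dist x y ≤ ρ n → ‖h y‖ ≤ ε) →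
      ‖kernelOp μ (k n) h x‖ ≤ D * ε := by
  filter_upwards [hk.row_le n, hk.dist_le n] with x hrow hdist h ε hε hh
  have hle : ‖kernelOp μ (k n) h x‖ₑ ≤ ENNReal.ofReal D * ENNReal.ofReal ε :=
    calc _ ≤ ∫⁻ y, ‖k n x y‖ₑ * ENNReal.ofReal ε ∂μ := by
          refine (enorm_integral_le_lintegral_enorm _).trans (lintegral_mono fun y => ?_)
          by_cases hy : k n x y = 0
          · simp [hy]
          · rw [enorm_mul, ← ofReal_norm (h y)]
            gcongr
            exact hh y (hdist y hy)
      _ = (∫⁻ y, ‖k n x y‖ₑ ∂μ) * ENNReal.ofReal ε :=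
          lintegral_mul_const' _ _ ENNReal.ofReal_ne_top
      _ ≤ _ := by gcongr
  rw [← ENNReal.ofReal_mul hD, ← ofReal_norm] at hle
  exact (ENNReal.ofReal_le_ofReal_iff (by positivity)).1 hle

theorem ae_tendsto_of_continuous [IsFiniteMeasure μ] (hk : IsApproxIdentity μ k D ρ)
    (hD : 0 ≤ D) {h : X → ℝ} (hc : Continuous h) (hi : Integrable h μ) :
    ∀ᵐ x ∂μ, Tendsto (fun n => (kernelOp μ (k n) h - h) x) atTop (𝓝 0) := by
  filter_upwards [hk.eventually_mass, ae_all_iff.2 (hk.norm_kernelOp_le hD)] with x hmass hle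
  rw [Metric.tendsto_nhds]
  intro ε hε
  have hε' : 0 < ε / (D + 1) := by positivity
  obtain ⟨δ, hδ, hclose⟩ := Metric.continuous_iff.1 hc x _ hε'
  filter_upwards [hmass, hk.tendsto_radius.eventually_lt_const hδ] with n hn hnδ
  have hdiff : (kernelOp μ (k n) h - h) x = kernelOp μ (k n) (fun y => h y - h x) x := by
    simp only [kernelOp, Pi.sub_apply, mul_sub]
    rw [integral_sub (hk.integrable_mul n x hi) (hk.integrable_mul n x (integrable_const _)),
      integral_mul_const, hn, one_mul]
  rw [dist_zero_right, hdiff]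
  calc _ ≤ D * (ε / (D + 1)) := hle n _ _ hε'.le fun y hy => by
        rw [← dist_eq_norm]
        exact (hclose y (by rw [dist_comm]; exact hy.trans_lt hnδ)).le
    _ < ε := by
        rw [mul_div_assoc', div_lt_iff₀ (by positivity)]
        linarith

variable [BorelSpace X] [IsFiniteMeasure μ] {r : ℝ≥0∞}

theorem tendsto_of_continuous (hk : IsApproxIdentity μ k D ρ) (hD : 0 ≤ D) (hr : r ≠ 0)
    (hr' : r ≠ ⊤) {h : X → ℝ} (hc : Continuous h) {B : ℝ} (hB : ∀ x, ‖h x‖ ≤ B) :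
    Tendsto (fun n => eLpNorm (kernelOp μ (k n) h - h) r μ) atTop (𝓝 0) := by
  have hm : AEStronglyMeasurable h μ := hc.aestronglyMeasurable
  refine tendsto_eLpNorm_zero_of_bounded hr hr'
    (fun n => (hk.aestronglyMeasurable_kernelOp n hm).sub hm) (B := D * B + B) (fun n => ?_)
    (hk.ae_tendsto_of_continuous hD hc (Integrable.of_bound hm B (Eventually.of_forall hB)))
  filter_upwards [hk.norm_kernelOp_le hD n] with x hx
  exact (norm_sub_le _ _).trans (add_le_add
    (hx h B ((norm_nonneg _).trans (hB x)) fun y _ => hB y) (hB x))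

theorem tendsto_self (hk : IsApproxIdentity μ k D ρ) (hD : 0 ≤ D) (hr : 1 ≤ r) (hr' : r ≠ ⊤)
    {g : X → ℝ} (hg : MemLp g r μ) :
    Tendsto (fun n => eLpNorm (kernelOp μ (k n) g - g) r μ) atTop (𝓝 0) := by
  rw [ENNReal.tendsto_nhds_zero]
  intro ε hε
  set c := ENNReal.ofReal D + 1
  have hc : c ≠ ⊤ := by simp [c]
  have hδ : ε / 2 / c ≠ 0 :=
    ENNReal.div_ne_zero.2 ⟨ENNReal.div_ne_zero.2 ⟨hε.ne', ENNReal.ofNat_ne_top⟩, hc⟩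
  obtain ⟨h, hlim, happrox, hh⟩ : ∃ h : X → ℝ,
      Tendsto (fun n => eLpNorm (kernelOp μ (k n) h - h) r μ) atTop (𝓝 0) ∧
        eLpNorm (g - h) r μ ≤ ε / 2 / c ∧ MemLp h r μ := by
    obtain ⟨h, happrox, hh⟩ := hg.exists_boundedContinuous_eLpNorm_sub_le hr' hδ
    exact ⟨h, hk.tendsto_of_continuous hD (zero_lt_one.trans_le hr).ne' hr' h.continuous
      h.norm_coe_le_norm, happrox, hh⟩
  have hε2 : 0 < ε / 2 := ENNReal.half_pos hε.ne'
  filter_upwards [ENNReal.tendsto_nhds_zero.1 hlim _ hε2] with n hn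
  have hmg := (hg.sub hh).1
  have hmh := (hk.aestronglyMeasurable_kernelOp n hh.1).sub hh.1
  have hsplit : kernelOp μ (k n) g - g =
      kernelOp μ (k n) (g - h) + ((kernelOp μ (k n) h - h) + (h - g)) := by
    rw [hk.kernelOp_sub n (hg.integrable hr) (hh.integrable hr)]
    abel
  calc eLpNorm (kernelOp μ (k n) g - g) r μ
      ≤ eLpNorm (kernelOp μ (k n) (g - h)) r μ +
          (eLpNorm (kernelOp μ (k n) h - h) r μ + eLpNorm (h - g) r μ) := by
        rw [hsplit]
        refine (eLpNorm_add_le (hk.aestronglyMeasurable_kernelOp n hmg)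
          (hmh.add (hh.sub hg).1) hr).trans ?_
        gcongr
        exact eLpNorm_add_le hmh (hh.sub hg).1 hr
    _ ≤ ENNReal.ofReal D * (ε / 2 / c) + (ε / 2 + ε / 2 / c) := by
        gcongr
        · exact (hk.eLpNorm_kernelOp_le n hr hr' hmg).trans (by gcongr)
        · rwa [eLpNorm_sub_comm]
    _ = c * (ε / 2 / c) + ε / 2 := by ring
    _ = ε := by rw [ENNReal.mul_div_cancel (by simp [c]) hc, ENNReal.add_halves]

theorem tendsto (hk : IsApproxIdentity μ k D ρ) (hD : 0 ≤ D) (hr : 1 ≤ r) (hr' : r ≠ ⊤)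
    {g : ℕ → X → ℝ} {g₀ : X → ℝ} (hg : ∀ n, MemLp (g n) r μ) (hg₀ : MemLp g₀ r μ)
    (hlim : Tendsto (fun n => eLpNorm (g n - g₀) r μ) atTop (𝓝 0)) :
    Tendsto (fun n => eLpNorm (kernelOp μ (k n) (g n) - g₀) r μ) atTop (𝓝 0) := by
  have hbound : Tendsto (fun n => ENNReal.ofReal D * eLpNorm (g n - g₀) r μ +
      eLpNorm (kernelOp μ (k n) g₀ - g₀) r μ) atTop (𝓝 0) := by
    simpa using (ENNReal.Tendsto.const_mul hlim (Or.inr ENNReal.ofReal_ne_top)).add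
      (hk.tendsto_self hD hr hr' hg₀)
  refine tendsto_of_tendsto_of_tendsto_of_le_of_le tendsto_const_nhds hbound
    (fun _ => zero_le) fun n => ?_
  have hm := ((hg n).sub hg₀).1
  have hsplit : kernelOp μ (k n) (g n) - g₀ =
      kernelOp μ (k n) (g n - g₀) + (kernelOp μ (k n) g₀ - g₀) := by
    rw [hk.kernelOp_sub n ((hg n).integrable hr) (hg₀.integrable hr)]
    abel
  dsimp only
  rw [hsplit]
  exact (eLpNorm_add_le (hk.aestronglyMeasurable_kernelOp n hm)
    ((hk.aestronglyMeasurable_kernelOp n hg₀.1).sub hg₀.1) hr).trans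
    (add_le_add_left (hk.eLpNorm_kernelOp_le n hr hr' hm) _)

end IsApproxIdentity

end ApproximateIdentity

/-! ### Lebesgue measure on the unit square -/

theorem closure_Ω : closure Ω = Set.Icc 0 1 ×ˢ Set.Icc 0 1 := by
  rw [Ω, closure_prod_eq, closure_Ioo zero_ne_one]

theorem isOpen_Ω : IsOpen Ω := isOpen_Ioo.prod isOpen_Ioo

theorem measurableSet_Ω : MeasurableSet Ω := isOpen_Ω.measurableSet

theorem ae_mem_Ω : ∀ᵐ x ∂μΩ, x ∈ Ω := ae_restrict_mem measurableSet_Ω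

theorem Ω_ae_eq_Icc : Ω =ᵐ[volume] (Set.Icc 0 1 ×ˢ Set.Icc 0 1 : Set (ℝ × ℝ)) :=
  Measure.set_prod_ae_eq Ioo_ae_eq_Icc Ioo_ae_eq_Icc

theorem Ω_ae_eq_Ico : Ω =ᵐ[volume] (Set.Ico 0 1 ×ˢ Set.Ico 0 1 : Set (ℝ × ℝ)) :=
  Measure.set_prod_ae_eq Ioo_ae_eq_Ico Ioo_ae_eq_Ico

theorem μΩ_eq_prod :
    μΩ = (volume.restrict (Set.Ioo (0 : ℝ) 1)).prod (volume.restrict (Set.Ioo (0 : ℝ) 1)) :=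
  (Measure.prod_restrict _ _).symm

instance : IsProbabilityMeasure (volume.restrict (Set.Ioo (0 : ℝ) 1)) := ⟨by simp⟩

instance : IsProbabilityMeasure μΩ := by
  rw [μΩ_eq_prod]
  infer_instance

theorem volume_closedBall_prod (x : ℝ × ℝ) (r : ℝ) :
    volume (Metric.closedBall x r) = ENNReal.ofReal (2 * r) * ENNReal.ofReal (2 * r) := by
  obtain ⟨a, b⟩ := x
  rw [← closedBall_prod_same, Measure.volume_eq_prod, Measure.prod_prod, Real.volume_closedBall,
    Real.volume_closedBall]

theorem lintegral_enorm_le_of_closedBall {f : ℝ × ℝ → ℝ} {x : ℝ × ℝ} {c r : ℝ} (hr : 0 ≤ r)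
    (hf : ∀ᵐ y ∂μΩ, ‖f y‖ ≤ c ∧ (f y ≠ 0 → dist y x ≤ r)) :
    ∫⁻ y, ‖f y‖ₑ ∂μΩ ≤ ENNReal.ofReal (4 * c * r ^ 2) := by
  have hc : 0 ≤ c := let ⟨_, hy, _⟩ := hf.exists; (norm_nonneg _).trans hy
  calc ∫⁻ y, ‖f y‖ₑ ∂μΩ
      ≤ ∫⁻ y, (Metric.closedBall x r).indicator (fun _ => ENNReal.ofReal c) y ∂μΩ := by
        refine lintegral_mono_ae (hf.mono fun y ⟨hle, hdist⟩ => ?_)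
        by_cases hy : f y = 0
        · simp [hy]
        · rw [Set.indicator_of_mem (Metric.mem_closedBall.2 (hdist hy)), ← ofReal_norm]
          exact ENNReal.ofReal_le_ofReal hle
    _ ≤ ∫⁻ y, (Metric.closedBall x r).indicator (fun _ => ENNReal.ofReal c) y :=
        setLIntegral_le_lintegral _ _
    _ = ENNReal.ofReal (4 * c * r ^ 2) := by
        rw [lintegral_indicator Metric.isClosed_closedBall.measurableSet, setLIntegral_const,
          volume_closedBall_prod, ← ENNReal.ofReal_mul (by positivity),
          ← ENNReal.ofReal_mul hc]
        ring_nf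

theorem IsApproxIdentity.of_bound {k : ℕ → ℝ × ℝ → ℝ × ℝ → ℝ} {B R : ℝ} (hR : 0 ≤ R)
    (hm : ∀ n, Measurable (Function.uncurry (k n))) (hB : ∀ n x y, ‖k n x y‖ ≤ B * 4 ^ n)
    (hdist : ∀ n, ∀ x ∈ Ω, ∀ y, k n x y ≠ 0 → dist x y ≤ R * (2 ^ n)⁻¹)
    (hmass : ∀ x ∈ Ω, ∀ᶠ n in atTop, ∫ y, k n x y ∂μΩ = 1) :
    IsApproxIdentity μΩ k (4 * B * R ^ 2) fun n => R * (2 ^ n)⁻¹ := by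
  have hD (n : ℕ) : 4 * (B * 4 ^ n) * (R * (2 ^ n)⁻¹) ^ 2 = 4 * B * R ^ 2 := by
    rw [mul_pow, inv_pow, ← pow_mul, mul_comm n 2, pow_mul]
    norm_num
    field_simp
  refine ⟨hm, fun n => ⟨_, hB n⟩, fun n => ae_mem_Ω.mono fun x hx => ?_,
    fun n => Eventually.of_forall fun y => ?_, fun n => ae_mem_Ω.mono (hdist n), ?_,
    ae_mem_Ω.mono hmass⟩
  · rw [← hD n]
    exact lintegral_enorm_le_of_closedBall (by positivity) (Eventually.of_forall fun y =>
      ⟨hB n x y, fun hy => (dist_comm y x).trans_le (hdist n x hx y hy)⟩)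
  · rw [← hD n]
    exact lintegral_enorm_le_of_closedBall (by positivity) (ae_mem_Ω.mono fun x hx =>
      ⟨hB n x y, hdist n x hx y⟩)
  · simpa using (tendsto_pow_atTop_nhds_zero_of_lt_one (r := (2 : ℝ)⁻¹) (by norm_num)
      (by norm_num)).const_mul R

/-! ### Translations and window integrals on the line -/

/-- Bounded measurable functions vanishing outside `[a, b]`. -/
structure BddSupp (a b : ℝ) (F : ℝ → ℝ) : Prop where
  measurable : Measurable F
  bounded : ∃ B, ∀ x, ‖F x‖ ≤ B
  mem_Icc : ∀ x, F x ≠ 0 → x ∈ Set.Icc a b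

/-- Convolution with the indicator function of `[0, h]`. -/
def windowIntegral (h : ℝ) (F : ℝ → ℝ) (x : ℝ) : ℝ := ∫ t in (0 : ℝ)..h, F (x - t)

/-- Translation by `h`, as an endomorphism, so that filters are polynomials in `shift 1`. -/
def shift (h : ℝ) : Module.End ℝ (ℝ → ℝ) where
  toFun F x := F (x - h)
  map_add' _ _ := rfl
  map_smul' _ _ := rfl

@[simp] theorem shift_apply (h : ℝ) (F : ℝ → ℝ) (x : ℝ) : shift h F x = F (x - h) := rfl

theorem shift_pow_apply (h : ℝ) (j : ℕ) (F : ℝ → ℝ) (x : ℝ) :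
    (shift h ^ j) F x = F (x - j * h) := by
  induction j generalizing x with
  | zero => simp
  | succ j ih =>
    rw [pow_succ', Module.End.mul_apply, shift_apply, ih]
    push_cast
    ring_nf

theorem windowIntegral_eq (F : ℝ → ℝ) (h x : ℝ) :
    windowIntegral h F x = ∫ t in (x - h)..x, F t := by
  rw [windowIntegral, intervalIntegral.integral_comp_sub_left F x, sub_zero]

namespace BddSupp

variable {a b a' b' h : ℝ} {F G : ℝ → ℝ}

theorem integrable_mul (hF : BddSupp a b F) {U : ℝ → ℝ} (hU : Continuous U) :
    Integrable fun x => U x * F x := by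
  obtain ⟨B, hB⟩ := hF.bounded
  rw [← integrableOn_iff_integrable_of_support_subset (s := Set.Icc a b)
    fun x hx => hF.mem_Icc x (right_ne_zero_of_mul hx)]
  exact hU.integrableOn_Icc.mul_bdd hF.measurable.aestronglyMeasurable (Eventually.of_forall hB)

theorem integrable (hF : BddSupp a b F) : Integrable F := by
  simpa using hF.integrable_mul (U := fun _ => 1) continuous_const

theorem mono (hF : BddSupp a b F) (ha : a' ≤ a) (hb : b ≤ b') : BddSupp a' b' F :=
  ⟨hF.measurable, hF.bounded, fun x hx => Set.Icc_subset_Icc ha hb (hF.mem_Icc x hx)⟩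

theorem add (hF : BddSupp a b F) (hG : BddSupp a b G) : BddSupp a b (F + G) := by
  obtain ⟨B, hB⟩ := hF.bounded
  obtain ⟨B', hB'⟩ := hG.bounded
  refine ⟨hF.measurable.add hG.measurable,
    ⟨B + B', fun x => (norm_add_le _ _).trans (add_le_add (hB x) (hB' x))⟩, fun x hx => ?_⟩
  by_cases h : F x = 0
  · exact hG.mem_Icc x fun h' => hx (by simp [h, h'])
  · exact hF.mem_Icc x h

theorem smul (hF : BddSupp a b F) (c : ℝ) : BddSupp a b (c • F) := by
  obtain ⟨B, hB⟩ := hF.bounded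
  refine ⟨hF.measurable.const_smul c, ⟨‖c‖ * B, fun x => ?_⟩,
    fun x hx => hF.mem_Icc x fun h => hx (by simp [h])⟩
  rw [Pi.smul_apply, norm_smul]
  gcongr
  exact hB x

theorem comp_affine (hF : BddSupp a b F) {l : ℝ} (hl : 0 < l) (κ : ℝ) :
    BddSupp ((a + κ) / l) ((b + κ) / l) fun x => F (l * x - κ) := by
  obtain ⟨B, hB⟩ := hF.bounded
  refine ⟨hF.measurable.comp (by fun_prop), ⟨B, fun x => hB _⟩, fun x hx => ?_⟩
  obtain ⟨h₁, h₂⟩ := hF.mem_Icc _ hx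
  rw [Set.mem_Icc, div_le_iff₀ hl, le_div_iff₀ hl]
  constructor <;> linarith

protected theorem shift (hF : BddSupp a b F) (h : ℝ) : BddSupp (a + h) (b + h) (shift h F) := by
  convert hF.comp_affine one_pos h using 1
  · rw [div_one]
  · rw [div_one]
  · simp only [one_mul]
    rfl

theorem one_add_shift (hF : BddSupp a b F) (hh : 0 ≤ h) :
    BddSupp a (b + h) ((1 + shift h) F) :=
  (hF.mono le_rfl (by linarith)).add ((hF.shift h).mono (by linarith) le_rfl)

theorem one_sub_shift (hF : BddSupp a b F) (hh : 0 ≤ h) :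
    BddSupp a (b + h) ((1 - shift h) F) := by
  have hsum := (hF.mono (b' := b + h) le_rfl (by linarith)).add
    (((hF.shift h).mono (a' := a) (by linarith) le_rfl).smul (-1))
  rwa [neg_one_smul, ← sub_eq_add_neg] at hsum

theorem iterate {φ : (ℝ → ℝ) → ℝ → ℝ}
    (hφ : ∀ {b : ℝ} {F : ℝ → ℝ}, BddSupp a b F → BddSupp a (b + h) (φ F))
    (hF : BddSupp a b F) (j : ℕ) : BddSupp a (b + j * h) (φ^[j] F) := by
  induction j with
  | zero => simpa using hF
  | succ j ih =>
    rw [Function.iterate_succ_apply', Nat.cast_succ, add_one_mul, ← add_assoc]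
    exact hφ ih

theorem one_add_shift_pow (hF : BddSupp a b F) (hh : 0 ≤ h) (j : ℕ) :
    BddSupp a (b + j * h) (((1 + shift h) ^ j) F) := by
  rw [Module.End.pow_apply]
  exact iterate (fun hG => hG.one_add_shift hh) hF j

theorem one_sub_shift_pow (hF : BddSupp a b F) (hh : 0 ≤ h) (j : ℕ) :
    BddSupp a (b + j * h) (((1 - shift h) ^ j) F) := by
  rw [Module.End.pow_apply]
  exact iterate (fun hG => hG.one_sub_shift hh) hF j

protected theorem windowIntegral (hF : BddSupp a b F) (hh : 0 ≤ h) :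
    BddSupp a (b + h) (windowIntegral h F) := by
  obtain ⟨B, hB⟩ := hF.bounded
  have hint (x y : ℝ) : IntervalIntegrable F volume x y := hF.integrable.intervalIntegrable
  refine ⟨?_, ⟨B * |h - 0|, fun x =>
    intervalIntegral.norm_integral_le_of_norm_le_const fun t _ => hB _⟩, fun x hx => ?_⟩
  · have hdiff : windowIntegral h F =
        fun x => (∫ t in (0 : ℝ)..x, F t) - ∫ t in (0 : ℝ)..(x - h), F t := by
      funext x
      rw [windowIntegral_eq, intervalIntegral.integral_interval_sub_left (hint _ _) (hint _ _)]
    have hc := intervalIntegral.continuous_primitive hint 0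
    rw [hdiff]
    exact (hc.sub (hc.comp (by fun_prop))).measurable
  · obtain ⟨t, ht, hne⟩ : ∃ t ∈ Set.uIcc 0 h, F (x - t) ≠ 0 := by
      by_contra! hzero
      exact hx ((intervalIntegral.integral_congr hzero).trans intervalIntegral.integral_zero)
    rw [Set.uIcc_of_le hh] at ht
    obtain ⟨h₁, h₂⟩ := hF.mem_Icc _ hne
    exact ⟨by linarith [ht.1], by linarith [ht.2]⟩

theorem windowIntegral_iterate (hF : BddSupp a b F) (hh : 0 ≤ h) (j : ℕ) :
    BddSupp a (b + j * h) ((windowIntegral h)^[j] F) :=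
  iterate (fun hG => hG.windowIntegral hh) hF j

theorem integrable_prod_mul (hF : BddSupp a b F) {U : ℝ → ℝ} (hU : Continuous U) :
    Integrable (fun z : ℝ × ℝ => U (z.1 + z.2) * F z.1)
      (volume.prod (volume.restrict (Set.Ioc 0 h))) := by
  have hU' : Continuous fun z : ℝ × ℝ => U (z.1 + z.2) := by fun_prop
  obtain ⟨B, hB⟩ := (isCompact_Icc.prod isCompact_Icc :
    IsCompact (Set.Icc a b ×ˢ Set.Icc 0 h)).exists_bound_of_continuousOn hU'.continuousOn
  refine ((hF.integrable.norm.comp_fst _).const_mul B).mono' (hU'.measurable.mul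
    (hF.measurable.comp measurable_fst)).aestronglyMeasurable ?_
  have hmem : ∀ᵐ z ∂((volume : Measure ℝ).prod (volume.restrict (Set.Ioc 0 h))),
      z.2 ∈ Set.Ioc 0 h :=
    Measure.quasiMeasurePreserving_snd.ae (ae_restrict_mem measurableSet_Ioc)
  filter_upwards [hmem] with z hz
  by_cases hne : F z.1 = 0
  · simp [hne]
  · rw [norm_mul]
    gcongr
    exact hB z ⟨hF.mem_Icc _ hne, hz.1.le, hz.2⟩

theorem integral_mul_windowIntegral (hF : BddSupp a b F) (hh : 0 ≤ h) {U : ℝ → ℝ}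
    (hU : Continuous U) :
    ∫ x, U x * windowIntegral h F x = ∫ x, (∫ t in (0 : ℝ)..h, U (x + t)) * F x := by
  have hi := hF.integrable_prod_mul (h := h) hU
  have hi' : Integrable (fun z : ℝ × ℝ => U z.1 * F (z.1 - z.2))
      (volume.prod (volume.restrict (Set.Ioc 0 h))) := by
    simpa only [Function.comp_def, sub_add_cancel] using (measurePreserving_sub_prod volume
      (volume.restrict (Set.Ioc 0 h))).integrable_comp_of_integrable hi
  calc ∫ x, U x * windowIntegral h F x
      = ∫ x, ∫ t in Set.Ioc 0 h, U x * F (x - t) := by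
        simp only [windowIntegral, intervalIntegral.integral_of_le hh, integral_const_mul]
    _ = ∫ t in Set.Ioc 0 h, ∫ x, U x * F (x - t) := integral_integral_swap hi'
    _ = ∫ t in Set.Ioc 0 h, ∫ x, U (x + t) * F x := by
        congr with t
        simpa using (integral_add_right_eq_self (fun x => U x * F (x - t)) t).symm
    _ = ∫ x, ∫ t in Set.Ioc 0 h, U (x + t) * F x := (integral_integral_swap hi).symm
    _ = ∫ x, (∫ t in (0 : ℝ)..h, U (x + t)) * F x := by
        simp only [intervalIntegral.integral_of_le hh, integral_mul_const]

theorem integral_windowIntegral (hF : BddSupp a b F) (hh : 0 ≤ h) :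
    ∫ x, windowIntegral h F x = h * ∫ x, F x := by
  simpa [integral_const_mul] using
    hF.integral_mul_windowIntegral hh (U := fun _ => 1) continuous_const

theorem integral_windowIntegral_iterate (hF : BddSupp a b F) (hh : 0 ≤ h) (j : ℕ) :
    ∫ x, (windowIntegral h)^[j] F x = h ^ j * ∫ x, F x := by
  induction j with
  | zero => simp
  | succ j ih =>
    rw [Function.iterate_succ_apply', (hF.windowIntegral_iterate hh j).integral_windowIntegral hh,
      ih]
    ring

theorem integral_one_add_shift_pow (hF : BddSupp a b F) (hh : 0 ≤ h) (j : ℕ) :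
    ∫ x, ((1 + shift h) ^ j) F x = 2 ^ j * ∫ x, F x := by
  induction j with
  | zero => simp
  | succ j ih =>
    have hj := hF.one_add_shift_pow hh j
    simp only [pow_succ', Module.End.mul_apply, LinearMap.add_apply, Module.End.one_apply,
      Pi.add_apply]
    rw [integral_add hj.integrable (hj.shift h).integrable]
    simp only [shift_apply]
    rw [integral_sub_right_eq_self (((1 + shift h) ^ j) F) h, ih]
    ring

theorem windowIntegral_one_sub_shift (hF : BddSupp a b F) :
    windowIntegral h ((1 - shift h) F) = (1 - shift h) (windowIntegral h F) := by
  have hint (y : ℝ) : IntervalIntegrable (fun t => F (y - t)) volume 0 h :=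
    (hF.integrable.comp_sub_left y).intervalIntegrable
  funext x
  simp only [windowIntegral, LinearMap.sub_apply, Module.End.one_apply, Pi.sub_apply, shift_apply]
  rw [← intervalIntegral.integral_sub (hint x) (hint (x - h))]
  simp only [sub_right_comm]

theorem windowIntegral_one_sub_shift_pow (hF : BddSupp a b F) (hh : 0 ≤ h) (j : ℕ) :
    windowIntegral h (((1 - shift h) ^ j) F) = ((1 - shift h) ^ j) (windowIntegral h F) := by
  induction j with
  | zero => simp
  | succ j ih =>
    rw [pow_succ', Module.End.mul_apply,
      (hF.one_sub_shift_pow hh j).windowIntegral_one_sub_shift, ih, Module.End.mul_apply]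

theorem prim_one_sub_shift (hF : BddSupp a b F) :
    prim ((1 - shift h) F) = windowIntegral h F := by
  have hshift (x : ℝ) : ∫ t in Set.Iic x, F (t - h) = ∫ t in Set.Iic (x - h), F t := by
    rw [← integral_indicator measurableSet_Iic, ← integral_indicator measurableSet_Iic,
      ← integral_sub_right_eq_self ((Set.Iic (x - h)).indicator F) h]
    simp [Set.indicator_apply]
  have hint := hF.integrable
  funext x
  simp only [prim, LinearMap.sub_apply, Module.End.one_apply, Pi.sub_apply, shift_apply]
  rw [integral_sub hint.integrableOn (hint.comp_sub_right h).integrableOn, hshift,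
    intervalIntegral.integral_Iic_sub_Iic hint.integrableOn hint.integrableOn, windowIntegral_eq]

theorem prim_iterate_one_sub_shift_pow (hF : BddSupp a b F) (hh : 0 ≤ h) (j : ℕ) :
    prim^[j] (((1 - shift h) ^ j) F) = (windowIntegral h)^[j] F := by
  induction j generalizing b F with
  | zero => simp
  | succ j ih =>
    rw [Function.iterate_succ_apply, pow_succ', Module.End.mul_apply,
      (hF.one_sub_shift_pow hh j).prim_one_sub_shift, hF.windowIntegral_one_sub_shift_pow hh,
      ih (hF.windowIntegral hh), Function.iterate_succ_apply]

end BddSupp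

/-- `f` is an `a`-fold primitive of `g`, in the sense of integration by parts against smooth
functions, which need not have compact support. -/
def IsIteratedPrim (a : ℕ) (g f : ℝ → ℝ) : Prop :=
  ∀ U : ℝ → ℝ, ContDiff ℝ ∞ U →
    ∫ x, U x * g x = (-1) ^ a * ∫ x, iteratedDeriv a U x * f x

theorem IsIteratedPrim.smul {a : ℕ} {g f : ℝ → ℝ} (h : IsIteratedPrim a g f) (c : ℝ) :
    IsIteratedPrim a (c • g) (c • f) := by
  intro U hU
  simp only [Pi.smul_apply, smul_eq_mul, mul_left_comm _ c, integral_const_mul]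
  rw [h U hU]

theorem integral_comp_mul_sub {l : ℝ} (hl : 0 < l) (κ : ℝ) (w : ℝ → ℝ) :
    ∫ x, w (l * x - κ) = l⁻¹ * ∫ y, w y := by
  rw [Measure.integral_comp_mul_left (fun y => w (y - κ)) l, integral_sub_right_eq_self w κ,
    abs_of_pos (inv_pos.2 hl), smul_eq_mul]

theorem IsIteratedPrim.comp_affine {a : ℕ} {g f : ℝ → ℝ} (h : IsIteratedPrim a g f) {l : ℝ}
    (hl : 0 < l) (κ : ℝ) :
    IsIteratedPrim a (fun x => l ^ a * g (l * x - κ)) fun x => f (l * x - κ) := by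
  intro U hU
  let V : ℝ → ℝ := fun y => U (l⁻¹ * (y + κ))
  have hinv (x : ℝ) : l⁻¹ * (l * x - κ + κ) = x := by field_simp; simp
  have hV (x : ℝ) : V (l * x - κ) = U x := congrArg U (hinv x)
  have hVderiv (x : ℝ) : iteratedDeriv a V (l * x - κ) = l⁻¹ ^ a * iteratedDeriv a U x := by
    rw [iteratedDeriv_comp_add_const a (fun z => U (l⁻¹ * z)),
      iteratedDeriv_comp_const_mul (hU.of_le (by exact_mod_cast le_top))]
    simp only [hinv]
  calc ∫ x, U x * (l ^ a * g (l * x - κ))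
      = l ^ a * ∫ x, V (l * x - κ) * g (l * x - κ) := by
        simp only [hV, mul_left_comm _ (l ^ a), integral_const_mul]
    _ = l ^ a * (l⁻¹ * ((-1) ^ a * ∫ y, iteratedDeriv a V y * f y)) := by
        rw [integral_comp_mul_sub hl κ fun y => V y * g y, h V (hU.comp (by fun_prop))]
    _ = l ^ a * ((-1) ^ a * ∫ x, iteratedDeriv a V (l * x - κ) * f (l * x - κ)) := by
        rw [integral_comp_mul_sub hl κ fun y => iteratedDeriv a V y * f y, mul_left_comm l⁻¹]
    _ = (-1) ^ a * ∫ x, iteratedDeriv a U x * f (l * x - κ) := by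
        simp only [hVderiv, mul_assoc, integral_const_mul]
        rw [mul_left_comm, inv_pow, mul_inv_cancel_left₀ (pow_pos hl a).ne']

theorem BddSupp.integral_mul_one_sub_shift {a b h : ℝ} {F : ℝ → ℝ} (hF : BddSupp a b F)
    (hh : 0 ≤ h) {U : ℝ → ℝ} (hU : ContDiff ℝ 1 U) :
    ∫ x, U x * (1 - shift h) F x = -∫ x, deriv U x * windowIntegral h F x := by
  have hU' : Continuous (deriv U) := hU.continuous_deriv le_rfl
  have htranslate : ∫ x, U x * F (x - h) = ∫ x, U (x + h) * F x := by
    simpa using (integral_add_right_eq_self (fun x => U x * F (x - h)) h).symm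
  have hftc (x : ℝ) : ∫ t in (0 : ℝ)..h, deriv U (x + t) = U (x + h) - U x := by
    rw [intervalIntegral.integral_comp_add_left (deriv U) x, add_zero,
      intervalIntegral.integral_deriv_eq_sub
        (fun y _ => (hU.differentiable one_ne_zero).differentiableAt)
        (hU'.intervalIntegrable _ _)]
  have hi := hF.integrable_mul hU.continuous
  have hi' := hF.integrable_mul (U := fun x => U (x + h)) (hU.continuous.comp (by fun_prop))
  simp only [LinearMap.sub_apply, Module.End.one_apply, Pi.sub_apply, mul_sub]
  rw [integral_sub hi ((hF.shift h).integrable_mul hU.continuous)]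
  simp only [shift_apply]
  rw [htranslate, hF.integral_mul_windowIntegral hh hU']
  simp only [hftc, sub_mul]
  rw [integral_sub hi' hi, neg_sub]

theorem BddSupp.isIteratedPrim_one_sub_shift_pow {a b h : ℝ} {F : ℝ → ℝ} (hF : BddSupp a b F)
    (hh : 0 ≤ h) (j : ℕ) :
    IsIteratedPrim j (((1 - shift h) ^ j) F) ((windowIntegral h)^[j] F) := by
  induction j generalizing b F with
  | zero => intro U _; simp
  | succ j ih =>
    intro U hU
    rw [pow_succ' (1 - shift h), Module.End.mul_apply,
      (hF.one_sub_shift_pow hh j).integral_mul_one_sub_shift hh (hU.of_le (by simp)),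
      hF.windowIntegral_one_sub_shift_pow hh, ih (hF.windowIntegral hh) (deriv U)
        (contDiff_infty_iff_deriv.1 hU).2, ← Function.iterate_succ_apply, iteratedDeriv_succ']
    ring

/-! ### B-splines -/

theorem bddSupp_bspline (m : ℕ) : BddSupp 0 (m + 1 : ℕ) (bspline (m + 1)) := by
  induction m with
  | zero =>
    refine ⟨measurable_one.indicator measurableSet_Icc, ⟨1, fun x => ?_⟩, fun x hx => ?_⟩
    · exact (norm_indicator_le_norm_self _ x).trans (by simp)
    · simpa using Set.mem_of_indicator_ne_zero hx
  | succ m ih =>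
    have hsupp := ih.windowIntegral zero_le_one
    rwa [← Nat.cast_add_one] at hsupp

theorem integral_bspline (m : ℕ) : ∫ x, bspline (m + 1) x = 1 := by
  induction m with
  | zero => simp [bspline, integral_indicator measurableSet_Icc]
  | succ m ih =>
    calc ∫ x, bspline (m + 2) x
        = 1 * ∫ x, bspline (m + 1) x := (bddSupp_bspline m).integral_windowIntegral zero_le_one
      _ = 1 := by rw [ih, mul_one]

theorem bspline_nonneg (m : ℕ) (x : ℝ) : 0 ≤ bspline (m + 1) x := by
  induction m generalizing x with
  | zero => exact Set.indicator_nonneg (fun _ _ => zero_le_one) x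
  | succ m ih => exact intervalIntegral.integral_nonneg zero_le_one fun t _ => ih _

theorem bspline_pos (m : ℕ) {x : ℝ} (hx : x ∈ Set.Ioo (0 : ℝ) (m + 1 : ℕ)) :
    0 < bspline (m + 1) x := by
  induction m generalizing x with
  | zero =>
    have hmem : x ∈ Set.Icc (0 : ℝ) 1 := ⟨hx.1.le, by simpa using hx.2.le⟩
    simp [bspline, hmem]
  | succ m ih =>
    change 0 < ∫ t in (0 : ℝ)..1, bspline (m + 1) (x - t)
    push_cast at hx
    rw [intervalIntegral.integral_of_le zero_le_one, setIntegral_pos_iff_support_of_nonneg_ae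
      (Eventually.of_forall fun t => bspline_nonneg m _)
      ((bddSupp_bspline m).integrable.comp_sub_left x).integrableOn]
    have hlt : max 0 (x - (m + 1)) < min 1 x := by
      rw [max_lt_iff, lt_min_iff, lt_min_iff]
      exact ⟨⟨one_pos, hx.1⟩, by linarith [hx.2], by linarith [m.cast_nonneg (α := ℝ)]⟩
    have hsub : Set.Ioo (max 0 (x - (m + 1))) (min 1 x) ⊆
        Function.support (fun t => bspline (m + 1) (x - t)) ∩ Set.Ioc 0 1 := by
      rintro t ⟨h₁, h₂⟩
      rw [max_lt_iff] at h₁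
      rw [lt_min_iff] at h₂
      exact ⟨(ih ⟨by linarith, by push_cast; linarith⟩).ne', h₁.1, h₂.1.le⟩
    exact (by simpa using hlt : 0 < volume _).trans_le (measure_mono hsub)

/-- `⌊m/2⌋`, as a real number. -/
abbrev floorHalf (m : ℕ) : ℝ := (m / 2 : ℕ)

theorem floorHalf_nonneg (m : ℕ) : 0 ≤ floorHalf m := Nat.cast_nonneg _

theorem floorHalf_le (m : ℕ) : floorHalf m ≤ m := Nat.cast_le.2 (Nat.div_le_self m 2)

section

variable {m a b : ℕ} {r s : ℝ} {F : ℝ → ℝ}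

theorem bddSupp_phi₁ (hm : 1 ≤ m) : BddSupp (-floorHalf m) (m - floorHalf m) (phi₁ m) := by
  obtain ⟨m, rfl⟩ := Nat.exists_eq_add_of_le' hm
  simpa only [one_mul, sub_neg_eq_add, div_one, ← sub_eq_add_neg, zero_sub] using!
    (bddSupp_bspline m).comp_affine one_pos (-floorHalf (m + 1))

theorem integral_phi₁ (hm : 1 ≤ m) : ∫ x, phi₁ m x = 1 := by
  obtain ⟨m, rfl⟩ := Nat.exists_eq_add_of_le' hm
  rw [← integral_bspline m]
  exact integral_add_right_eq_self (bspline (m + 1)) _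

theorem phi₁_pos (hm : 1 ≤ m) {x : ℝ} (hx : x ∈ Set.Ioo (-floorHalf m) (m - floorHalf m)) :
    0 < phi₁ m x := by
  obtain ⟨m, rfl⟩ := Nat.exists_eq_add_of_le' hm
  exact bspline_pos m ⟨by linarith [hx.1], by linarith [hx.2]⟩

/-! ### Filters as difference operators -/

/-- The constant `± √(m choose a) 2^{-m}` in front of the polynomial of the filter `q_a`. -/
def filterConst (m a : ℕ) : ℝ := (-1) ^ (a / 2) * √(m.choose a) / 2 ^ m

theorem filterConst_ne_zero (ha : a ≤ m) : filterConst m a ≠ 0 := by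
  have hpos : 0 < √(m.choose a : ℝ) := Real.sqrt_pos.2 (Nat.cast_pos.2 (Nat.choose_pos ha))
  unfold filterConst
  positivity

/-- The polynomial `(1 - z)^a (1 + z)^{m-a}` of the filter `q_a`. -/
def filterPoly (m a : ℕ) : Polynomial ℝ := (1 - Polynomial.X) ^ a * (1 + Polynomial.X) ^ (m - a)

theorem natDegree_filterPoly_le (ha : a ≤ m) : (filterPoly m a).natDegree ≤ m := by
  have hsub : (1 - Polynomial.X : Polynomial ℝ).natDegree ≤ 1 :=
    (Polynomial.natDegree_sub_le _ _).trans (by simp)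
  have hadd : (1 + Polynomial.X : Polynomial ℝ).natDegree ≤ 1 :=
    (Polynomial.natDegree_add_le _ _).trans (by simp)
  calc (filterPoly m a).natDegree
      ≤ a * 1 + (m - a) * 1 := Polynomial.natDegree_mul_le_of_le
        (Polynomial.natDegree_pow_le_of_le a hsub) (Polynomial.natDegree_pow_le_of_le (m - a) hadd)
    _ = m := by omega

theorem filter₁_eq (m a j : ℕ) :
    filter₁ m a ((j : ℤ) - (m / 2 : ℕ)) = filterConst m a * (filterPoly m a).coeff j := by
  rw [filter₁, if_pos (by simp), sub_add_cancel, Int.toNat_natCast, filterConst, filterPoly]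

theorem mem_box₁_iff {k : ℤ} :
    k ∈ box₁ m ↔ ∃ j ≤ m, k = (j : ℤ) - (m / 2 : ℕ) := by
  rw [box₁, Finset.mem_Icc]
  refine ⟨fun hk => ⟨(k + (m / 2 : ℕ)).toNat, by omega, by omega⟩, ?_⟩
  rintro ⟨j, hj, rfl⟩
  omega

theorem sum_box₁ (m : ℕ) (f : ℤ → ℝ) :
    ∑ k ∈ box₁ m, f k = ∑ j ∈ Finset.range (m + 1), f (j - (m / 2 : ℕ)) := by
  refine (Finset.sum_nbij (fun j : ℕ => (j : ℤ) - (m / 2 : ℕ)) (fun j hj => ?_) ?_ ?_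
    fun _ _ => rfl).symm
  · exact mem_box₁_iff.2 ⟨j, Finset.mem_range_succ_iff.1 hj, rfl⟩
  · exact fun i _ j _ h => by simpa using h
  · intro k hk
    obtain ⟨j, hj, rfl⟩ := mem_box₁_iff.1 hk
    exact ⟨j, Finset.mem_coe.2 (Finset.mem_range_succ_iff.2 hj), rfl⟩

theorem filter₁_zero_ne_zero {k : ℤ} (hk : k ∈ box₁ m) : filter₁ m 0 k ≠ 0 := by
  obtain ⟨j, hj, rfl⟩ := mem_box₁_iff.1 hk
  rw [filter₁_eq, filterPoly, pow_zero, one_mul, Nat.sub_zero, Polynomial.coeff_one_add_X_pow]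
  exact mul_ne_zero (filterConst_ne_zero m.zero_le) (Nat.cast_ne_zero.2 (Nat.choose_pos hj).ne')

theorem mem_box₁_of_filter₁_ne_zero (ha : a ≤ m) {k : ℤ} (hk : filter₁ m a k ≠ 0) :
    k ∈ box₁ m := by
  have hnonneg : 0 ≤ k + (m / 2 : ℕ) := by
    by_contra h
    exact hk (if_neg h)
  obtain ⟨j, hj⟩ := Int.eq_ofNat_of_zero_le hnonneg
  obtain rfl : k = (j : ℤ) - (m / 2 : ℕ) := eq_sub_of_add_eq hj
  rw [filter₁_eq] at hk
  exact mem_box₁_iff.2 ⟨j, (Polynomial.le_natDegree_of_ne_zero (right_ne_zero_of_mul hk)).trans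
    (natDegree_filterPoly_le ha), rfl⟩

/-- Convolution with the filter `q_a`, that is `∑_k q_a[k] F(· - k)`. -/
def filterSum (m a : ℕ) (F : ℝ → ℝ) (x : ℝ) : ℝ := ∑ k ∈ box₁ m, filter₁ m a k * F (x - k)

theorem filterSum_eq (ha : a ≤ m) (F : ℝ → ℝ) :
    filterSum m a F = filterConst m a •
      ((1 - shift 1) ^ a) (((1 + shift 1) ^ (m - a)) (shift (-floorHalf m) F)) := by
  have haeval : ((1 - shift 1) ^ a) (((1 + shift 1) ^ (m - a)) (shift (-floorHalf m) F)) =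
      Polynomial.aeval (shift 1) (filterPoly m a) (shift (-floorHalf m) F) := by
    simp [filterPoly, Module.End.mul_apply]
  rw [haeval, Polynomial.aeval_eq_sum_range' (Nat.lt_succ_of_le (natDegree_filterPoly_le ha))]
  funext x
  rw [Pi.smul_apply, LinearMap.sum_apply, Finset.sum_apply, Finset.smul_sum, filterSum, sum_box₁]
  refine Finset.sum_congr rfl fun j _ => ?_
  simp only [filter₁_eq, LinearMap.smul_apply, Pi.smul_apply, shift_pow_apply, shift_apply,
    smul_eq_mul, mul_one, mul_assoc, Int.cast_sub, Int.cast_natCast]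
  ring_nf

theorem bddSupp_filterSum (ha : a ≤ m) (hF : BddSupp r s F) :
    BddSupp (r - floorHalf m) (s + (m - floorHalf m)) (filterSum m a F) := by
  rw [filterSum_eq ha]
  refine ((((hF.shift (-floorHalf m)).one_add_shift_pow zero_le_one (m - a)).one_sub_shift_pow
    zero_le_one a).smul _).mono (by linarith) ?_
  rw [Nat.cast_sub ha]
  linarith

/-- The smoothing of `F` whose `a`-th derivative is, up to a constant, `F` convolved with the
filter `q_a`: the factor `(1 - z)^a` of the filter is replaced by an `a`-fold integral over unit
windows, and the result is normalised so as to preserve the integral. -/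
def smear (m a : ℕ) (F : ℝ → ℝ) : ℝ → ℝ :=
  ((2 : ℝ) ^ (m - a))⁻¹ •
    (windowIntegral 1)^[a] (((1 + shift 1) ^ (m - a)) (shift (-floorHalf m) F))

theorem bddSupp_smear (ha : a ≤ m) (hF : BddSupp r s F) :
    BddSupp (r - floorHalf m) (s + (m - floorHalf m)) (smear m a F) := by
  refine ((((hF.shift (-floorHalf m)).one_add_shift_pow zero_le_one
    (m - a)).windowIntegral_iterate zero_le_one a).smul _).mono (by linarith) ?_
  rw [Nat.cast_sub ha]
  linarith

theorem integral_smear (hF : BddSupp r s F) (a : ℕ) : ∫ x, smear m a F x = ∫ x, F x := by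
  have hF' := hF.shift (-floorHalf m)
  simp only [smear, Pi.smul_apply, smul_eq_mul, integral_const_mul]
  rw [(hF'.one_add_shift_pow zero_le_one _).integral_windowIntegral_iterate zero_le_one,
    hF'.integral_one_add_shift_pow zero_le_one, one_pow, one_mul,
    inv_mul_cancel_left₀ (by positivity)]
  exact integral_sub_right_eq_self F _

/-- The constant in `filterSum m a F = smearConst m a • ∂^a (smear m a F)`. -/
def smearConst (m a : ℕ) : ℝ := filterConst m a * 2 ^ (m - a)

theorem smearConst_ne_zero (ha : a ≤ m) : smearConst m a ≠ 0 :=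
  mul_ne_zero (filterConst_ne_zero ha) (by positivity)

theorem smearConst_smul_smear (a : ℕ) (F : ℝ → ℝ) : smearConst m a • smear m a F =
    filterConst m a •
      (windowIntegral 1)^[a] (((1 + shift 1) ^ (m - a)) (shift (-floorHalf m) F)) := by
  rw [smear, smul_smul, smearConst, mul_inv_cancel_right₀ (by positivity)]

theorem isIteratedPrim_filterSum (ha : a ≤ m) (hF : BddSupp r s F) :
    IsIteratedPrim a (filterSum m a F) (smearConst m a • smear m a F) := by
  rw [filterSum_eq ha, smearConst_smul_smear]
  exact (((hF.shift _).one_add_shift_pow zero_le_one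
    (m - a)).isIteratedPrim_one_sub_shift_pow zero_le_one a).smul _

/-! ### The framelets as derivatives of smeared B-splines -/

theorem prim_smul (c : ℝ) (g : ℝ → ℝ) : prim (c • g) = c • prim g := by
  funext x
  simp only [prim, Pi.smul_apply, smul_eq_mul, integral_const_mul]

theorem prim_iterate_smul (c : ℝ) (g : ℝ → ℝ) (a : ℕ) : prim^[a] (c • g) = c • prim^[a] g := by
  induction a generalizing g with
  | zero => rfl
  | succ a ih => rw [Function.iterate_succ_apply, prim_smul, ih, Function.iterate_succ_apply]

theorem prim_comp_mul {l : ℝ} (hl : 0 < l) (g : ℝ → ℝ) :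
    prim (fun y => g (l * y)) = l⁻¹ • fun y => prim g (l * y) := by
  funext x
  have hscale := integral_comp_mul_sub hl 0 ((Set.Iic (l * x)).indicator g)
  simp only [prim, Pi.smul_apply, smul_eq_mul]
  rw [← integral_indicator measurableSet_Iic, ← integral_indicator measurableSet_Iic, ← hscale]
  simp [Set.indicator_apply, hl]

theorem prim_iterate_comp_mul {l : ℝ} (hl : 0 < l) (g : ℝ → ℝ) (a : ℕ) :
    prim^[a] (fun y => g (l * y)) = l⁻¹ ^ a • fun y => prim^[a] g (l * y) := by
  induction a generalizing g with
  | zero => simp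
  | succ a ih =>
    rw [Function.iterate_succ_apply, prim_comp_mul hl, prim_iterate_smul, ih, smul_smul,
      ← pow_succ', Function.iterate_succ_apply]

theorem prim_iterate_filterSum (ha : a ≤ m) (hF : BddSupp r s F) :
    prim^[a] (filterSum m a F) = smearConst m a • smear m a F := by
  rw [filterSum_eq ha, prim_iterate_smul, smearConst_smul_smear,
    ((hF.shift _).one_add_shift_pow zero_le_one (m - a)).prim_iterate_one_sub_shift_pow zero_le_one]

theorem prim_iterate_filterSum_comp_mul (ha : a ≤ m) (hF : BddSupp r s F) {l : ℝ} (hl : 0 < l) :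
    prim^[a] (fun y => l * filterSum m a F (l * y)) =
      fun y => l * (smearConst m a * l⁻¹ ^ a) * smear m a F (l * y) := by
  calc prim^[a] (l • fun y => filterSum m a F (l * y))
      = l • l⁻¹ ^ a • fun y => (smearConst m a • smear m a F) (l * y) := by
        rw [prim_iterate_smul, prim_iterate_comp_mul hl, prim_iterate_filterSum ha hF]
    _ = fun y => l * (smearConst m a * l⁻¹ ^ a) * smear m a F (l * y) := by
        funext y
        simp only [Pi.smul_apply, smul_eq_mul]
        ring

theorem integral_mul_comp_mul {l : ℝ} (hl : 0 < l) (c : ℝ) (F : ℝ → ℝ) :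
    ∫ y, l * c * F (l * y) = c * ∫ y, F y := by
  have hscale := integral_comp_mul_sub hl 0 F
  simp only [sub_zero] at hscale
  rw [integral_const_mul, hscale, mul_assoc, mul_left_comm c, mul_inv_cancel_left₀ hl.ne']

theorem integral_smear_phi₁ (hm : 1 ≤ m) (a : ℕ) : ∫ x, smear m a (phi₁ m) x = 1 := by
  rw [integral_smear (bddSupp_phi₁ hm), integral_phi₁ hm]

theorem bddSupp_smear_phi₁ (hm : 1 ≤ m) (ha : a ≤ m) :
    BddSupp (-(2 * floorHalf m)) (2 * (m - floorHalf m)) (smear m a (phi₁ m)) :=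
  (bddSupp_smear ha (bddSupp_phi₁ hm)).mono (by linarith) (by linarith)

theorem bddSupp_smear_smear_phi₁ (hm : 1 ≤ m) (ha : a ≤ m) (hb : b ≤ m) :
    BddSupp (-(3 * floorHalf m)) (3 * (m - floorHalf m)) (smear m b (smear m a (phi₁ m))) :=
  (bddSupp_smear hb (bddSupp_smear_phi₁ hm ha)).mono (by linarith) (by linarith)

theorem integral_smear_smear_phi₁ (hm : 1 ≤ m) (ha : a ≤ m) (b : ℕ) :
    ∫ x, smear m b (smear m a (phi₁ m)) x = 1 := by
  rw [integral_smear (bddSupp_smear_phi₁ hm ha), integral_smear_phi₁ hm]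

theorem vphi₁_eq_smearConst_mul (hm : 1 ≤ m) (ha : a ≤ m) :
    vphi₁ m a = fun y => 2 * (smearConst m a * 2⁻¹ ^ a) * smear m a (phi₁ m) (2 * y) :=
  prim_iterate_filterSum_comp_mul ha (bddSupp_phi₁ hm) two_pos

theorem c₁_eq (hm : 1 ≤ m) (ha : a ≤ m) : c₁ m a = smearConst m a * 2⁻¹ ^ a := by
  rw [c₁, vphi₁_eq_smearConst_mul hm ha, integral_mul_comp_mul two_pos, integral_smear_phi₁ hm,
    mul_one]

theorem c₁_ne_zero (hm : 1 ≤ m) (ha : a ≤ m) : c₁ m a ≠ 0 := by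
  rw [c₁_eq hm ha]
  exact mul_ne_zero (smearConst_ne_zero ha) (by positivity)

theorem vphi₁_eq (hm : 1 ≤ m) (ha : a ≤ m) (y : ℝ) :
    vphi₁ m a y = 2 * c₁ m a * smear m a (phi₁ m) (2 * y) := by
  rw [c₁_eq hm ha, vphi₁_eq_smearConst_mul hm ha]

theorem c₂_eq (hm : 1 ≤ m) (ha : a ≤ m) (hb : b ≤ m) : c₂ m b a = smearConst m b * 4⁻¹ ^ b := by
  have hsum : (fun y : ℝ => 2 * (c₁ m a)⁻¹ *
      ∑ k ∈ box₁ m, filter₁ m b k * vphi₁ m a (2 * y - k / 2)) =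
      fun y => 4 * filterSum m b (smear m a (phi₁ m)) (4 * y) := by
    funext y
    rw [filterSum, Finset.mul_sum, Finset.mul_sum]
    refine Finset.sum_congr rfl fun k _ => ?_
    have hc := c₁_ne_zero hm ha
    rw [vphi₁_eq hm ha, show 2 * (2 * y - (k : ℝ) / 2) = 4 * y - k by ring]
    field_simp
    ring
  rw [c₂, vphi₂, hsum, prim_iterate_filterSum_comp_mul hb (bddSupp_smear_phi₁ hm ha) four_pos,
    integral_mul_comp_mul four_pos, integral_smear_smear_phi₁ hm ha, mul_one]

end

/-! ### The index sets -/

section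

variable {m C n : ℕ}

theorem tsupport_phi (hm : 1 ≤ m) (n : ℕ) (k : ℤ × ℤ) :
    tsupport (phi m n k) =
      Set.Icc ((-floorHalf m + k.1) / 2 ^ n) ((m - floorHalf m + k.1) / 2 ^ n) ×ˢ
        Set.Icc ((-floorHalf m + k.2) / 2 ^ n) ((m - floorHalf m + k.2) / 2 ^ n) := by
  have hn : (0 : ℝ) < 2 ^ n := by positivity
  have hm₀ : (0 : ℝ) < m := Nat.cast_pos.2 hm
  have hne (j : ℤ) : (-floorHalf m + j) / 2 ^ n ≠ (m - floorHalf m + j) / 2 ^ n :=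
    (div_lt_div_of_pos_right (by linarith) hn).ne
  have hpos {j : ℤ} {x : ℝ} (hx : x ∈ Set.Ioo ((-floorHalf m + j) / 2 ^ n)
      ((m - floorHalf m + j) / 2 ^ n)) : 0 < phi₁ m (2 ^ n * x - j) := by
    rw [Set.mem_Ioo, div_lt_iff₀' hn, lt_div_iff₀' hn] at hx
    exact phi₁_pos hm ⟨by linarith [hx.1], by linarith [hx.2]⟩
  have hmem (j : ℤ) := ((bddSupp_phi₁ hm).comp_affine hn j).mem_Icc
  refine (closure_minimal ?_ (isClosed_Icc.prod isClosed_Icc)).antisymm ?_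
  · intro x hx
    have hx' := right_ne_zero_of_mul hx
    exact ⟨hmem _ _ (left_ne_zero_of_mul hx'), hmem _ _ (right_ne_zero_of_mul hx')⟩
  · rw [← closure_Ioo (hne _), ← closure_Ioo (hne _), ← closure_prod_eq]
    exact closure_mono fun x hx => (mul_pos hn (mul_pos (hpos hx.1) (hpos hx.2))).ne'

theorem tsupport_phi_subset_iff (hm : 1 ≤ m) {k : ℤ × ℤ} :
    tsupport (phi m n k) ⊆ closure Ω ↔
      (((m / 2 : ℕ) : ℤ) ≤ k.1 ∧ k.1 + m - (m / 2 : ℕ) ≤ 2 ^ n) ∧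
        (((m / 2 : ℕ) : ℤ) ≤ k.2 ∧ k.2 + m - (m / 2 : ℕ) ≤ 2 ^ n) := by
  have hn : (0 : ℝ) < 2 ^ n := by positivity
  have hle (j : ℤ) : (-floorHalf m + j) / 2 ^ n ≤ (m - floorHalf m + j) / 2 ^ n := by
    gcongr
    linarith [m.cast_nonneg (α := ℝ)]
  have hsub (j : ℤ) :
      Set.Icc ((-floorHalf m + j) / 2 ^ n) ((m - floorHalf m + j) / 2 ^ n) ⊆ Set.Icc 0 1 ↔
        ((m / 2 : ℕ) : ℤ) ≤ j ∧ j + m - (m / 2 : ℕ) ≤ 2 ^ n := by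
    rw [Set.Icc_subset_Icc_iff (hle j), div_le_one hn, le_div_iff₀ hn, zero_mul, neg_add_eq_sub,
      sub_nonneg, sub_add_eq_add_sub, add_comm (m : ℝ), ← Int.cast_le (R := ℝ),
      ← Int.cast_le (R := ℝ)]
    simp only [Int.cast_add, Int.cast_sub, Int.cast_natCast, Int.cast_pow, Int.cast_ofNat]
  rw [tsupport_phi hm, closure_Ω, Set.prod_subset_prod_iff'
    ((Set.nonempty_Icc.2 (hle _)).prod (Set.nonempty_Icc.2 (hle _))), hsub, hsub]

theorem mem_M_iff (hm : 1 ≤ m) {k : ℤ × ℤ} :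
    k ∈ M m n ↔ (((m / 2 : ℕ) : ℤ) ≤ k.1 ∧ k.1 + m - (m / 2 : ℕ) ≤ 2 ^ n) ∧
      (((m / 2 : ℕ) : ℤ) ≤ k.2 ∧ k.2 + m - (m / 2 : ℕ) ≤ 2 ^ n) := by
  simp only [M, Finset.mem_filter]
  rw [tsupport_phi_subset_iff hm, and_iff_right_iff_imp]
  rintro ⟨h₁, h₂⟩
  rw [O, Finset.mem_product, Finset.mem_Icc, Finset.mem_Icc]
  omega

theorem mem_K_iff {k : ℤ × ℤ} : k ∈ K m C n ↔ k ∈ M m n ∧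
    ∀ β : ℕ × ℕ, β.1 ≤ m → β.2 ≤ m → ∀ l : ℤ × ℤ, filt m β l ≠ 0 → k + (C : ℤ) • l ∈ M m n := by
  simp only [K, Finset.mem_filter]

theorem add_smul_mem_M {k : ℤ × ℤ} (hk : k ∈ K m C n) {l : ℤ × ℤ} (h₁ : l.1 ∈ box₁ m)
    (h₂ : l.2 ∈ box₁ m) : k + (C : ℤ) • l ∈ M m n :=
  (mem_K_iff.1 hk).2 (0, 0) (Nat.zero_le _) (Nat.zero_le _) l
    (mul_ne_zero (filter₁_zero_ne_zero h₁) (filter₁_zero_ne_zero h₂))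

theorem bounds_of_mem_K (hm : 1 ≤ m) (hC : 2 ≤ C) {k : ℤ × ℤ} (hk : k ∈ K m C n) :
    (3 * ((m / 2 : ℕ) : ℤ) ≤ k.1 ∧ k.1 + 3 * (m - (m / 2 : ℕ)) ≤ 2 ^ n) ∧
      (3 * ((m / 2 : ℕ) : ℤ) ≤ k.2 ∧ k.2 + 3 * (m - (m / 2 : ℕ)) ≤ 2 ^ n) := by
  have hlo : -((m / 2 : ℕ) : ℤ) ∈ box₁ m := mem_box₁_iff.2 ⟨0, m.zero_le, by simp⟩
  have hhi : (m : ℤ) - (m / 2 : ℕ) ∈ box₁ m := mem_box₁_iff.2 ⟨m, le_rfl, rfl⟩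
  have hMlo := (mem_M_iff hm).1 (add_smul_mem_M hk (l := (_, _)) hlo hlo)
  have hMhi := (mem_M_iff hm).1 (add_smul_mem_M hk (l := (_, _)) hhi hhi)
  have hC' : (2 : ℤ) ≤ C := Int.ofNat_le.2 hC
  have hfloor : 2 * ((m / 2 : ℕ) : ℤ) ≤ C * (m / 2 : ℕ) := by gcongr
  have hceil : 2 * ((m : ℤ) - (m / 2 : ℕ)) ≤ C * ((m : ℤ) - (m / 2 : ℕ)) := by
    gcongr
    omega
  simp only [Prod.fst_add, Prod.snd_add, Prod.smul_fst, Prod.smul_snd, smul_eq_mul,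
    mul_neg] at hMlo hMhi
  omega

theorem add_mem_M (hm : 1 ≤ m) (hC : 2 ≤ C) {k : ℤ × ℤ} (hk : k ∈ K m C n) {l : ℤ × ℤ}
    (h₁ : l.1 ∈ box₁ m) (h₂ : l.2 ∈ box₁ m) : k + l ∈ M m n := by
  have hbounds := bounds_of_mem_K hm hC hk
  rw [box₁, Finset.mem_Icc] at h₁ h₂
  rw [mem_M_iff hm, Prod.fst_add, Prod.snd_add]
  omega

theorem mem_K_of_bounds (hm : 1 ≤ m) {k : ℤ × ℤ}
    (h₁ : ((C + 1) * m : ℤ) ≤ k.1 ∧ k.1 + (C + 1) * m ≤ 2 ^ n)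
    (h₂ : ((C + 1) * m : ℤ) ≤ k.2 ∧ k.2 + (C + 1) * m ≤ 2 ^ n) : k ∈ K m C n := by
  have hCm : (0 : ℤ) ≤ C * m := by positivity
  have hsmul {j : ℤ} (hj : j ∈ box₁ m) : -(C * m : ℤ) ≤ C * j ∧ (C * j : ℤ) ≤ C * m := by
    rw [box₁, Finset.mem_Icc] at hj
    rw [← mul_neg]
    constructor <;> gcongr <;> omega
  rw [add_one_mul] at h₁ h₂
  rw [mem_K_iff, mem_M_iff hm]
  refine ⟨by omega, fun β hβ₁ hβ₂ l hl => ?_⟩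
  have hl₁ := hsmul (mem_box₁_of_filter₁_ne_zero hβ₁ (left_ne_zero_of_mul hl))
  have hl₂ := hsmul (mem_box₁_of_filter₁_ne_zero hβ₂ (right_ne_zero_of_mul hl))
  rw [mem_M_iff hm]
  simp only [Prod.fst_add, Prod.snd_add, Prod.smul_fst, Prod.smul_snd, smul_eq_mul]
  omega

theorem cell_bounds_of_mem_K (hm : 1 ≤ m) {k : ℤ × ℤ} (hk : k ∈ K m C n) :
    (0 ≤ k.1 ∧ k.1 + 1 ≤ 2 ^ n) ∧ (0 ≤ k.2 ∧ k.2 + 1 ≤ 2 ^ n) := by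
  have hM := (mem_M_iff hm).1 (mem_K_iff.1 hk).1
  omega

/-! ### Arrays as piecewise constant functions -/

/-- The index of the dyadic cell of side `2^{-n}` containing `x`. -/
def cellIdx (n : ℕ) (x : ℝ × ℝ) : ℤ × ℤ := (⌊2 ^ n * x.1⌋, ⌊2 ^ n * x.2⌋)

theorem measurable_cellIdx (n : ℕ) : Measurable (cellIdx n) :=
  (Int.measurable_floor.comp (by fun_prop)).prodMk (Int.measurable_floor.comp (by fun_prop))

theorem measurableSet_cellIdx_preimage (n : ℕ) (k : ℤ × ℤ) : MeasurableSet (cellIdx n ⁻¹' {k}) :=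
  measurable_cellIdx n (measurableSet_singleton k)

theorem cellIdx_preimage (n : ℕ) (k : ℤ × ℤ) : cellIdx n ⁻¹' {k} =
    Set.Ico ((k.1 : ℝ) / 2 ^ n) ((k.1 + 1) / 2 ^ n) ×ˢ
      Set.Ico ((k.2 : ℝ) / 2 ^ n) ((k.2 + 1) / 2 ^ n) := by
  have hn : (0 : ℝ) < 2 ^ n := by positivity
  obtain ⟨k₁, k₂⟩ := k
  ext x
  simp only [cellIdx, Set.mem_preimage, Set.mem_singleton_iff, Prod.mk.injEq, Int.floor_eq_iff,
    Set.mem_prod, Set.mem_Ico, div_le_iff₀' hn, lt_div_iff₀' hn]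

theorem μΩ_real_cell {k : ℤ × ℤ}
    (hk : (0 ≤ k.1 ∧ k.1 + 1 ≤ 2 ^ n) ∧ (0 ≤ k.2 ∧ k.2 + 1 ≤ 2 ^ n)) :
    μΩ.real (cellIdx n ⁻¹' {k}) = (2 ^ (2 * n))⁻¹ := by
  have hn : (0 : ℝ) < 2 ^ n := by positivity
  have hsub {j : ℤ} (hj : 0 ≤ j ∧ j + 1 ≤ 2 ^ n) :
      Set.Ico ((j : ℝ) / 2 ^ n) ((j + 1) / 2 ^ n) ⊆ Set.Ico 0 1 := by
    refine Set.Ico_subset_Ico (div_nonneg (Int.cast_nonneg hj.1) hn.le) ?_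
    rw [div_le_one hn]
    exact_mod_cast hj.2
  have hvol (j : ℤ) : volume (Set.Ico ((j : ℝ) / 2 ^ n) ((j + 1) / 2 ^ n)) =
      ENNReal.ofReal (2 ^ n)⁻¹ := by
    rw [Real.volume_Ico, ← sub_div, add_sub_cancel_left, one_div]
  rw [Measure.real, μΩ, Measure.restrict_congr_set Ω_ae_eq_Ico,
    Measure.restrict_apply (measurableSet_cellIdx_preimage n k), cellIdx_preimage,
    Set.inter_eq_left.2 (Set.prod_mono (hsub hk.1) (hsub hk.2)), Measure.volume_eq_prod,
    Measure.prod_prod, hvol, hvol, ENNReal.toReal_mul, ENNReal.toReal_ofReal (by positivity),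
    ← mul_inv, ← pow_add, two_mul]

/-- The piecewise constant function with the values of an array on `K_n`: the value at `k` is
taken on the dyadic cell with lower left corner `2^{-n} k`. -/
def step (a : K m C n → ℝ) (x : ℝ × ℝ) : ℝ :=
  if h : cellIdx n x ∈ K m C n then a ⟨cellIdx n x, h⟩ else 0

theorem step_eq_sum (a : K m C n → ℝ) :
    step a = fun x => ∑ k : K m C n, (cellIdx n ⁻¹' {k.1}).indicator (fun _ => a k) x := by
  funext x
  rw [step]
  split_ifs with hx
  · rw [Fintype.sum_eq_single ⟨cellIdx n x, hx⟩, Set.indicator_of_mem]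
    · exact Set.mem_singleton _
    · intro k hk
      refine Set.indicator_of_notMem (fun h => hk ?_) _
      exact Subtype.ext (Set.mem_singleton_iff.1 h).symm
  · refine (Finset.sum_eq_zero fun k _ => Set.indicator_of_notMem (fun h => hx ?_) _).symm
    exact Set.mem_singleton_iff.1 h ▸ k.2

theorem memLp_step (a : K m C n → ℝ) (p : ℝ≥0∞) : MemLp (step a) p μΩ := by
  rw [step_eq_sum]
  exact memLp_finsetSum _ fun k _ =>
    (memLp_const (a k)).indicator (measurableSet_cellIdx_preimage n k.1)

theorem integral_step (hm : 1 ≤ m) (a : K m C n → ℝ) :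
    ∫ x, step a x ∂μΩ = (2 ^ (2 * n))⁻¹ * ∑ k, a k := by
  rw [step_eq_sum, integral_finsetSum _ fun k _ => (integrable_const _).indicator
    (measurableSet_cellIdx_preimage n k.1), Finset.mul_sum]
  refine Finset.sum_congr rfl fun k _ => ?_
  rw [integral_indicator_const _ (measurableSet_cellIdx_preimage n k.1),
    μΩ_real_cell (cell_bounds_of_mem_K hm k.2), smul_eq_mul]

theorem arrayNorm_eq_vecNorm (hm : 1 ≤ m) {ι : Type} [Fintype ι] {p : ℝ≥0∞} (hp : p ≠ 0)
    (hp' : p ≠ ⊤) (a : ι → K m C n → ℝ) : arrayNorm p a = vecNorm p fun i => step (a i) := by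
  have hpos : 0 < p.toReal := ENNReal.toReal_pos hp hp'
  rw [arrayNorm, ← integral_step hm, vecNorm]
  congr 2
  funext x
  simp only [step]
  split_ifs with hx
  · rfl
  · simp [hpos.ne']

end

section

variable {ι : Type} [Fintype ι] {p : ℝ≥0∞}

theorem vecNorm_eq_eLpNorm (hp : p ≠ 0) (hp' : p ≠ ⊤) {g : ι → ℝ × ℝ → ℝ}
    (hg : ∀ i, MemLp (g i) p μΩ) :
    vecNorm p g =
      (eLpNorm (fun x => (WithLp.toLp 2 fun i => g i x : EuclideanSpace ℝ ι)) p μΩ).toReal := by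
  rw [(MemLp.of_eval_piLp hg).eLpNorm_eq_integral_rpow_norm hp hp',
    ENNReal.toReal_ofReal (by positivity), vecNorm, one_div]
  congr 2
  funext x
  rw [EuclideanSpace.norm_eq, Real.sqrt_eq_rpow, ← Real.rpow_mul (by positivity),
    one_div_mul_eq_div]
  rfl

theorem norm_toLp_le_sum (c : ι → ℝ) :
    ‖(WithLp.toLp 2 c : EuclideanSpace ℝ ι)‖ ≤ ∑ i, ‖c i‖ := by
  rw [EuclideanSpace.norm_eq]
  exact Real.sqrt_le_iff.2 ⟨by positivity,
    Finset.sum_sq_le_sq_sum_of_nonneg fun i _ => norm_nonneg (c i)⟩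

theorem tendsto_vecNorm (hp : 1 ≤ p) (hp' : p ≠ ⊤) {G : ℕ → ι → ℝ × ℝ → ℝ}
    {g : ι → ℝ × ℝ → ℝ} (hG : ∀ n i, MemLp (G n i) p μΩ) (hg : ∀ i, MemLp (g i) p μΩ)
    (hlim : ∀ i, Tendsto (fun n => eLpNorm (G n i - g i) p μΩ) atTop (𝓝 0)) :
    Tendsto (fun n => vecNorm p (G n)) atTop (𝓝 (vecNorm p g)) := by
  have : Fact (1 ≤ p) := ⟨hp⟩
  let vec (h : ι → ℝ × ℝ → ℝ) (x : ℝ × ℝ) : EuclideanSpace ℝ ι := WithLp.toLp 2 fun i => h i x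
  have hvec {h : ι → ℝ × ℝ → ℝ} (hh : ∀ i, MemLp (h i) p μΩ) : MemLp (vec h) p μΩ :=
    MemLp.of_eval_piLp hh
  have hle (n : ℕ) : eLpNorm (vec (G n) - vec g) p μΩ ≤ ∑ i, eLpNorm (G n i - g i) p μΩ := by
    calc eLpNorm (vec (G n) - vec g) p μΩ
        ≤ eLpNorm (∑ i, fun x => ‖(G n i - g i) x‖) p μΩ := by
          refine eLpNorm_mono_real fun x => ?_
          rw [Finset.sum_apply]
          exact norm_toLp_le_sum fun i => (G n i - g i) x
      _ ≤ ∑ i, eLpNorm (fun x => ‖(G n i - g i) x‖) p μΩ :=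
          eLpNorm_sum_le (fun i _ => ((hG n i).sub (hg i)).1.norm) hp
      _ = ∑ i, eLpNorm (G n i - g i) p μΩ := by simp only [eLpNorm_norm]
  have hsum : Tendsto (fun n => ∑ i, eLpNorm (G n i - g i) p μΩ) atTop (𝓝 0) := by
    simpa using tendsto_finsetSum Finset.univ fun i _ => hlim i
  have htoLp := (Lp.tendsto_Lp_iff_tendsto_eLpNorm'' _ (fun n => hvec (hG n)) _ (hvec hg)).2
    (tendsto_of_tendsto_of_tendsto_of_le_of_le tendsto_const_nhds hsum (fun _ => zero_le) hle)
  have hp₀ : p ≠ 0 := (zero_lt_one.trans_le hp).ne'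
  simp only [vecNorm_eq_eLpNorm hp₀ hp' (hG _), vecNorm_eq_eLpNorm hp₀ hp' hg]
  simpa only [Lp.norm_toLp] using htoLp.norm

end

/-! ### Smooth approximation in the square -/

open scoped Convolution
open ContinuousLinearMap (lsmul)

theorem contDiff_pd_iterate (e : ℝ × ℝ) (k : ℕ) {η : ℝ × ℝ → ℝ} (h : ContDiff ℝ ∞ η) :
    ContDiff ℝ ∞ ((pd e)^[k] η) := by
  induction k with
  | zero => exact h
  | succ k ih =>
    rw [Function.iterate_succ_apply']
    exact (ih.fderiv_right (m := ∞) (by simp)).clm_apply contDiff_const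

theorem contDiff_pderiv (α : ℕ × ℕ) {η : ℝ × ℝ → ℝ} (h : ContDiff ℝ ∞ η) :
    ContDiff ℝ ∞ (pderiv α η) :=
  contDiff_pd_iterate _ _ (contDiff_pd_iterate _ _ h)

theorem pd_iterate_comp_affine (e : ℝ × ℝ) (k : ℕ) {η : ℝ × ℝ → ℝ} (h : ContDiff ℝ ∞ η)
    (c l : ℝ) (b : ℝ × ℝ) : (pd e)^[k] (fun x => c * η (l • x + b)) =
      fun x => c * l ^ k * (pd e)^[k] η (l • x + b) := by
  induction k with
  | zero => simp
  | succ k ih =>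
    rw [Function.iterate_succ_apply', ih, Function.iterate_succ_apply']
    funext x
    have hη : HasFDerivAt ((pd e)^[k] η) (fderiv ℝ ((pd e)^[k] η) (l • x + b)) (l • x + b) :=
      ((contDiff_pd_iterate e k h).differentiable (by simp) _).hasFDerivAt
    have hL : HasFDerivAt (fun x : ℝ × ℝ => l • x + b) (l • ContinuousLinearMap.id ℝ (ℝ × ℝ)) x :=
      ((hasFDerivAt_id x).const_smul l).add_const b
    have hcomp : fderiv ℝ (fun x => c * l ^ k * (pd e)^[k] η (l • x + b)) x = _ :=
      ((hη.comp x hL).const_mul (c * l ^ k)).fderiv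
    rw [pd, hcomp]
    simp only [smul_apply, ContinuousLinearMap.comp_apply,
      ContinuousLinearMap.id_apply, map_smul, smul_eq_mul, pd]
    ring

theorem pderiv_comp_affine (α : ℕ × ℕ) {η : ℝ × ℝ → ℝ} (h : ContDiff ℝ ∞ η) (l : ℝ) (b : ℝ × ℝ) :
    pderiv α (fun x => η (l • x + b)) =
      fun x => l ^ (α.1 + α.2) * pderiv α η (l • x + b) := by
  have h₂ := pd_iterate_comp_affine (0, 1) α.2 h 1 l b
  simp only [one_mul] at h₂
  simp only [pderiv]
  rw [h₂, pd_iterate_comp_affine _ _ (contDiff_pd_iterate _ _ h), pow_add]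
  funext x
  ring

theorem pderiv_comp_const_sub (α : ℕ × ℕ) {η : ℝ × ℝ → ℝ} (h : ContDiff ℝ ∞ η) (z : ℝ × ℝ) :
    pderiv α (fun y => η (z - y)) = fun y => (-1) ^ (α.1 + α.2) * pderiv α η (z - y) := by
  have hneg (y : ℝ × ℝ) : (-1 : ℝ) • y + z = z - y := by rw [neg_one_smul, neg_add_eq_sub]
  simpa only [hneg] using pderiv_comp_affine α h (-1) z

theorem pd_iterate_convolution (e : ℝ × ℝ) (k : ℕ) {f ρ : ℝ × ℝ → ℝ} (hf : LocallyIntegrable f)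
    (h : ContDiff ℝ ∞ ρ ∧ HasCompactSupport ρ) :
    (pd e)^[k] (f ⋆[lsmul ℝ ℝ] ρ) = f ⋆[lsmul ℝ ℝ] (pd e)^[k] ρ := by
  induction k with
  | zero => rfl
  | succ k ih =>
    rw [Function.iterate_succ_apply', ih, Function.iterate_succ_apply']
    obtain ⟨hsmooth, hcpt⟩ := pd_iterate_smooth e k h
    have hC1 : ContDiff ℝ 1 ((pd e)^[k] ρ) := hsmooth.of_le (by simp)
    funext x
    rw [pd, (hcpt.hasFDerivAt_convolution_right _ hf hC1 x).fderiv,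
      convolution_precompR_apply _ hf (hcpt.fderiv ℝ) (hC1.continuous_fderiv (by simp))]
    rfl

theorem pderiv_convolution (α : ℕ × ℕ) {f ρ : ℝ × ℝ → ℝ} (hf : LocallyIntegrable f)
    (h : ContDiff ℝ ∞ ρ ∧ HasCompactSupport ρ) :
    pderiv α (f ⋆[lsmul ℝ ℝ] ρ) = f ⋆[lsmul ℝ ℝ] pderiv α ρ := by
  simp only [pderiv]
  rw [pd_iterate_convolution _ _ hf h, pd_iterate_convolution _ _ hf (pd_iterate_smooth _ _ h)]

theorem convolution_indicator_Ω (u ρ : ℝ × ℝ → ℝ) (z : ℝ × ℝ) :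
    (Ω.indicator u ⋆[lsmul ℝ ℝ] ρ) z = ∫ y, u y * ρ (z - y) ∂μΩ := by
  rw [convolution, ← integral_indicator measurableSet_Ω]
  refine integral_congr_ae (Eventually.of_forall fun y => ?_)
  by_cases hy : y ∈ Ω <;> simp [hy]

theorem locallyIntegrable_indicator_Ω {u : ℝ × ℝ → ℝ} (hu : Integrable u μΩ) :
    LocallyIntegrable (Ω.indicator u) :=
  ((integrable_indicator_iff measurableSet_Ω).2 hu).locallyIntegrable

theorem HasWeakDeriv.pderiv_convolution_apply {α : ℕ × ℕ} {u g ρ : ℝ × ℝ → ℝ} {z : ℝ × ℝ}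
    (h : HasWeakDeriv α u g) (hu : Integrable u μΩ) (hρ : ContDiff ℝ ∞ ρ ∧ HasCompactSupport ρ)
    (hz : IsTest fun y => ρ (z - y)) :
    pderiv α (Ω.indicator u ⋆[lsmul ℝ ℝ] ρ) z = ∫ y, g y * ρ (z - y) ∂μΩ := by
  have hparts := h _ hz
  simp only [pderiv_comp_const_sub α hρ.1, mul_left_comm _ ((-1 : ℝ) ^ (α.1 + α.2)),
    integral_const_mul] at hparts
  rw [pderiv_convolution α (locallyIntegrable_indicator_Ω hu) hρ,
    convolution_indicator_Ω]
  exact mul_left_cancel₀ (pow_ne_zero _ (by norm_num)) hparts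

/-- The bump function underlying `mollifier n`, supported in the ball of radius `2^{-n-2}`. -/
def mollifierBump (n : ℕ) : ContDiffBump (0 : ℝ × ℝ) where
  rIn := (2 ^ (n + 3))⁻¹
  rOut := (2 ^ (n + 2))⁻¹
  rIn_pos := by positivity
  rIn_lt_rOut := by
    gcongr
    · norm_num
    · omega

/-- A smooth mollifier supported in the ball of radius `2^{-n-2}`. -/
def mollifier (n : ℕ) : ℝ × ℝ → ℝ := (mollifierBump n).normed volume

theorem mollifier_smooth (n : ℕ) : ContDiff ℝ ∞ (mollifier n) ∧ HasCompactSupport (mollifier n) :=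
  ⟨(mollifierBump n).contDiff_normed (n := (⊤ : ℕ∞)), (mollifierBump n).hasCompactSupport_normed⟩

theorem norm_mollifier_le (n : ℕ) (x : ℝ × ℝ) : ‖mollifier n x‖ ≤ 16 * 4 ^ n := by
  rw [mollifier, Real.norm_of_nonneg ((mollifierBump n).nonneg_normed x)]
  refine ((mollifierBump n).normed_le_div_measure_closedBall_rIn volume x).trans (le_of_eq ?_)
  rw [Measure.real, volume_closedBall_prod, ← ENNReal.ofReal_mul (by simp [mollifierBump]),
    ENNReal.toReal_ofReal (mul_self_nonneg _)]
  have h4 : (4 : ℝ) ^ n = 2 ^ n * 2 ^ n := by rw [← mul_pow]; norm_num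
  simp only [mollifierBump]
  rw [h4, pow_add]
  field_simp
  norm_num

theorem integral_mollifier (n : ℕ) : ∫ x, mollifier n x = 1 := (mollifierBump n).integral_normed

theorem tsupport_mollifier (n : ℕ) :
    tsupport (mollifier n) = Metric.closedBall 0 (2 ^ (n + 2))⁻¹ :=
  (mollifierBump n).tsupport_normed_eq

/-- The ratio of the contraction `contract n`. -/
def contractRatio (n : ℕ) : ℝ := 1 - (2 ^ n)⁻¹

/-- The contraction of the square towards its centre, which makes room for `mollifier n`. -/
def contract (n : ℕ) (x : ℝ × ℝ) : ℝ × ℝ :=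
  contractRatio n • x + (2⁻¹ * (2 ^ n)⁻¹, 2⁻¹ * (2 ^ n)⁻¹)

theorem contDiff_contract (n : ℕ) : ContDiff ℝ ∞ (contract n) := by
  unfold contract
  fun_prop

theorem tendsto_contractRatio_pow (k : ℕ) : Tendsto (fun n => contractRatio n ^ k) atTop (𝓝 1) := by
  have h : Tendsto (fun n : ℕ => ((2 : ℝ) ^ n)⁻¹) atTop (𝓝 0) :=
    tendsto_inv_atTop_zero.comp (tendsto_pow_atTop_atTop_of_one_lt one_lt_two)
  simpa [contractRatio] using (h.const_sub 1).pow k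

theorem mem_Ω_and_dist_le_of_contract_sub_mem {n : ℕ} {x y : ℝ × ℝ} (hx : x ∈ Ω)
    (hy : contract n x - y ∈ tsupport (mollifier n)) : y ∈ Ω ∧ dist x y ≤ 1 * (2 ^ n)⁻¹ := by
  obtain ⟨x₁, x₂⟩ := x
  obtain ⟨y₁, y₂⟩ := y
  rw [tsupport_mollifier, mem_closedBall_zero_iff, Prod.norm_def, max_le_iff, pow_add,
    mul_inv] at hy
  have hq : 0 < ((2 : ℝ) ^ n)⁻¹ := by positivity
  have hq1 : ((2 : ℝ) ^ n)⁻¹ ≤ 1 := inv_le_one_of_one_le₀ (one_le_pow₀ one_le_two)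
  simp only [contract, contractRatio, Prod.smul_mk, Prod.mk_add_mk, Prod.mk_sub_mk, smul_eq_mul,
    Real.norm_eq_abs, abs_le] at hy
  obtain ⟨⟨h₁, h₁'⟩, h₂, h₂'⟩ := hy
  obtain ⟨⟨hx₁, hx₁'⟩, hx₂, hx₂'⟩ := hx
  simp only at hx₁ hx₁' hx₂ hx₂'
  generalize ((2 : ℝ) ^ n)⁻¹ = q at *
  constructor
  · refine ⟨⟨?_, ?_⟩, ?_, ?_⟩ <;> simp only <;> nlinarith
  · simp only [Prod.dist_eq, max_le_iff, Real.dist_eq, abs_le]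
    refine ⟨⟨?_, ?_⟩, ?_, ?_⟩ <;> nlinarith

theorem isTest_mollifier (n : ℕ) {x : ℝ × ℝ} (hx : x ∈ Ω) :
    IsTest fun y => mollifier n (contract n x - y) := by
  have hsub : tsupport (fun y => mollifier n (contract n x - y)) ⊆
      (fun y => contract n x - y) ⁻¹' tsupport (mollifier n) :=
    tsupport_comp_subset_preimage (mollifier n) (by fun_prop)
  have hcpt : IsCompact ((fun y => contract n x - y) ⁻¹' tsupport (mollifier n)) :=
    (Homeomorph.subLeft (contract n x)).isCompact_preimage.2 (mollifier_smooth n).2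
  exact ⟨(mollifier_smooth n).1.comp (by fun_prop),
    hcpt.of_isClosed_subset (isClosed_tsupport _) hsub,
    fun y hy => (mem_Ω_and_dist_le_of_contract_sub_mem hx (hsub hy)).1⟩

theorem isApproxIdentity_mollifier :
    IsApproxIdentity μΩ (fun n x y => mollifier n (contract n x - y)) (4 * 16 * 1 ^ 2)
      fun n => 1 * (2 ^ n)⁻¹ := by
  refine .of_bound zero_le_one (fun n => ?_) (fun n x y => norm_mollifier_le n _)
    (fun n x hx y hy => (mem_Ω_and_dist_le_of_contract_sub_mem hx (subset_tsupport _ hy)).2)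
    fun x hx => Eventually.of_forall fun n => ?_
  · exact ((mollifier_smooth n).1.continuous.comp
      (((contDiff_contract n).continuous.comp continuous_fst).sub continuous_snd)).measurable
  · rw [setIntegral_eq_integral_of_forall_compl_eq_zero, ← integral_mollifier n]
    · exact integral_sub_left_eq_self (mollifier n) volume (contract n x)
    · intro y hy
      by_contra hne
      exact hy (mem_Ω_and_dist_le_of_contract_sub_mem hx (subset_tsupport _ hne)).1

/-- The smooth approximations of a function on `Ω`, mollified after a contraction so that only
values inside `Ω` enter. -/
def smoothApprox (n : ℕ) (u : ℝ × ℝ → ℝ) (x : ℝ × ℝ) : ℝ :=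
  (Ω.indicator u ⋆[lsmul ℝ ℝ] mollifier n) (contract n x)

section

variable {u g : ℝ × ℝ → ℝ} {α : ℕ × ℕ}

theorem contDiff_convolution_mollifier (n : ℕ) (hu : Integrable u μΩ) :
    ContDiff ℝ ∞ (Ω.indicator u ⋆[lsmul ℝ ℝ] mollifier n) :=
  (mollifier_smooth n).2.contDiff_convolution_right (n := (⊤ : ℕ∞)) _
    (locallyIntegrable_indicator_Ω hu) (mollifier_smooth n).1

theorem contDiff_smoothApprox (n : ℕ) (hu : Integrable u μΩ) : ContDiff ℝ ∞ (smoothApprox n u) :=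
  (contDiff_convolution_mollifier n hu).comp (contDiff_contract n)

theorem HasWeakDeriv.pderiv_smoothApprox (n : ℕ) (hu : Integrable u μΩ) (h : HasWeakDeriv α u g)
    {x : ℝ × ℝ} (hx : x ∈ Ω) :
    pderiv α (smoothApprox n u) x = kernelOp μΩ (fun x y => mollifier n (contract n x - y))
      (fun y => contractRatio n ^ (α.1 + α.2) * g y) x := by
  have hchain : pderiv α (smoothApprox n u) x = contractRatio n ^ (α.1 + α.2) *
      pderiv α (Ω.indicator u ⋆[lsmul ℝ ℝ] mollifier n) (contract n x) :=
    congrFun (pderiv_comp_affine α (contDiff_convolution_mollifier n hu) _ _) x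
  rw [hchain, h.pderiv_convolution_apply hu (mollifier_smooth n) (isTest_mollifier n hx), kernelOp,
    ← integral_const_mul]
  exact integral_congr_ae (Eventually.of_forall fun y => by ring)

theorem HasWeakDeriv.tendsto_pderiv_smoothApprox (hu : Integrable u μΩ) (hg : Integrable g μΩ)
    (h : HasWeakDeriv α u g) :
    Tendsto (fun n => eLpNorm (pderiv α (smoothApprox n u) - g) 1 μΩ) atTop (𝓝 0) := by
  have hg1 := memLp_one_iff_integrable.2 hg
  have hscale : Tendsto (fun n => eLpNorm ((fun y => contractRatio n ^ (α.1 + α.2) * g y) - g)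
      1 μΩ) atTop (𝓝 0) := by
    have hnorm (n : ℕ) : eLpNorm ((fun y => contractRatio n ^ (α.1 + α.2) * g y) - g) 1 μΩ =
        ‖contractRatio n ^ (α.1 + α.2) - 1‖ₑ * eLpNorm g 1 μΩ := by
      rw [← eLpNorm_const_smul]
      congr 1
      funext y
      simp [sub_mul]
    have hratio := ((tendsto_contractRatio_pow (α.1 + α.2)).sub_const 1).enorm
    rw [sub_self, enorm_zero] at hratio
    simp only [hnorm]
    simpa only [zero_mul] using
      ENNReal.Tendsto.mul_const hratio (Or.inr hg1.eLpNorm_ne_top)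
  refine (isApproxIdentity_mollifier.tendsto (by norm_num) le_rfl ENNReal.one_ne_top
    (fun n => hg1.const_mul _) hg1 hscale).congr fun n => eLpNorm_congr_ae ?_
  filter_upwards [ae_mem_Ω] with x hx
  rw [Pi.sub_apply, Pi.sub_apply, h.pderiv_smoothApprox n hu hx]

theorem hasWeakDeriv_zero (u : ℝ × ℝ → ℝ) : HasWeakDeriv (0, 0) u u := by
  intro η _
  simp [pderiv]

theorem tendsto_smoothApprox (hu : Integrable u μΩ) :
    Tendsto (fun n => eLpNorm (smoothApprox n u - u) 1 μΩ) atTop (𝓝 0) := by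
  simpa only [pderiv, Function.iterate_zero, id_eq] using
    (hasWeakDeriv_zero u).tendsto_pderiv_smoothApprox hu hu

end

/-! ### Integration by parts on the square -/

theorem setIntegral_Ω_eq_integral {w : ℝ × ℝ → ℝ}
    (hw : ∀ x, w x ≠ 0 → x ∈ Set.Icc (0 : ℝ) 1 ×ˢ Set.Icc (0 : ℝ) 1) :
    ∫ x, w x ∂μΩ = ∫ x, w x := by
  rw [setIntegral_congr_set Ω_ae_eq_Icc, setIntegral_eq_integral_of_forall_compl_eq_zero]
  exact fun x => not_imp_comm.1 (hw x)

theorem integrable_of_continuous {η : ℝ × ℝ → ℝ} (h : Continuous η) : Integrable η μΩ := by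
  rw [μΩ, Measure.restrict_congr_set Ω_ae_eq_Icc]
  exact h.continuousOn.integrableOn_compact (isCompact_Icc.prod isCompact_Icc)

theorem tendsto_integral_mul_of_bounded {X : Type*} [MeasurableSpace X] {μ : Measure X}
    {w : X → ℝ} (hw : Measurable w) (hB : ∃ B, ∀ x, ‖w x‖ ≤ B) {F : ℕ → X → ℝ} {f : X → ℝ}
    (hF : ∀ n, Integrable (F n) μ) (hf : Integrable f μ)
    (h : Tendsto (fun n => eLpNorm (F n - f) 1 μ) atTop (𝓝 0)) :
    Tendsto (fun n => ∫ x, F n x * w x ∂μ) atTop (𝓝 (∫ x, f x * w x ∂μ)) := by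
  obtain ⟨B, hB⟩ := hB
  have hint {g : X → ℝ} (hg : Integrable g μ) : Integrable (fun x => g x * w x) μ :=
    hg.mul_bdd hw.aestronglyMeasurable (Eventually.of_forall hB)
  have hlim : Tendsto (fun n => ENNReal.ofReal B * eLpNorm (F n - f) 1 μ) atTop (𝓝 0) := by
    simpa only [mul_zero] using ENNReal.Tendsto.const_mul h (Or.inr ENNReal.ofReal_ne_top)
  refine tendsto_integral_of_L1' _ (hint hf).aestronglyMeasurable
    (Eventually.of_forall fun n => hint (hF n))
    (tendsto_of_tendsto_of_tendsto_of_le_of_le tendsto_const_nhds hlim (fun _ => zero_le)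
      fun n => eLpNorm_le_mul_eLpNorm_of_ae_le_mul (Eventually.of_forall fun x => ?_) 1)
  simp only [Pi.sub_apply]
  rw [← sub_mul, norm_mul, mul_comm]
  exact mul_le_mul_of_nonneg_right (hB x) (norm_nonneg _)

theorem iteratedDeriv_fst {η : ℝ × ℝ → ℝ} (h : ContDiff ℝ ∞ η) (i : ℕ) (y : ℝ) :
    iteratedDeriv i (fun x => η (x, y)) = fun x => (pd (1, 0))^[i] η (x, y) := by
  induction i with
  | zero => simp
  | succ i ih =>
    funext x
    rw [iteratedDeriv_succ, ih, Function.iterate_succ_apply']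
    exact (((contDiff_pd_iterate (1, 0) i h).differentiable (by simp)
      (x, y)).hasFDerivAt.comp_hasDerivAt x
        ((hasDerivAt_id x).prodMk (hasDerivAt_const x y))).deriv

theorem iteratedDeriv_snd {η : ℝ × ℝ → ℝ} (h : ContDiff ℝ ∞ η) (i : ℕ) (x : ℝ) :
    iteratedDeriv i (fun y => η (x, y)) = fun y => (pd (0, 1))^[i] η (x, y) := by
  induction i with
  | zero => simp
  | succ i ih =>
    funext y
    rw [iteratedDeriv_succ, ih, Function.iterate_succ_apply']
    exact (((contDiff_pd_iterate (0, 1) i h).differentiable (by simp)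
      (x, y)).hasFDerivAt.comp_hasDerivAt y
        ((hasDerivAt_const y x).prodMk (hasDerivAt_id y))).deriv

section

variable {f₁ f₂ g₁ g₂ : ℝ → ℝ} {r₁ s₁ r₂ s₂ : ℝ}

theorem BddSupp.measurable_prod (h₁ : BddSupp r₁ s₁ f₁) (h₂ : BddSupp r₂ s₂ f₂) :
    Measurable fun x : ℝ × ℝ => f₁ x.1 * f₂ x.2 :=
  (h₁.measurable.comp measurable_fst).mul (h₂.measurable.comp measurable_snd)

theorem BddSupp.bounded_prod (h₁ : BddSupp r₁ s₁ f₁) (h₂ : BddSupp r₂ s₂ f₂) :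
    ∃ B, ∀ x : ℝ × ℝ, ‖f₁ x.1 * f₂ x.2‖ ≤ B := by
  obtain ⟨B₁, hB₁⟩ := h₁.bounded
  obtain ⟨B₂, hB₂⟩ := h₂.bounded
  refine ⟨B₁ * B₂, fun x => ?_⟩
  rw [norm_mul]
  exact mul_le_mul (hB₁ _) (hB₂ _) (norm_nonneg _) ((norm_nonneg _).trans (hB₁ x.1))

theorem BddSupp.mem_Icc_prod (h₁ : BddSupp r₁ s₁ f₁) (h₂ : BddSupp r₂ s₂ f₂) {x : ℝ × ℝ}
    (hx : f₁ x.1 * f₂ x.2 ≠ 0) : x ∈ Set.Icc r₁ s₁ ×ˢ Set.Icc r₂ s₂ :=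
  ⟨h₁.mem_Icc _ (left_ne_zero_of_mul hx), h₂.mem_Icc _ (right_ne_zero_of_mul hx)⟩

theorem BddSupp.integrable_mul_prod (h₁ : BddSupp r₁ s₁ f₁) (h₂ : BddSupp r₂ s₂ f₂)
    {η : ℝ × ℝ → ℝ} (hη : Continuous η) :
    Integrable (fun x => η x * (f₁ x.1 * f₂ x.2)) (volume.prod volume) := by
  obtain ⟨B, hB⟩ := h₁.bounded_prod h₂
  rw [← integrableOn_iff_integrable_of_support_subset
    fun x hx => h₁.mem_Icc_prod h₂ (right_ne_zero_of_mul hx)]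
  exact (hη.continuousOn.integrableOn_compact (isCompact_Icc.prod isCompact_Icc)).mul_bdd
    (h₁.measurable_prod h₂).aestronglyMeasurable (Eventually.of_forall hB)

theorem BddSupp.setIntegral_Ω_mul_prod (h₁ : BddSupp 0 1 f₁) (h₂ : BddSupp 0 1 f₂)
    (η : ℝ × ℝ → ℝ) :
    ∫ x, η x * (f₁ x.1 * f₂ x.2) ∂μΩ = ∫ x, η x * (f₁ x.1 * f₂ x.2) ∂(volume.prod volume) :=
  setIntegral_Ω_eq_integral fun _ hx => h₁.mem_Icc_prod h₂ (right_ne_zero_of_mul hx)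

theorem IsIteratedPrim.setIntegral_Ω_fst {a : ℕ} (h : IsIteratedPrim a g₁ f₁)
    (hg : BddSupp 0 1 g₁) (hf : BddSupp 0 1 f₁) (hf₂ : BddSupp 0 1 f₂) {η : ℝ × ℝ → ℝ}
    (hη : ContDiff ℝ ∞ η) : ∫ x, η x * (g₁ x.1 * f₂ x.2) ∂μΩ =
      (-1) ^ a * ∫ x, (pd (1, 0))^[a] η x * (f₁ x.1 * f₂ x.2) ∂μΩ := by
  rw [hg.setIntegral_Ω_mul_prod hf₂, hf.setIntegral_Ω_mul_prod hf₂,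
    integral_prod_symm _ (hg.integrable_mul_prod hf₂ hη.continuous),
    integral_prod_symm _ (hf.integrable_mul_prod hf₂ (contDiff_pd_iterate (1, 0) a hη).continuous),
    ← integral_const_mul]
  refine integral_congr_ae (Eventually.of_forall fun y => ?_)
  simp only [← mul_assoc, integral_mul_const]
  rw [h (fun x => η (x, y)) (by fun_prop), iteratedDeriv_fst hη]

theorem IsIteratedPrim.setIntegral_Ω_snd {b : ℕ} (h : IsIteratedPrim b g₂ f₂)
    (hg : BddSupp 0 1 g₂) (hf : BddSupp 0 1 f₂) (hg₁ : BddSupp 0 1 g₁) {η : ℝ × ℝ → ℝ}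
    (hη : ContDiff ℝ ∞ η) : ∫ x, η x * (g₁ x.1 * g₂ x.2) ∂μΩ =
      (-1) ^ b * ∫ x, (pd (0, 1))^[b] η x * (g₁ x.1 * f₂ x.2) ∂μΩ := by
  rw [hg₁.setIntegral_Ω_mul_prod hg, hg₁.setIntegral_Ω_mul_prod hf,
    integral_prod _ (hg₁.integrable_mul_prod hg hη.continuous),
    integral_prod _ (hg₁.integrable_mul_prod hf (contDiff_pd_iterate (0, 1) b hη).continuous),
    ← integral_const_mul]
  refine integral_congr_ae (Eventually.of_forall fun x => ?_)
  simp only [mul_left_comm _ (g₁ x), integral_const_mul]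
  rw [h (fun y => η (x, y)) (by fun_prop), iteratedDeriv_snd hη, mul_left_comm]

theorem HasWeakDeriv.integral_mul_prod {a b : ℕ} {u g : ℝ × ℝ → ℝ} (h : HasWeakDeriv (a, b) u g)
    (hu : Integrable u μΩ) (hg : Integrable g μΩ) (hg₁ : BddSupp 0 1 g₁) (hg₂ : BddSupp 0 1 g₂)
    (hf₁ : BddSupp 0 1 f₁) (hf₂ : BddSupp 0 1 f₂) (h₁ : IsIteratedPrim a g₁ f₁)
    (h₂ : IsIteratedPrim b g₂ f₂) :
    ∫ x, u x * (g₁ x.1 * g₂ x.2) ∂μΩ = (-1) ^ (a + b) * ∫ x, g x * (f₁ x.1 * f₂ x.2) ∂μΩ := by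
  have hsmooth (n : ℕ) := contDiff_smoothApprox n hu
  have hlim := tendsto_integral_mul_of_bounded (hg₁.measurable_prod hg₂) (hg₁.bounded_prod hg₂)
    (fun n => integrable_of_continuous (hsmooth n).continuous) hu (tendsto_smoothApprox hu)
  have hlim' := (tendsto_integral_mul_of_bounded (hf₁.measurable_prod hf₂)
    (hf₁.bounded_prod hf₂)
    (fun n => integrable_of_continuous (contDiff_pderiv (a, b) (hsmooth n)).continuous) hg
    (h.tendsto_pderiv_smoothApprox hu hg)).const_mul ((-1) ^ (a + b))
  refine tendsto_nhds_unique hlim (hlim'.congr fun n => ?_)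
  rw [h₂.setIntegral_Ω_snd hg₂ hf₂ hg₁ (hsmooth n),
    h₁.setIntegral_Ω_fst hg₁ hf₁ hf₂ (contDiff_pd_iterate (0, 1) b (hsmooth n)), ← mul_assoc,
    ← pow_add, add_comm b]
  rfl

end

/-! ### The embedding of `W_1^1(Ω)` into `L_2(Ω)` -/

theorem enorm_le_lintegral_add_lintegral_deriv {w : ℝ → ℝ} (hw : ContDiff ℝ 1 w) {x : ℝ}
    (hx : x ∈ Set.Ioo (0 : ℝ) 1) :
    ‖w x‖ₑ ≤ ∫⁻ t in Set.Ioo (0 : ℝ) 1, (‖w t‖ₑ + ‖deriv w t‖ₑ) := by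
  have hle {t : ℝ} (ht : t ∈ Set.Ioo (0 : ℝ) 1) :
      ‖w x‖ₑ ≤ ‖w t‖ₑ + ∫⁻ s in Set.Ioo (0 : ℝ) 1, ‖deriv w s‖ₑ := by
    have hftc : w x = w t + ∫ s in t..x, deriv w s := by
      rw [intervalIntegral.integral_deriv_eq_sub
        (fun y _ => (hw.differentiable one_ne_zero).differentiableAt)
        ((hw.continuous_deriv le_rfl).intervalIntegrable _ _), add_sub_cancel]
    rw [hftc]
    refine (enorm_add_le _ _).trans ?_
    gcongr
    rw [← ofReal_norm, intervalIntegral.norm_intervalIntegral_eq, ofReal_norm]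
    exact (enorm_integral_le_lintegral_enorm _).trans <| lintegral_mono_set <|
      Set.uIoc_subset_uIcc.trans (Set.ordConnected_Ioo.uIcc_subset ht hx)
  calc ‖w x‖ₑ = ∫⁻ _ in Set.Ioo (0 : ℝ) 1, ‖w x‖ₑ := by simp
    _ ≤ ∫⁻ t in Set.Ioo (0 : ℝ) 1, (‖w t‖ₑ + ∫⁻ s in Set.Ioo (0 : ℝ) 1, ‖deriv w s‖ₑ) :=
        setLIntegral_mono' measurableSet_Ioo fun t ht => hle ht
    _ = ∫⁻ t in Set.Ioo (0 : ℝ) 1, (‖w t‖ₑ + ‖deriv w t‖ₑ) := by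
        rw [lintegral_add_left hw.continuous.measurable.enorm,
          lintegral_add_left hw.continuous.measurable.enorm]
        simp

theorem enorm_le_lintegral_fst {η : ℝ × ℝ → ℝ} (hη : ContDiff ℝ ∞ η) {x : ℝ × ℝ} (hx : x ∈ Ω) :
    ‖η x‖ₑ ≤ ∫⁻ t in Set.Ioo (0 : ℝ) 1, (‖η (t, x.2)‖ₑ + ‖pderiv (1, 0) η (t, x.2)‖ₑ) := by
  have h := enorm_le_lintegral_add_lintegral_deriv (w := fun t => η (t, x.2))
    ((hη.comp (by fun_prop)).of_le (by simp)) hx.1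
  rwa [← iteratedDeriv_one, iteratedDeriv_fst hη] at h

theorem enorm_le_lintegral_snd {η : ℝ × ℝ → ℝ} (hη : ContDiff ℝ ∞ η) {x : ℝ × ℝ} (hx : x ∈ Ω) :
    ‖η x‖ₑ ≤ ∫⁻ t in Set.Ioo (0 : ℝ) 1, (‖η (x.1, t)‖ₑ + ‖pderiv (0, 1) η (x.1, t)‖ₑ) := by
  have h := enorm_le_lintegral_add_lintegral_deriv (w := fun t => η (x.1, t))
    ((hη.comp (by fun_prop)).of_le (by simp)) hx.2
  rwa [← iteratedDeriv_one, iteratedDeriv_snd hη] at h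

theorem lintegral_Ω_mul_le {A B : ℝ → ℝ≥0∞} (hA : Measurable A) (hB : Measurable B) {S : ℝ≥0∞}
    (hAS : ∫⁻ t in Set.Ioo (0 : ℝ) 1, A t ≤ S) (hBS : ∫⁻ t in Set.Ioo (0 : ℝ) 1, B t ≤ S) :
    (∫⁻ z, A z.1 * B z.2 ∂μΩ) ^ (1 / (2 : ℝ)) ≤ S :=
  calc (∫⁻ z, A z.1 * B z.2 ∂μΩ) ^ (1 / (2 : ℝ)) ≤ (S * S) ^ (1 / (2 : ℝ)) := by
        rw [μΩ_eq_prod, lintegral_prod_mul hA.aemeasurable hB.aemeasurable]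
        gcongr
    _ = S := by
        rw [← pow_two, ← ENNReal.rpow_two, ← ENNReal.rpow_mul]
        norm_num

theorem eLpNorm_two_le_of_smooth {η : ℝ × ℝ → ℝ} (hη : ContDiff ℝ ∞ η) :
    eLpNorm η 2 μΩ ≤ eLpNorm η 1 μΩ + eLpNorm (pderiv (1, 0) η) 1 μΩ +
      eLpNorm (pderiv (0, 1) η) 1 μΩ := by
  have hη₀ := hη.continuous.measurable.enorm
  have h₁ : Measurable fun z => ‖η z‖ₑ + ‖pderiv (1, 0) η z‖ₑ :=
    hη₀.add (contDiff_pderiv (1, 0) hη).continuous.measurable.enorm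
  have h₂ : Measurable fun z => ‖η z‖ₑ + ‖pderiv (0, 1) η z‖ₑ :=
    hη₀.add (contDiff_pderiv (0, 1) hη).continuous.measurable.enorm
  have hrow : ∫⁻ x in Set.Ioo (0 : ℝ) 1, ∫⁻ t in Set.Ioo (0 : ℝ) 1,
      (‖η (x, t)‖ₑ + ‖pderiv (0, 1) η (x, t)‖ₑ) =
      eLpNorm η 1 μΩ + eLpNorm (pderiv (0, 1) η) 1 μΩ := by
    rw [← lintegral_prod _ h₂.aemeasurable, ← μΩ_eq_prod, lintegral_add_left hη₀,
      ← eLpNorm_one_eq_lintegral_enorm, ← eLpNorm_one_eq_lintegral_enorm]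
  have hcol : ∫⁻ y in Set.Ioo (0 : ℝ) 1, ∫⁻ t in Set.Ioo (0 : ℝ) 1,
      (‖η (t, y)‖ₑ + ‖pderiv (1, 0) η (t, y)‖ₑ) =
      eLpNorm η 1 μΩ + eLpNorm (pderiv (1, 0) η) 1 μΩ := by
    rw [← lintegral_prod_symm _ h₁.aemeasurable, ← μΩ_eq_prod, lintegral_add_left hη₀,
      ← eLpNorm_one_eq_lintegral_enorm, ← eLpNorm_one_eq_lintegral_enorm]
  rw [eLpNorm_eq_lintegral_rpow_enorm_toReal two_ne_zero ENNReal.ofNat_ne_top,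
    ENNReal.toReal_ofNat]
  refine (ENNReal.rpow_le_rpow (lintegral_mono_ae (ae_mem_Ω.mono fun z hz => ?_))
    (by norm_num)).trans (lintegral_Ω_mul_le h₂.lintegral_prod_right' h₁.lintegral_prod_left'
      (hrow.trans_le (add_le_add le_self_add le_rfl)) (hcol.trans_le le_self_add))
  rw [ENNReal.rpow_two, pow_two]
  exact mul_le_mul' (enorm_le_lintegral_snd hη hz) (enorm_le_lintegral_fst hη hz)

theorem tendsto_eLpNorm_of_tendsto_sub {X : Type*} [MeasurableSpace X] {μ : Measure X} {r : ℝ≥0∞}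
    (hr : 1 ≤ r) {F : ℕ → X → ℝ} {f : X → ℝ} (hF : ∀ n, MemLp (F n) r μ) (hf : MemLp f r μ)
    (h : Tendsto (fun n => eLpNorm (F n - f) r μ) atTop (𝓝 0)) :
    Tendsto (fun n => eLpNorm (F n) r μ) atTop (𝓝 (eLpNorm f r μ)) := by
  have : Fact (1 ≤ r) := ⟨hr⟩
  simpa only [Lp.enorm_toLp] using
    ((Lp.tendsto_Lp_iff_tendsto_eLpNorm'' _ hF _ hf).2 h).enorm

theorem eLpNorm_two_le_of_hasWeakDeriv {u g₁ g₂ : ℝ × ℝ → ℝ} (hu : Integrable u μΩ)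
    (hg₁ : Integrable g₁ μΩ) (hg₂ : Integrable g₂ μΩ) (h₁ : HasWeakDeriv (1, 0) u g₁)
    (h₂ : HasWeakDeriv (0, 1) u g₂) :
    eLpNorm u 2 μΩ ≤ eLpNorm u 1 μΩ + eLpNorm g₁ 1 μΩ + eLpNorm g₂ 1 μΩ := by
  have hsmooth (n : ℕ) := contDiff_smoothApprox n hu
  have hmeas (n : ℕ) : AEStronglyMeasurable (smoothApprox n u) μΩ :=
    (hsmooth n).continuous.aestronglyMeasurable
  have hnorm {α : ℕ × ℕ} {g : ℝ × ℝ → ℝ} (hg : Integrable g μΩ) (h : HasWeakDeriv α u g) :=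
    tendsto_eLpNorm_of_tendsto_sub le_rfl (fun n => memLp_one_iff_integrable.2 <|
      integrable_of_continuous (contDiff_pderiv α (hsmooth n)).continuous)
      (memLp_one_iff_integrable.2 hg) (h.tendsto_pderiv_smoothApprox hu hg)
  have hlim := ((hnorm hu (hasWeakDeriv_zero u)).add (hnorm hg₁ h₁)).add (hnorm hg₂ h₂)
  obtain ⟨ns, hns, hae⟩ := (tendstoInMeasure_of_tendsto_eLpNorm one_ne_zero hmeas
    hu.aestronglyMeasurable (tendsto_smoothApprox hu)).exists_seq_tendsto_ae
  refine (Lp.eLpNorm_lim_le_liminf_eLpNorm (fun n => hmeas (ns n)) u hae).trans ?_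
  rw [← (hlim.comp hns.tendsto_atTop).liminf_eq]
  exact liminf_le_liminf (Eventually.of_forall fun n => eLpNorm_two_le_of_smooth (hsmooth (ns n)))

section

theorem eLpNorm_coe_le {p r : ℝ≥0∞} (u : Lp ℝ p μΩ) (hr : r ≤ p) :
    eLpNorm u r μΩ ≤ ENNReal.ofReal ‖u‖ := by
  rw [Lp.norm_def, ENNReal.ofReal_toReal (Lp.eLpNorm_ne_top u)]
  exact eLpNorm_le_eLpNorm_of_exponent_le hr (Lp.aestronglyMeasurable u)

variable {k : ℕ} {p : ℝ≥0∞} [hp : Fact (1 ≤ p)]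

theorem integrable_coe (u : Lp ℝ p μΩ) : Integrable u μΩ := (Lp.memLp u).integrable hp.out

theorem hasWeakDeriv_wderiv (u : Sobolev k p) (α : ℕ × ℕ) (hα : α.1 + α.2 ≤ k) :
    HasWeakDeriv α (fn u) (wderiv u α hα) :=
  u.2 ⟨α, mem_multiIdx hα⟩

theorem eLpNorm_wderiv_le (u : Sobolev k p) (α : ℕ × ℕ) (hα : α.1 + α.2 ≤ k) {r : ℝ≥0∞}
    (hr : r ≤ p) : eLpNorm (wderiv u α hα) r μΩ ≤ ENNReal.ofReal ‖u‖ :=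
  (eLpNorm_coe_le _ hr).trans (ENNReal.ofReal_le_ofReal (PiLp.norm_apply_le u.1 _))

theorem eLpNorm_fn_le (hk : 1 ≤ k) {r : ℝ≥0∞} (hr : r ≤ max 2 p) (u : Sobolev k p) :
    eLpNorm (fn u) r μΩ ≤ 3 * ENNReal.ofReal ‖u‖ := by
  rcases le_max_iff.1 hr with hr | hr
  · have hle (α : ℕ × ℕ) (hα : α.1 + α.2 ≤ k) := eLpNorm_wderiv_le u α hα hp.out
    calc eLpNorm (fn u) r μΩ ≤ eLpNorm (fn u) 2 μΩ :=
          eLpNorm_le_eLpNorm_of_exponent_le hr (Lp.aestronglyMeasurable _)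
      _ ≤ _ := eLpNorm_two_le_of_hasWeakDeriv (integrable_coe _) (integrable_coe _)
          (integrable_coe _) (hasWeakDeriv_wderiv u (1, 0) hk) (hasWeakDeriv_wderiv u (0, 1) hk)
      _ ≤ ENNReal.ofReal ‖u‖ + ENNReal.ofReal ‖u‖ + ENNReal.ofReal ‖u‖ :=
          add_le_add (add_le_add (hle (0, 0) (Nat.zero_le k)) (hle _ _)) (hle _ _)
      _ = 3 * ENNReal.ofReal ‖u‖ := by ring
  · exact (eLpNorm_wderiv_le u (0, 0) (Nat.zero_le k) hr).trans
      (le_mul_of_one_le_left zero_le (by norm_num))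

theorem memLp_fn (hk : 1 ≤ k) {r : ℝ≥0∞} (hr : r ≤ max 2 p) (u : Sobolev k p) :
    MemLp (fn u) r μΩ :=
  ⟨Lp.aestronglyMeasurable _, (eLpNorm_fn_le hk hr u).trans_lt
    (ENNReal.mul_lt_top ENNReal.ofNat_lt_top ENNReal.ofReal_lt_top)⟩

variable {u : ℕ → Sobolev k p} {u₀ : Sobolev k p}

theorem tendsto_ofReal_norm_sub (h : Tendsto u atTop (𝓝 u₀)) :
    Tendsto (fun n => ENNReal.ofReal ‖u n - u₀‖) atTop (𝓝 0) := by
  simpa using ENNReal.tendsto_ofReal (tendsto_iff_norm_sub_tendsto_zero.1 h)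

theorem tendsto_eLpNorm_fn_sub (hk : 1 ≤ k) (h : Tendsto u atTop (𝓝 u₀)) {r : ℝ≥0∞}
    (hr : r ≤ max 2 p) :
    Tendsto (fun n => eLpNorm (fn (u n) - fn u₀ : ℝ × ℝ → ℝ) r μΩ) atTop (𝓝 0) := by
  have hlim : Tendsto (fun n => 3 * ENNReal.ofReal ‖u n - u₀‖) atTop (𝓝 0) := by
    simpa using ENNReal.Tendsto.const_mul (tendsto_ofReal_norm_sub h) (Or.inr (by simp))
  refine tendsto_of_tendsto_of_tendsto_of_le_of_le tendsto_const_nhds hlim (fun _ => zero_le)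
    fun n => ?_
  rw [eLpNorm_congr_ae (Lp.coeFn_sub (fn (u n)) (fn u₀)).symm]
  exact eLpNorm_fn_le hk hr (u n - u₀)

theorem tendsto_eLpNorm_wderiv_sub (h : Tendsto u atTop (𝓝 u₀)) (α : ℕ × ℕ)
    (hα : α.1 + α.2 ≤ k) :
    Tendsto (fun n => eLpNorm (wderiv (u n) α hα - wderiv u₀ α hα : ℝ × ℝ → ℝ) p μΩ) atTop
      (𝓝 0) := by
  refine tendsto_of_tendsto_of_tendsto_of_le_of_le tendsto_const_nhds (tendsto_ofReal_norm_sub h)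
    (fun _ => zero_le) fun n => ?_
  rw [eLpNorm_congr_ae (Lp.coeFn_sub (wderiv (u n) α hα) (wderiv u₀ α hα)).symm]
  exact eLpNorm_wderiv_le (u n - u₀) α hα le_rfl

end

/-! ### Sampling -/

/-- The array `4ⁿ ∫ g(y) θ₁(2ⁿ y₁ - k₁) θ₂(2ⁿ y₂ - k₂) dy`, which all of `T_n`, `S_n`, `W'_n T_n`
and `W''_n S_n` turn out to be, for suitable `θ₁` and `θ₂`. -/
def samp (θ₁ θ₂ : ℝ → ℝ) (n : ℕ) (g : ℝ × ℝ → ℝ) (k : ℤ × ℤ) : ℝ :=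
  4 ^ n * ∫ y, g y * (θ₁ (2 ^ n * y.1 - k.1) * θ₂ (2 ^ n * y.2 - k.2)) ∂μΩ

/-- A univariate sampling function: one of mass `1` whose dilate by `2ⁿ`, placed at a coordinate of
an index in `K_n`, is supported in `[0, 1]`. -/
structure IsSampler (m : ℕ) (θ : ℝ → ℝ) : Prop where
  bddSupp : BddSupp (-(3 * floorHalf m)) (3 * (m - floorHalf m)) θ
  integral_eq_one : ∫ x, θ x = 1

section

variable {m C n : ℕ} {θ₁ θ₂ : ℝ → ℝ}

theorem isSampler_phi₁ (hm : 1 ≤ m) : IsSampler m (phi₁ m) where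
  bddSupp := (bddSupp_phi₁ hm).mono (by linarith [floorHalf_nonneg m])
    (by linarith [floorHalf_le m])
  integral_eq_one := integral_phi₁ hm

theorem isSampler_smear_phi₁ (hm : 1 ≤ m) {a : ℕ} (ha : a ≤ m) :
    IsSampler m (smear m a (phi₁ m)) where
  bddSupp := (bddSupp_smear_phi₁ hm ha).mono (by linarith [floorHalf_nonneg m])
    (by linarith [floorHalf_le m])
  integral_eq_one := integral_smear_phi₁ hm a

theorem isSampler_smear_smear_phi₁ (hm : 1 ≤ m) {a b : ℕ} (ha : a ≤ m) (hb : b ≤ m) :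
    IsSampler m (smear m b (smear m a (phi₁ m))) where
  bddSupp := bddSupp_smear_smear_phi₁ hm ha hb
  integral_eq_one := integral_smear_smear_phi₁ hm ha b

theorem four_pow_eq_mul_self (n : ℕ) : (4 : ℝ) ^ n = 2 ^ n * 2 ^ n := by
  rw [← mul_pow]
  norm_num

theorem BddSupp.integrable_μΩ_mul_prod {r₁ s₁ r₂ s₂ : ℝ} (h₁ : BddSupp r₁ s₁ θ₁)
    (h₂ : BddSupp r₂ s₂ θ₂) {g : ℝ × ℝ → ℝ} (hg : Integrable g μΩ) :
    Integrable (fun y => g y * (θ₁ y.1 * θ₂ y.2)) μΩ := by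
  obtain ⟨B, hB⟩ := h₁.bounded_prod h₂
  exact hg.mul_bdd (h₁.measurable_prod h₂).aestronglyMeasurable (Eventually.of_forall hB)

theorem BddSupp.integrable_mul_dilate {r₁ s₁ r₂ s₂ : ℝ} (h₁ : BddSupp r₁ s₁ θ₁)
    (h₂ : BddSupp r₂ s₂ θ₂) {g : ℝ × ℝ → ℝ} (hg : Integrable g μΩ) (n : ℕ) (k : ℤ × ℤ) :
    Integrable (fun y => g y * (θ₁ (2 ^ n * y.1 - k.1) * θ₂ (2 ^ n * y.2 - k.2))) μΩ :=
  (h₁.comp_affine (by positivity) k.1).integrable_μΩ_mul_prod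
    (h₂.comp_affine (by positivity) k.2) hg

theorem samp_sub {r₁ s₁ r₂ s₂ : ℝ} (h₁ : BddSupp r₁ s₁ θ₁) (h₂ : BddSupp r₂ s₂ θ₂)
    {g g' : ℝ × ℝ → ℝ} (hg : Integrable g μΩ) (hg' : Integrable g' μΩ) (k : ℤ × ℤ) :
    samp θ₁ θ₂ n (fun x => g x - g' x) k = samp θ₁ θ₂ n g k - samp θ₁ θ₂ n g' k := by
  simp only [samp, sub_mul]
  rw [integral_sub (h₁.integrable_mul_dilate h₂ hg n k) (h₁.integrable_mul_dilate h₂ hg' n k),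
    mul_sub]

theorem bddSupp_dilate {j : ℤ}
    (hj : 3 * ((m / 2 : ℕ) : ℤ) ≤ j ∧ j + 3 * (m - (m / 2 : ℕ)) ≤ 2 ^ n) {θ : ℝ → ℝ}
    (hθ : BddSupp (-(3 * floorHalf m)) (3 * (m - floorHalf m)) θ) :
    BddSupp 0 1 fun y => θ (2 ^ n * y - j) := by
  have hn : (0 : ℝ) < 2 ^ n := by positivity
  rw [floorHalf] at hθ
  generalize m / 2 = c at hj hθ
  have hleft : (3 * c : ℝ) ≤ j := by exact_mod_cast hj.1
  have hright : (j : ℝ) + 3 * (m - c) ≤ 2 ^ n := by exact_mod_cast hj.2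
  refine (hθ.comp_affine hn (j : ℝ)).mono (div_nonneg (by linarith) hn.le) ?_
  rw [div_le_one hn]
  linarith

/-- The kernel of the operator `g ↦ step (samp θ₁ θ₂ n g)`. -/
def sampKernel (m C : ℕ) (θ₁ θ₂ : ℝ → ℝ) (n : ℕ) (x y : ℝ × ℝ) : ℝ :=
  if cellIdx n x ∈ K m C n then
    4 ^ n * (θ₁ (2 ^ n * y.1 - (cellIdx n x).1) * θ₂ (2 ^ n * y.2 - (cellIdx n x).2)) else 0

theorem kernelOp_sampKernel (θ₁ θ₂ : ℝ → ℝ) (g : ℝ × ℝ → ℝ) :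
    kernelOp μΩ (sampKernel m C θ₁ θ₂ n) g = step fun k : K m C n => samp θ₁ θ₂ n g k.1 := by
  funext x
  rw [step]
  split_ifs with hx
  · simp only [kernelOp, sampKernel, if_pos hx, samp]
    rw [← integral_const_mul]
    congr with y
    ring
  · simp [kernelOp, sampKernel, hx]

theorem measurable_sampKernel (hθ₁ : Measurable θ₁) (hθ₂ : Measurable θ₂) (n : ℕ) :
    Measurable (Function.uncurry (sampKernel m C θ₁ θ₂ n)) := by
  have hidx : Measurable fun z : (ℝ × ℝ) × (ℝ × ℝ) => cellIdx n z.1 :=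
    (measurable_cellIdx n).comp measurable_fst
  have hcast : Measurable fun j : ℤ => (j : ℝ) := measurable_from_top
  have hfst := hcast.comp (measurable_fst.comp hidx)
  have hsnd := hcast.comp (measurable_snd.comp hidx)
  refine Measurable.ite (hidx (K m C n : Set (ℤ × ℤ)).to_countable.measurableSet) ?_
    measurable_const
  have hdil : Measurable fun t : ℝ => 2 ^ n * t := measurable_id.const_mul _
  exact ((hθ₁.comp ((hdil.comp measurable_snd.fst).sub hfst)).mul
    (hθ₂.comp ((hdil.comp measurable_snd.snd).sub hsnd))).const_mul _

theorem norm_sampKernel_le {B₁ B₂ : ℝ} (hB₁ : ∀ x, ‖θ₁ x‖ ≤ B₁) (hB₂ : ∀ x, ‖θ₂ x‖ ≤ B₂)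
    (n : ℕ) (x y : ℝ × ℝ) : ‖sampKernel m C θ₁ θ₂ n x y‖ ≤ B₁ * B₂ * 4 ^ n := by
  have hB₁0 : 0 ≤ B₁ := (norm_nonneg _).trans (hB₁ 0)
  have hB₂0 : 0 ≤ B₂ := (norm_nonneg _).trans (hB₂ 0)
  rw [sampKernel]
  split_ifs
  · rw [norm_mul, norm_mul, mul_comm, norm_pow, Real.norm_ofNat]
    gcongr
    exacts [hB₁ _, hB₂ _]
  · rw [norm_zero]
    positivity

theorem dist_le_of_apply_dilate_ne_zero {θ : ℝ → ℝ}
    (hθ : BddSupp (-(3 * floorHalf m)) (3 * (m - floorHalf m)) θ) {s t : ℝ}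
    (hne : θ (2 ^ n * t - ⌊2 ^ n * s⌋) ≠ 0) : dist s t ≤ (3 * m + 1) * (2 ^ n)⁻¹ := by
  have hn : (0 : ℝ) < 2 ^ n := by positivity
  obtain ⟨hl, hr⟩ := hθ.mem_Icc _ hne
  have := Int.floor_le (2 ^ n * s)
  have := Int.lt_floor_add_one (2 ^ n * s)
  have := floorHalf_nonneg m
  have := floorHalf_le m
  rw [← div_eq_mul_inv, le_div_iff₀ hn, Real.dist_eq, ← abs_of_pos hn, ← abs_mul, abs_le]
  constructor <;> linarith

theorem dist_le_of_sampKernel_ne_zero (hθ₁ : IsSampler m θ₁) (hθ₂ : IsSampler m θ₂)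
    {x y : ℝ × ℝ} (hne : sampKernel m C θ₁ θ₂ n x y ≠ 0) :
    dist x y ≤ (3 * m + 1) * (2 ^ n)⁻¹ := by
  rw [sampKernel] at hne
  have hprod := right_ne_zero_of_mul (ite_ne_right_iff.1 hne).2
  rw [Prod.dist_eq]
  exact max_le (dist_le_of_apply_dilate_ne_zero hθ₁.bddSupp (left_ne_zero_of_mul hprod))
    (dist_le_of_apply_dilate_ne_zero hθ₂.bddSupp (right_ne_zero_of_mul hprod))

theorem eventually_le_floor_two_pow_mul (c : ℤ) {t : ℝ} (ht : t ∈ Set.Ioo (0 : ℝ) 1) :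
    ∀ᶠ n : ℕ in atTop, c ≤ ⌊2 ^ n * t⌋ ∧ ⌊2 ^ n * t⌋ + c ≤ 2 ^ n := by
  have hpow : Tendsto (fun n : ℕ => (2 : ℝ) ^ n) atTop atTop :=
    tendsto_pow_atTop_atTop_of_one_lt one_lt_two
  filter_upwards [(hpow.atTop_mul_const ht.1).eventually_ge_atTop (c : ℝ),
    (hpow.atTop_mul_const (sub_pos.2 ht.2)).eventually_ge_atTop (c : ℝ)] with n hleft hright
  refine ⟨Int.le_floor.2 hleft, ?_⟩
  have hcast : (⌊2 ^ n * t⌋ : ℝ) + c ≤ 2 ^ n := by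
    linarith [Int.floor_le (2 ^ n * t)]
  exact_mod_cast hcast

theorem eventually_cellIdx_mem_K (hm : 1 ≤ m) (C : ℕ) {x : ℝ × ℝ} (hx : x ∈ Ω) :
    ∀ᶠ n in atTop, cellIdx n x ∈ K m C n := by
  filter_upwards [eventually_le_floor_two_pow_mul ((C + 1) * m) hx.1,
    eventually_le_floor_two_pow_mul ((C + 1) * m) hx.2] with n h₁ h₂
  exact mem_K_of_bounds hm h₁ h₂

theorem integral_dilate_prod (h₁ : ∫ x, θ₁ x = 1) (h₂ : ∫ x, θ₂ x = 1) (κ : ℝ × ℝ) :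
    ∫ y : ℝ × ℝ, 4 ^ n * (θ₁ (2 ^ n * y.1 - κ.1) * θ₂ (2 ^ n * y.2 - κ.2)) = 1 := by
  have hn : (0 : ℝ) < 2 ^ n := by positivity
  rw [integral_const_mul, Measure.volume_eq_prod,
    integral_prod_mul (fun y => θ₁ (2 ^ n * y - κ.1)) fun y => θ₂ (2 ^ n * y - κ.2),
    integral_comp_mul_sub hn, integral_comp_mul_sub hn, h₁, h₂, four_pow_eq_mul_self]
  field_simp

theorem eventually_integral_sampKernel (hm : 1 ≤ m) (hC : 2 ≤ C) (hθ₁ : IsSampler m θ₁)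
    (hθ₂ : IsSampler m θ₂) {x : ℝ × ℝ} (hx : x ∈ Ω) :
    ∀ᶠ n in atTop, ∫ y, sampKernel m C θ₁ θ₂ n x y ∂μΩ = 1 := by
  filter_upwards [eventually_cellIdx_mem_K hm C hx] with n hn
  obtain ⟨hb₁, hb₂⟩ := bounds_of_mem_K hm hC hn
  simp only [sampKernel, if_pos hn]
  rw [setIntegral_Ω_eq_integral fun y hy => (bddSupp_dilate hb₁ hθ₁.bddSupp).mem_Icc_prod
    (bddSupp_dilate hb₂ hθ₂.bddSupp) (right_ne_zero_of_mul hy)]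
  exact integral_dilate_prod hθ₁.integral_eq_one hθ₂.integral_eq_one
    (((cellIdx n x).1 : ℝ), ((cellIdx n x).2 : ℝ))

theorem isApproxIdentity_sampKernel (hm : 1 ≤ m) (hC : 2 ≤ C) (hθ₁ : IsSampler m θ₁)
    (hθ₂ : IsSampler m θ₂) :
    ∃ D ρ, 0 ≤ D ∧ IsApproxIdentity μΩ (sampKernel m C θ₁ θ₂) D ρ := by
  obtain ⟨B₁, hB₁⟩ := hθ₁.bddSupp.bounded
  obtain ⟨B₂, hB₂⟩ := hθ₂.bddSupp.bounded
  have hB₁0 : 0 ≤ B₁ := (norm_nonneg _).trans (hB₁ 0)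
  have hB₂0 : 0 ≤ B₂ := (norm_nonneg _).trans (hB₂ 0)
  exact ⟨4 * (B₁ * B₂) * (3 * m + 1) ^ 2, _, by positivity,
    .of_bound (by positivity) (measurable_sampKernel hθ₁.bddSupp.measurable hθ₂.bddSupp.measurable)
      (norm_sampKernel_le hB₁ hB₂) (fun _ _ _ _ => dist_le_of_sampKernel_ne_zero hθ₁ hθ₂)
      fun _ => eventually_integral_sampKernel hm hC hθ₁ hθ₂⟩

theorem tendsto_step_samp (hm : 1 ≤ m) (hC : 2 ≤ C) (hθ₁ : IsSampler m θ₁)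
    (hθ₂ : IsSampler m θ₂) {r : ℝ≥0∞} (hr : 1 ≤ r) (hr' : r ≠ ⊤) {g : ℕ → ℝ × ℝ → ℝ}
    {g₀ : ℝ × ℝ → ℝ} (hg : ∀ n, MemLp (g n) r μΩ) (hg₀ : MemLp g₀ r μΩ)
    (hlim : Tendsto (fun n => eLpNorm (g n - g₀) r μΩ) atTop (𝓝 0)) :
    Tendsto (fun n => eLpNorm ((step fun k : K m C n => samp θ₁ θ₂ n (g n) k.1) - g₀) r μΩ) atTop
      (𝓝 0) := by
  obtain ⟨D, ρ, hD, hk⟩ := isApproxIdentity_sampKernel hm hC hθ₁ hθ₂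
  simpa only [kernelOp_sampKernel] using hk.tendsto hD hr hr' hg hg₀ hlim

theorem T_eq_samp (m n : ℕ) (g : ℝ × ℝ → ℝ) (k : M m n) :
    T m n g k = samp (phi₁ m) (phi₁ m) n g k.1 := by
  simp only [T, samp, phi, mul_left_comm _ ((2 : ℝ) ^ n), integral_const_mul]
  rw [four_pow_eq_mul_self, mul_assoc]

theorem vphi_eq (hm : 1 ≤ m) {β : ℕ × ℕ} (hβ : β.1 ≤ m ∧ β.2 ≤ m) (n : ℕ) (k : ℤ × ℤ)
    (x : ℝ × ℝ) :
    vphi m β n k x = 2 ^ n * cst m β * (smear m β.1 (phi₁ m) (2 ^ n * x.1 - k.1) *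
      smear m β.2 (phi₁ m) (2 ^ n * x.2 - k.2)) := by
  have hscale : (2 : ℝ) ^ ((n : ℤ) - 1) = 2 ^ n / 2 := by
    rw [zpow_sub₀ two_ne_zero, zpow_natCast, zpow_one]
  have hweight : (2 : ℝ) ^ ((n : ℤ) - 2) = 2 ^ n / 4 := by
    rw [zpow_sub₀ two_ne_zero, zpow_natCast]
    norm_num
  have harg (y : ℝ) (j : ℤ) : 2 * ((2 : ℝ) ^ n / 2 * y - j / 2) = 2 ^ n * y - j := by ring
  rw [vphi, cst, vphi₁_eq hm hβ.1, vphi₁_eq hm hβ.2, hscale, hweight, harg, harg]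
  ring

theorem S_eq_samp (hm : 1 ≤ m) {J : ℕ} {α : Fin J → ℕ × ℕ} {j : Fin J}
    (hj : (α j).1 ≤ m ∧ (α j).2 ≤ m) (v : Fin J → ℝ × ℝ → ℝ) (k : M m n) :
    S m n α v j k = samp (smear m (α j).1 (phi₁ m)) (smear m (α j).2 (phi₁ m)) n (v j) k.1 := by
  have hcst : cst m (α j) ≠ 0 := mul_ne_zero (c₁_ne_zero hm hj.1) (c₁_ne_zero hm hj.2)
  rw [S, samp, ← integral_const_mul, ← integral_const_mul]
  congr with y
  rw [vphi_eq hm hj, four_pow_eq_mul_self]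
  field_simp

theorem sum_filt_samp {r₁ s₁ r₂ s₂ : ℝ} {F₁ F₂ : ℝ → ℝ} (hF₁ : BddSupp r₁ s₁ F₁)
    (hF₂ : BddSupp r₂ s₂ F₂) {u : ℝ × ℝ → ℝ} (hu : Integrable u μΩ) (β : ℕ × ℕ) (k : ℤ × ℤ) :
    ∑ l ∈ box₁ m ×ˢ box₁ m, filt m β l * samp F₁ F₂ n u (k + l) =
      samp (filterSum m β.1 F₁) (filterSum m β.2 F₂) n u k := by
  simp only [samp, mul_left_comm _ ((4 : ℝ) ^ n)]
  rw [← Finset.mul_sum]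
  congr 1
  simp only [← integral_const_mul]
  rw [← integral_finsetSum _ fun l _ => (hF₁.integrable_mul_dilate hF₂ hu n (k + l)).const_mul _]
  congr with y
  simp only [filterSum]
  rw [Finset.sum_mul_sum, ← Finset.sum_product', Finset.mul_sum]
  refine Finset.sum_congr rfl fun l _ => ?_
  rw [filt, Prod.fst_add, Prod.snd_add, Int.cast_add, Int.cast_add, sub_add_eq_sub_sub,
    sub_add_eq_sub_sub]
  ring

theorem conv_samp (hm : 1 ≤ m) (hC : 2 ≤ C) {r₁ s₁ r₂ s₂ : ℝ} {F₁ F₂ : ℝ → ℝ}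
    (hF₁ : BddSupp r₁ s₁ F₁) (hF₂ : BddSupp r₂ s₂ F₂) {u : ℝ × ℝ → ℝ} (hu : Integrable u μΩ)
    (β : ℕ × ℕ) (k : K m C n) :
    conv C β (fun k : M m n => samp F₁ F₂ n u k.1) k =
      samp (filterSum m β.1 F₁) (filterSum m β.2 F₂) n u k.1 := by
  rw [← sum_filt_samp hF₁ hF₂ hu, conv]
  refine Finset.sum_congr rfl fun l hl => ?_
  rw [Finset.mem_product] at hl
  rw [ext, dif_pos (add_mem_M hm hC k.2 hl.1 hl.2)]

theorem HasWeakDeriv.samp_filterSum (hm : 1 ≤ m) (hC : 2 ≤ C) {a b : ℕ} (ha : a ≤ m)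
    (hb : b ≤ m) {F₁ F₂ : ℝ → ℝ}
    (hF₁ : BddSupp (-(2 * floorHalf m)) (2 * (m - floorHalf m)) F₁)
    (hF₂ : BddSupp (-(2 * floorHalf m)) (2 * (m - floorHalf m)) F₂) {u g : ℝ × ℝ → ℝ}
    (hu : Integrable u μΩ) (hg : Integrable g μΩ) (h : HasWeakDeriv (a, b) u g) {k : ℤ × ℤ}
    (hk : k ∈ K m C n) :
    (-1) ^ (a + b) * (2 ^ n) ^ (a + b) * samp (filterSum m a F₁) (filterSum m b F₂) n u k =
      smearConst m a * smearConst m b * samp (smear m a F₁) (smear m b F₂) n g k := by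
  have hn : (0 : ℝ) < 2 ^ n := by positivity
  obtain ⟨hb₁, hb₂⟩ := bounds_of_mem_K hm hC hk
  have hQ₁ := bddSupp_dilate hb₁ ((bddSupp_filterSum ha hF₁).mono (by linarith) (by linarith))
  have hQ₂ := bddSupp_dilate hb₂ ((bddSupp_filterSum hb hF₂).mono (by linarith) (by linarith))
  have hR₁ := bddSupp_dilate hb₁ ((bddSupp_smear ha hF₁).mono (by linarith) (by linarith))
  have hR₂ := bddSupp_dilate hb₂ ((bddSupp_smear hb hF₂).mono (by linarith) (by linarith))
  have hpair := h.integral_mul_prod hu hg (hQ₁.smul ((2 ^ n) ^ a)) (hQ₂.smul ((2 ^ n) ^ b))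
    (hR₁.smul (smearConst m a)) (hR₂.smul (smearConst m b))
    ((isIteratedPrim_filterSum ha hF₁).comp_affine hn k.1)
    ((isIteratedPrim_filterSum hb hF₂).comp_affine hn k.2)
  have hpull (w : ℝ × ℝ → ℝ) (c d : ℝ) (f₁ f₂ : ℝ → ℝ) :
      ∫ y, w y * ((c • f₁) y.1 * (d • f₂) y.2) ∂μΩ =
        c * d * ∫ y, w y * (f₁ y.1 * f₂ y.2) ∂μΩ := by
    rw [← integral_const_mul]
    congr with y
    simp only [Pi.smul_apply, smul_eq_mul]
    ring
  rw [hpull, hpull] at hpair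
  have hsign : ((-1 : ℝ) ^ (a + b)) * (-1) ^ (a + b) = 1 := by
    rw [← mul_pow, neg_one_mul, neg_neg, one_pow]
  simp only [samp]
  rw [pow_add ((2 : ℝ) ^ n)]
  linear_combination 4 ^ n * (-1) ^ (a + b) * hpair + 4 ^ n * smearConst m a * smearConst m b *
    (∫ y, g y * (smear m a F₁ (2 ^ n * y.1 - k.1) * smear m b F₂ (2 ^ n * y.2 - k.2)) ∂μΩ) * hsign

theorem two_zpow_mul_pow (c n s : ℕ) :
    (2 : ℝ) ^ (((n : ℤ) - c) * s) * (2 ^ c) ^ s = (2 ^ n) ^ s := by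
  rw [zpow_mul, zpow_sub₀ two_ne_zero, zpow_natCast, zpow_natCast, zpow_natCast, ← mul_pow,
    div_mul_cancel₀ _ (by positivity)]

/-- The weights `(-1) ^ |β| 2 ^ ((n - c) |β|)` turn the filter into an approximate `∂^β`. -/
theorem HasWeakDeriv.weighted_conv_samp (hm : 1 ≤ m) (hC : 2 ≤ C) {β : ℕ × ℕ}
    (hβ : β.1 ≤ m ∧ β.2 ≤ m) {F₁ F₂ : ℝ → ℝ}
    (hF₁ : BddSupp (-(2 * floorHalf m)) (2 * (m - floorHalf m)) F₁)
    (hF₂ : BddSupp (-(2 * floorHalf m)) (2 * (m - floorHalf m)) F₂) {u g : ℝ × ℝ → ℝ}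
    (hu : Integrable u μΩ) (hg : Integrable g μΩ) (h : HasWeakDeriv β u g) (c : ℕ)
    (k : K m C n) :
    (smearConst m β.1 * (2 ^ c)⁻¹ ^ β.1 * (smearConst m β.2 * (2 ^ c)⁻¹ ^ β.2))⁻¹ *
        (-1) ^ ord β * (2 : ℝ) ^ (((n : ℤ) - c) * ord β) *
        conv C β (fun k : M m n => samp F₁ F₂ n u k.1) k =
      samp (smear m β.1 F₁) (smear m β.2 F₂) n g k.1 := by
  have hderiv := h.samp_filterSum hm hC hβ.1 hβ.2 hF₁ hF₂ hu hg k.2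
  rw [← ord, ← two_zpow_mul_pow c n (ord β)] at hderiv
  have hne₁ := smearConst_ne_zero hβ.1
  have hne₂ := smearConst_ne_zero hβ.2
  have hpow : ((2 : ℝ) ^ c) ^ ord β = (2 ^ c) ^ β.1 * (2 ^ c) ^ β.2 := pow_add ..
  rw [conv_samp hm hC hF₁ hF₂ hu, inv_pow, inv_pow]
  rw [hpow] at hderiv
  field_simp
  linear_combination hderiv

theorem W'_T_eq_samp (hm : 1 ≤ m) (hC : 2 ≤ C) {J : ℕ} {α : Fin J → ℕ × ℕ} {j : Fin J}
    (hj : (α j).1 ≤ m ∧ (α j).2 ≤ m) {u g : ℝ × ℝ → ℝ} (hu : Integrable u μΩ)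
    (hg : Integrable g μΩ) (h : HasWeakDeriv (α j) u g) (k : K m C n) :
    W' m C n α (T m n u) j k =
      samp (smear m (α j).1 (phi₁ m)) (smear m (α j).2 (phi₁ m)) n g k.1 := by
  have hF : BddSupp (-(2 * floorHalf m)) (2 * (m - floorHalf m)) (phi₁ m) :=
    (bddSupp_phi₁ hm).mono (by linarith [floorHalf_nonneg m]) (by linarith [floorHalf_le m])
  rw [← h.weighted_conv_samp hm hC hj hF hF hu hg 1 k, W', funext (T_eq_samp m n u), cst,
    c₁_eq hm hj.1, c₁_eq hm hj.2, pow_one, Nat.cast_one]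

theorem W''_S_eq_samp (hm : 1 ≤ m) (hC : 2 ≤ C) {J : ℕ} {α : Fin J → ℕ × ℕ}
    (hα : ∀ j, (α j).1 ≤ m ∧ (α j).2 ≤ m) {v : Fin J → ℝ × ℝ → ℝ} {g : ℝ × ℝ → ℝ} {i j : Fin J}
    (hv : Integrable (v j) μΩ) (hg : Integrable g μΩ) (h : HasWeakDeriv (α i) (v j) g)
    (k : K m C n) :
    W'' m C n α (S m n α v) (i, j) k =
      samp (smear m (α i).1 (smear m (α j).1 (phi₁ m)))
        (smear m (α i).2 (smear m (α j).2 (phi₁ m))) n g k.1 := by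
  have hfour : (2 : ℝ) ^ 2 = 4 := by norm_num
  rw [← h.weighted_conv_samp hm hC (hα i) (bddSupp_smear_phi₁ hm (hα j).1)
    (bddSupp_smear_phi₁ hm (hα j).2) hv hg 2 k, W'', funext (S_eq_samp hm (hα j) v), cst₂,
    c₂_eq hm (hα j).1 (hα i).1, c₂_eq hm (hα j).2 (hα i).2, hfour, Nat.cast_ofNat]

end

/-! ### The data term -/

section

variable {m C n : ℕ}

theorem arrayNorm₂_eq (a : K m C n → ℝ) :
    arrayNorm₂ a = (2 ^ n)⁻¹ * ‖(WithLp.toLp 2 a : EuclideanSpace ℝ (K m C n))‖ := by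
  have hsq : ((2 : ℝ) ^ (2 * n))⁻¹ = ((2 ^ n)⁻¹) ^ 2 := by rw [inv_pow, ← pow_mul, mul_comm]
  rw [arrayNorm₂, EuclideanSpace.norm_eq, hsq, Real.sqrt_mul (by positivity),
    Real.sqrt_sq (by positivity)]
  rfl

/-- The norm of `ℓ_2(K_n)`, as a seminorm on arrays. -/
def arraySeminorm (m C n : ℕ) : Seminorm ℝ (K m C n → ℝ) :=
  Seminorm.of arrayNorm₂
    (fun a b => by
      rw [arrayNorm₂_eq, arrayNorm₂_eq, arrayNorm₂_eq, ← mul_add, WithLp.toLp_add]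
      gcongr
      exact norm_add_le _ _)
    fun c a => by
      rw [arrayNorm₂_eq, arrayNorm₂_eq, WithLp.toLp_smul, norm_smul, mul_left_comm]

theorem arraySeminorm_apply (a : K m C n → ℝ) : arraySeminorm m C n a = arrayNorm₂ a := rfl

theorem continuous_arraySeminorm : Continuous (arraySeminorm m C n) := by
  change Continuous arrayNorm₂
  unfold arrayNorm₂
  fun_prop

theorem arrayNorm₂_eq_arrayNorm (a : K m C n → ℝ) :
    arrayNorm₂ a = arrayNorm 2 fun _ : Unit => a := by
  simp [arrayNorm₂, arrayNorm, Real.sqrt_eq_rpow]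

theorem vecNorm_two_unit (g : Lp ℝ 2 μΩ) :
    vecNorm 2 (fun _ : Unit => (g : ℝ × ℝ → ℝ)) = ‖g‖ := by
  rw [vecNorm_eq_eLpNorm two_ne_zero ENNReal.ofNat_ne_top fun _ => Lp.memLp g, Lp.norm_def]
  congr 1
  refine eLpNorm_congr_norm_ae (Eventually.of_forall fun x => ?_)
  simp [EuclideanSpace.norm_eq, Real.sqrt_sq_eq_abs]

theorem T_congr {g g' : ℝ × ℝ → ℝ} (h : g =ᵐ[μΩ] g') : T m n g = T m n g' := by
  funext k
  rw [T, T]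
  congr 1
  exact integral_congr_ae (h.mono fun x hx => congrArg (· * phi m n k x) hx)

theorem T_coe_sub (hm : 1 ≤ m) (u v : Lp ℝ 2 μΩ) :
    T m n (u - v : Lp ℝ 2 μΩ) = T m n u - T m n v := by
  funext k
  rw [T_congr (Lp.coeFn_sub u v), Pi.sub_apply, T_eq_samp, T_eq_samp, T_eq_samp]
  exact samp_sub (bddSupp_phi₁ hm) (bddSupp_phi₁ hm) (integrable_coe u) (integrable_coe v) k

theorem continuous_T (hm : 1 ≤ m) : Continuous fun u : Lp ℝ 2 μΩ => T m n u := by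
  refine continuous_pi fun k => continuous_iff_seqContinuous.2 fun u u₀ hu => ?_
  have hphi (j : ℤ) := (bddSupp_phi₁ hm).comp_affine (show (0 : ℝ) < 2 ^ n by positivity) j
  simp only [Function.comp_def, T_eq_samp, samp]
  refine (tendsto_integral_mul_of_bounded ((hphi _).measurable_prod (hphi _))
    ((hphi _).bounded_prod (hphi _)) (fun i => integrable_coe (u i)) (integrable_coe u₀)
    ?_).const_mul (4 ^ n)
  have hnorm : Tendsto (fun i => ENNReal.ofReal ‖u i - u₀‖) atTop (𝓝 0) := by
    simpa only [ENNReal.ofReal_zero] using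
      ENNReal.tendsto_ofReal (tendsto_iff_norm_sub_tendsto_zero.1 hu)
  refine tendsto_of_tendsto_of_tendsto_of_le_of_le tendsto_const_nhds hnorm (fun _ => zero_le)
    fun i => ?_
  rw [← eLpNorm_congr_ae (Lp.coeFn_sub (u i) u₀)]
  exact eLpNorm_coe_le _ one_le_two

/-- The sampling operator `T_n` as a continuous linear map on `L_2(Ω)`. -/
def sampleCLM (hm : 1 ≤ m) (n : ℕ) : Lp ℝ 2 μΩ →L[ℝ] (M m n → ℝ) :=
  (AddMonoidHom.ofMapSub (fun u : Lp ℝ 2 μΩ => T m n u) (T_coe_sub hm)).toRealLinearMap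
    (continuous_T hm)

theorem sampleCLM_apply (hm : 1 ≤ m) (u : Lp ℝ 2 μΩ) : sampleCLM hm n u = T m n u := rfl

theorem tendsto_arrayNorm₂_T (hm : 1 ≤ m) (hC : 2 ≤ C) (g : Lp ℝ 2 μΩ) :
    Tendsto (fun n => arrayNorm₂ fun k : K m C n => T m n g (toM k)) atTop (𝓝 ‖g‖) := by
  rw [← vecNorm_two_unit]
  simp only [arrayNorm₂_eq_arrayNorm, arrayNorm_eq_vecNorm hm two_ne_zero ENNReal.ofNat_ne_top]
  refine tendsto_vecNorm one_le_two ENNReal.ofNat_ne_top (fun n _ => memLp_step _ 2)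
    (fun _ => Lp.memLp g) fun _ => ?_
  have hstep := tendsto_step_samp (C := C) hm hC (isSampler_phi₁ hm) (isSampler_phi₁ hm)
    one_le_two ENNReal.ofNat_ne_top (fun _ => Lp.memLp g) (Lp.memLp g)
    (by simp only [sub_self, eLpNorm_zero, tendsto_const_nhds_iff])
  simpa only [T_eq_samp, toM] using hstep

theorem tendsto_seminorm_sub_of_bddAbove {E : Type*} [AddCommGroup E] [Module ℝ E]
    [TopologicalSpace E] [ContinuousSub E] [BarrelledSpace ℝ E] {P : ℕ → Seminorm ℝ E}
    (hcont : ∀ n, Continuous (P n)) (hbdd : ∀ x, BddAbove (Set.range fun n => P n x))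
    {u : ℕ → E} {u₀ : E} (hu : Tendsto u atTop (𝓝 u₀)) :
    Tendsto (fun n => P n (u n - u₀)) atTop (𝓝 0) := by
  have hsup : Continuous (⨆ n, ⇑(P n)) :=
    Seminorm.continuous_iSup P hcont (Seminorm.bddAbove_range_iff.2 hbdd)
  have hlim : Tendsto (fun n => (⨆ i, ⇑(P i)) (u n - u₀)) atTop (𝓝 0) := by
    have hzero : (⨆ i, ⇑(P i)) (u₀ - u₀) = 0 := by
      simp only [sub_self, iSup_apply, map_zero, ciSup_const]
    rw [← hzero]
    exact (hsup.tendsto _).comp (hu.sub_const u₀)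
  refine squeeze_zero (fun n => apply_nonneg _ _) (fun n => ?_) hlim
  rw [iSup_apply]
  exact le_ciSup (hbdd (u n - u₀)) n

/-- By the uniform boundedness principle, consistent discretizations of `A` are stable. -/
theorem tendsto_discretization_sub (hm : 1 ≤ m) (hC : 2 ≤ C)
    {A : Lp ℝ 2 μΩ →ₗ[ℝ] Lp ℝ 2 μΩ} {A' : ∀ n : ℕ, (M m n → ℝ) →ₗ[ℝ] (K m C n → ℝ)}
    (hA : ∀ u : Lp ℝ 2 μΩ, Tendsto
      (fun n => arrayNorm₂ fun k : K m C n => T m n (A u) (toM k) - A' n (T m n u) k)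
      atTop (𝓝 0)) {u : ℕ → Lp ℝ 2 μΩ} {u₀ : Lp ℝ 2 μΩ} (hu : Tendsto u atTop (𝓝 u₀)) :
    Tendsto (fun n => arrayNorm₂ (A' n (T m n (u n) - T m n u₀))) atTop (𝓝 0) := by
  let P (n : ℕ) : Seminorm ℝ (Lp ℝ 2 μΩ) :=
    (arraySeminorm m C n).comp (A' n ∘ₗ (sampleCLM hm n).toLinearMap)
  have hcont (n : ℕ) : Continuous (P n) := continuous_arraySeminorm.comp
    ((A' n).continuous_of_finiteDimensional.comp (sampleCLM hm n).continuous)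
  have hbdd (v : Lp ℝ 2 μΩ) : BddAbove (Set.range fun n => P n v) := by
    obtain ⟨c, hc⟩ := ((tendsto_arrayNorm₂_T (C := C) hm hC (A v)).add (hA v)).bddAbove_range
    refine ⟨c, Set.forall_mem_range.2 fun n => le_trans ?_ (hc ⟨n, rfl⟩)⟩
    exact le_map_add_map_sub' (arraySeminorm m C n) (A' n (T m n v)) fun k => T m n (A v) (toM k)
  simpa only [P, Seminorm.comp_apply, LinearMap.comp_apply, ContinuousLinearMap.coe_coe, map_sub,
    sampleCLM_apply, arraySeminorm_apply] using tendsto_seminorm_sub_of_bddAbove hcont hbdd hu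

theorem tendsto_data_term (hm : 1 ≤ m) (hC : 2 ≤ C) {A : Lp ℝ 2 μΩ →ₗ[ℝ] Lp ℝ 2 μΩ}
    {A' : ∀ n : ℕ, (M m n → ℝ) →ₗ[ℝ] (K m C n → ℝ)}
    (hA : ∀ u : Lp ℝ 2 μΩ, Tendsto
      (fun n => arrayNorm₂ fun k : K m C n => T m n (A u) (toM k) - A' n (T m n u) k)
      atTop (𝓝 0)) (f : Lp ℝ 2 μΩ) {u : ℕ → Lp ℝ 2 μΩ} {u₀ : Lp ℝ 2 μΩ}
    (hu : Tendsto u atTop (𝓝 u₀)) :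
    Tendsto (fun n => arrayNorm₂ fun k : K m C n => A' n (T m n (u n)) k - T m n f (toM k)) atTop
      (𝓝 ‖A u₀ - f‖) := by
  have hsmall := (tendsto_discretization_sub hm hC hA hu).add (hA u₀)
  rw [add_zero] at hsmall
  refine tendsto_of_tendsto_of_dist (tendsto_arrayNorm₂_T (C := C) hm hC (A u₀ - f))
    (squeeze_zero (fun _ => dist_nonneg) (fun n => ?_) hsmall)
  have hsplit : (fun k : K m C n => T m n (A u₀ - f : Lp ℝ 2 μΩ) (toM k)) -
      (fun k => A' n (T m n (u n)) k - T m n f (toM k)) =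
      (fun k => T m n (A u₀) (toM k) - A' n (T m n u₀) k) -
        A' n (T m n (u n) - T m n u₀) := by
    funext k
    rw [T_coe_sub hm, map_sub]
    simp only [Pi.sub_apply]
    ring
  simp only [← arraySeminorm_apply]
  rw [Real.dist_eq, add_comm]
  refine (abs_sub_map_le_sub (arraySeminorm m C n) _ _).trans ?_
  rw [hsplit]
  exact map_sub_le_add _ _ _

end

/-! ### Convergence of the energies -/

theorem toL2_coe_ae {p : ℝ≥0∞} {u : Lp ℝ p μΩ} (hu : MemLp u 2 μΩ) :
    (toL2 u : ℝ × ℝ → ℝ) =ᵐ[μΩ] u := by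
  rw [toL2, dif_pos hu]
  exact hu.coeFn_toLp

section

variable {m C J : ℕ} {α : Fin J → ℕ × ℕ} {p q : ℝ≥0∞} [hp1 : Fact (1 ≤ p)] [hq1 : Fact (1 ≤ q)]

theorem one_le_order (hJ : 1 ≤ J) (hα : ∀ j, α j ≠ (0, 0)) : 1 ≤ order α := by
  refine le_trans ?_ (ord_le_order α ⟨0, hJ⟩)
  by_contra hlt
  refine hα ⟨0, hJ⟩ (Prod.ext ?_ ?_) <;> simp only <;> omega

theorem tendsto_toL2 {k : ℕ} (hk : 1 ≤ k) {u : ℕ → Sobolev k p} {u₀ : Sobolev k p}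
    (h : Tendsto u atTop (𝓝 u₀)) :
    Tendsto (fun n => toL2 (fn (u n))) atTop (𝓝 (toL2 (fn u₀))) := by
  have hae (u : Sobolev k p) : (toL2 (fn u) : ℝ × ℝ → ℝ) =ᵐ[μΩ] fn u :=
    toL2_coe_ae (memLp_fn hk (le_max_left _ _) u)
  rw [Lp.tendsto_Lp_iff_tendsto_eLpNorm']
  exact (tendsto_eLpNorm_fn_sub hk h (le_max_left _ _)).congr fun n =>
    eLpNorm_congr_ae ((hae _).symm.sub (hae _).symm)

theorem memLp_wderiv_sub_fn (hs : 1 ≤ order α) (hp : p ≤ max 2 q) (w : Space α p q) (j : Fin J) :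
    MemLp (fun x => wderiv w.1 (α j) (ord_le_two_order α j) x - fn (w.2 j) x) p μΩ :=
  (Lp.memLp _).sub (memLp_fn hs hp _)

theorem tendsto_eLpNorm_wderiv_sub_fn (hs : 1 ≤ order α) (hp : p ≤ max 2 q)
    {w : ℕ → Space α p q} {w₀ : Space α p q} (hw : Tendsto w atTop (𝓝 w₀)) (j : Fin J) :
    Tendsto (fun n => eLpNorm
      ((fun x => wderiv (w n).1 (α j) (ord_le_two_order α j) x - fn ((w n).2 j) x) -
        fun x => wderiv w₀.1 (α j) (ord_le_two_order α j) x - fn (w₀.2 j) x) p μΩ)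
      atTop (𝓝 0) := by
  have hw₁ : Tendsto (fun n => (w n).1) atTop (𝓝 w₀.1) := (continuous_fst.tendsto _).comp hw
  have hw₂ : Tendsto (fun n => (w n).2 j) atTop (𝓝 (w₀.2 j)) :=
    (((continuous_apply j).comp continuous_snd).tendsto _).comp hw
  have hsum := (tendsto_eLpNorm_wderiv_sub hw₁ (α j) (ord_le_two_order α j)).add
    (tendsto_eLpNorm_fn_sub hs hw₂ hp)
  rw [add_zero] at hsum
  refine tendsto_of_tendsto_of_tendsto_of_le_of_le tendsto_const_nhds hsum (fun _ => zero_le)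
    fun n => ?_
  refine le_trans (le_of_eq (congrArg (eLpNorm · p μΩ) ?_)) (eLpNorm_sub_le
    ((Lp.aestronglyMeasurable _).sub (Lp.aestronglyMeasurable _))
    ((Lp.aestronglyMeasurable _).sub (Lp.aestronglyMeasurable _)) hp1.out)
  exact sub_sub_sub_comm _ _ _ _

theorem W'_sub_S_eq_samp (hm : 1 ≤ m) (hC : 2 ≤ C) {j : Fin J} (hj : (α j).1 ≤ m ∧ (α j).2 ≤ m)
    {n : ℕ} (w : Space α p q) (k : K m C n) :
    W' m C n α (T m n (fn w.1)) j k - S m n α (fun j => fn (w.2 j)) j (toM k) =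
      samp (smear m (α j).1 (phi₁ m)) (smear m (α j).2 (phi₁ m)) n
        (fun x => wderiv w.1 (α j) (ord_le_two_order α j) x - fn (w.2 j) x) k := by
  rw [W'_T_eq_samp hm hC hj (integrable_coe _) (integrable_coe _)
    (hasWeakDeriv_wderiv w.1 (α j) (ord_le_two_order α j)), S_eq_samp hm hj,
    samp_sub (isSampler_smear_phi₁ hm hj.1).bddSupp (isSampler_smear_phi₁ hm hj.2).bddSupp
      (integrable_coe _) (integrable_coe _)]
  rfl

theorem tendsto_first_term (hm : 1 ≤ m) (hC : 2 ≤ C) (hα : ∀ j, (α j).1 ≤ m ∧ (α j).2 ≤ m)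
    (hs : 1 ≤ order α) (hp : p ≤ max 2 q) (hp' : p ≠ ⊤) {w : ℕ → Space α p q} {w₀ : Space α p q}
    (hw : Tendsto w atTop (𝓝 w₀)) :
    Tendsto (fun n => arrayNorm p fun (j : Fin J) (k : K m C n) =>
        W' m C n α (T m n (fn (w n).1)) j k - S m n α (fun j => fn ((w n).2 j)) j (toM k)) atTop
      (𝓝 (vecNorm p fun j x =>
        wderiv w₀.1 (α j) (ord_le_two_order α j) x - fn (w₀.2 j) x)) := by
  simp only [arrayNorm_eq_vecNorm hm (one_pos.trans_le hp1.out).ne' hp',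
    W'_sub_S_eq_samp hm hC (hα _)]
  exact tendsto_vecNorm hp1.out hp' (fun n j => memLp_step _ p) (memLp_wderiv_sub_fn hs hp w₀)
    fun j => tendsto_step_samp hm hC (isSampler_smear_phi₁ hm (hα j).1)
      (isSampler_smear_phi₁ hm (hα j).2) hp1.out hp' (fun n => memLp_wderiv_sub_fn hs hp (w n) j)
      (memLp_wderiv_sub_fn hs hp w₀ j) (tendsto_eLpNorm_wderiv_sub_fn hs hp hw j)

theorem tendsto_second_term (hm : 1 ≤ m) (hC : 2 ≤ C) (hα : ∀ j, (α j).1 ≤ m ∧ (α j).2 ≤ m)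
    (hq : q ≠ ⊤) {v : ℕ → Fin J → Sobolev (order α) q} {v₀ : Fin J → Sobolev (order α) q}
    (hv : Tendsto v atTop (𝓝 v₀)) :
    Tendsto (fun n => arrayNorm q (W'' m C n α (S m n α fun j => fn (v n j)))) atTop
      (𝓝 (vecNorm q fun (ij : Fin J × Fin J) x =>
        wderiv (v₀ ij.2) (α ij.1) (ord_le_order α ij.1) x)) := by
  simp only [arrayNorm_eq_vecNorm hm (one_pos.trans_le hq1.out).ne' hq]
  refine tendsto_vecNorm hq1.out hq (fun n j => memLp_step _ q) (fun _ => Lp.memLp _) ?_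
  rintro ⟨i, j⟩
  have hsamp (n : ℕ) := funext fun k : K m C n =>
    W''_S_eq_samp hm hC hα (v := fun j => fn (v n j)) (integrable_coe _) (integrable_coe _)
      (hasWeakDeriv_wderiv (v n j) (α i) (ord_le_order α i)) k
  simp only [hsamp]
  have hvj : Tendsto (fun n => v n j) atTop (𝓝 (v₀ j)) :=
    ((continuous_apply j).tendsto _).comp hv
  exact tendsto_step_samp hm hC (isSampler_smear_smear_phi₁ hm (hα j).1 (hα i).1)
    (isSampler_smear_smear_phi₁ hm (hα j).2 (hα i).2) hq1.out hq (fun n => Lp.memLp _)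
    (Lp.memLp _) (tendsto_eLpNorm_wderiv_sub hvj (α i) (ord_le_order α i))

theorem tendsto_En (hm : 1 ≤ m) (hC : 2 ≤ C) (hα : ∀ j, (α j).1 ≤ m ∧ (α j).2 ≤ m)
    (hs : 1 ≤ order α) (hp : p ≤ max 2 q) (hq : q ≠ ⊤) (ν₁ ν₂ : ℝ)
    {A : Lp ℝ 2 μΩ →ₗ[ℝ] Lp ℝ 2 μΩ} (f : Lp ℝ 2 μΩ)
    {A' : ∀ n : ℕ, (M m n → ℝ) →ₗ[ℝ] (K m C n → ℝ)}
    (hA : ∀ u : Lp ℝ 2 μΩ, Tendsto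
      (fun n => arrayNorm₂ fun k : K m C n => T m n (A u) (toM k) - A' n (T m n u) k)
      atTop (𝓝 0)) {w : ℕ → Space α p q} {w₀ : Space α p q} (hw : Tendsto w atTop (𝓝 w₀)) :
    Tendsto (fun n => En m C n α p q ν₁ ν₂ (A' n) f (w n)) atTop
      (𝓝 (E α p q ν₁ ν₂ A f w₀)) := by
  have hk : 1 ≤ 2 * order α := by omega
  have hp' : p ≠ ⊤ := (hp.trans_lt (max_lt ENNReal.ofNat_lt_top hq.lt_top)).ne
  have hu : Tendsto (fun n => (w n).1) atTop (𝓝 w₀.1) := (continuous_fst.tendsto _).comp hw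
  have hv : Tendsto (fun n => (w n).2) atTop (𝓝 w₀.2) := (continuous_snd.tendsto _).comp hw
  have hT (n : ℕ) : T m n (toL2 (fn (w n).1)) = T m n (fn (w n).1) :=
    T_congr (toL2_coe_ae (memLp_fn hk (le_max_left _ _) _))
  have hfirst := (tendsto_first_term hm hC hα hs hp hp' hw).rpow_const (p := p.toReal)
    (Or.inr ENNReal.toReal_nonneg)
  have hsecond := (tendsto_second_term hm hC hα hq hv).rpow_const (p := q.toReal)
    (Or.inr ENNReal.toReal_nonneg)
  have hdata := (tendsto_data_term hm hC hA f (tendsto_toL2 hk hu)).pow 2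
  simp only [hT] at hdata
  exact ((hfirst.const_mul ν₁).add (hsecond.const_mul ν₂)).add (hdata.const_mul (1 / 2))

end

theorem GammaConverges.of_tendsto {X : Type} [TopologicalSpace X] {G : ℕ → X → ℝ} {G₀ : X → ℝ}
    (h : ∀ (w : ℕ → X) (w₀ : X), Tendsto w atTop (𝓝 w₀) →
      Tendsto (fun n => G n (w n)) atTop (𝓝 (G₀ w₀))) : GammaConverges G G₀ := by
  have h' (w : ℕ → X) (w₀ : X) (hw : Tendsto w atTop (𝓝 w₀)) :
      Tendsto (fun n => (G n (w n) : EReal)) atTop (𝓝 (G₀ w₀ : EReal)) :=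
    (continuous_coe_real_ereal.tendsto _).comp (h w w₀ hw)
  exact ⟨fun w w₀ hw => (h' w w₀ hw).liminf_eq.ge, fun w₀ => ⟨fun _ => w₀, tendsto_const_nhds,
    (h' _ w₀ tendsto_const_nhds).limsup_eq.le⟩⟩
end

end WaveletFrame

theorem theorem3p1_general (m : ℕ) (hm : 1 ≤ m) (J : ℕ) (α : Fin J → ℕ × ℕ)
    (hα : ∀ j, (α j).1 ≤ m ∧ (α j).2 ≤ m) (hs : 1 ≤ order α) (C : ℕ) (hC : 2 ≤ C)
    (p q : ℝ≥0∞) [Fact (1 ≤ p)] [Fact (1 ≤ q)] (hp : p ≤ max 2 q) (hq : q ≠ ⊤) (ν₁ ν₂ : ℝ)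
    (A : Lp ℝ 2 μΩ →ₗ[ℝ] Lp ℝ 2 μΩ) (f : Lp ℝ 2 μΩ)
    (A' : ∀ n : ℕ, (M m n → ℝ) →ₗ[ℝ] (K m C n → ℝ))
    (hA : ∀ u : Lp ℝ 2 μΩ, Tendsto
      (fun n => arrayNorm₂ (fun k : K m C n => T m n (A u) (toM k) - A' n (T m n u) k))
      atTop (𝓝 0)) :
    (∀ w : Space α p q, MemLp (fn w.1) 2 μΩ ∧ ∀ j, MemLp (fn (w.2 j)) p μΩ) ∧
    (∀ (w : ℕ → Space α p q) (w₀ : Space α p q), Tendsto w atTop (𝓝 w₀) →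
      Tendsto (fun n => En m C n α p q ν₁ ν₂ (A' n) f (w n)) atTop
        (𝓝 (E α p q ν₁ ν₂ A f w₀))) ∧
    GammaConverges (fun n => En m C n α p q ν₁ ν₂ (A' n) f) (E α p q ν₁ ν₂ A f) := by
  have hlim (w : ℕ → Space α p q) (w₀ : Space α p q) (hw : Tendsto w atTop (𝓝 w₀)) :=
    tendsto_En hm hC hα hs hp hq ν₁ ν₂ f hA hw
  exact ⟨fun w => ⟨memLp_fn (by omega) (le_max_left _ _) w.1, fun j => memLp_fn hs hp (w.2 j)⟩,
    hlim, GammaConverges.of_tendsto hlim⟩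

theorem theorem3p1 (m : ℕ) (hm : 1 ≤ m) (J : ℕ) (hJ : 1 ≤ J) (α : Fin J → ℕ × ℕ)
    (hα : ∀ j, α j ≠ (0, 0) ∧ (α j).1 ≤ m ∧ (α j).2 ≤ m)
    (C : ℕ) (hC : 2 ≤ C)
    (p q : ℝ≥0∞) [Fact (1 ≤ p)] [Fact (1 ≤ q)] (hp : p ≤ 2) (hq : q ≤ 2) (ν₁ ν₂ : ℝ)
    (A : Lp ℝ 2 μΩ →ₗ[ℝ] Lp ℝ 2 μΩ) (f : Lp ℝ 2 μΩ)
    (A' : ∀ n : ℕ, (M m n → ℝ) →ₗ[ℝ] (K m C n → ℝ))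
    (hA : ∀ u : Lp ℝ 2 μΩ, Tendsto
      (fun n => arrayNorm₂ (fun k : K m C n => T m n (A u) (toM k) - A' n (T m n u) k))
      atTop (𝓝 0)) :
    -- all terms of the limit energy are finite
    (∀ w : Space α p q, MemLp (fn w.1) 2 μΩ ∧ ∀ j, MemLp (fn (w.2 j)) p μΩ) ∧
    (∀ (w : ℕ → Space α p q) (w₀ : Space α p q), Tendsto w atTop (𝓝 w₀) →
      Tendsto (fun n => En m C n α p q ν₁ ν₂ (A' n) f (w n)) atTop
        (𝓝 (E α p q ν₁ ν₂ A f w₀))) ∧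
    GammaConverges (fun n => En m C n α p q ν₁ ν₂ (A' n) f) (E α p q ν₁ ν₂ A f) := by
  exact theorem3p1_general m hm J α (fun j => (hα j).2) (one_le_order hJ fun j => (hα j).1) C hC
    p q (hp.trans (le_max_left 2 q)) (hq.trans_lt ENNReal.ofNat_lt_top).ne ν₁ ν₂ A f A' hA
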